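/- **Setting.** Fix $k\in\{1,2,3\}$ and $\epsilon,\delta\in\mathbb C$. Consider the multi-affine polynomials (fields $x_1,x_2,x_3,x_4$ in cyclic order around a square, parameters $\alpha_1,\alpha_2\in\mathbb C$) - $H_1^\epsilon$: $(x_1-x_3)(x_2-x_4)+(\alpha_2-\alpha_1)(1-\epsilon^2x_2x_4)$; - $H_2^\epsilon$: $(x_1-x_3)(x_2-x_4)+(\alpha_2-\alpha_1)(x_1+x_2+x_3+x_4)+\alpha_2^2-\alpha_1^2-\frac\epsilon2(\alpha_2-\alpha_1)(2x_2+\alpha_1+\alpha_2)(2x_4+\alpha_1+\alpha_2)-\frac\epsilon2(\alpha_2-\alpha_1)^3$; - $H_3^\epsilon$: $e^{2\alpha_1}(x_1x_2+x_3x_4)-e^{2\alpha_2}(x_1x_4+x_2x_3)+(e^{4\alpha_1}-e^{4\alpha_2})\big(\delta^2+\epsilon^2x_2x_4e^{-2(\alpha_1+\alpha_2)}\big)$; - $Q_1^\epsilon$: $\alpha_1(x_1x_2+x_3x_4)-\alpha_2(x_1x_4+x_2x_3)-(\alpha_1-\alpha_2)(x_1x_3+x_2x_4)+\epsilon^2\alpha_1\alpha_2(\alpha_1-\alpha_2)$;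 - $Q_2^\epsilon$: $\alpha_1(x_1x_2+x_3x_4)-\alpha_2(x_1x_4+x_2x_3)-(\alpha_1-\alpha_2)(x_1x_3+x_2x_4)+\alpha_1\alpha_2(\alpha_1-\alpha_2)\big(1+\epsilon(x_1+x_2+x_3+x_4)-\epsilon^2(\alpha_1^2-\alpha_1\alpha_2+\alpha_2^2)\big)$; - $Q_3^\epsilon$: $\sinh(2\alpha_1)(x_1x_2+x_3x_4)-\sinh(2\alpha_2)(x_1x_4+x_2x_3)-\sinh(2(\alpha_1-\alpha_2))(x_1x_3+x_2x_4)-4\delta^2\epsilon^2\sinh(2\alpha_1)\sinh(2\alpha_2)\sinh(2(\alpha_1-\alpha_2))$. In the *rhombic* equation $H_k^\epsilon$ the vertices $x_1,x_3$ are black and $x_2,x_4$ white. The *trapezoidal* equation ($x_1,x_2$ black, $x_3,x_4$ white) is obtained by $x_2\leftrightarrow x_3$, $\alpha_1\leftrightarrow\alpha_2-\alpha_1$. Black vertices carry $\epsilon$, white vertices carry $0$ in place of $\epsilon$; in particular a face with four black vertices carries $Q_k^\epsilon$, one with four white vertices $Q_k^0$. Let $S\subseteq\{1,\dots,m\}$,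 and colour $\mathbb Z^m$ so that $n$ and $n+e_i$ have different colours iff $i\in S$; let direction $i$ carry a parameter $\alpha_i\in\mathbb C$. Impose on each elementary square in directions $i,j$ the rhombic $H_k^\epsilon$ if $i,j\in S$, the trapezoidal $H_k^\epsilon$ if exactly one of $i,j$ is in $S$, and $Q_k^\epsilon$ (black) or $Q_k^0$ (white) if neither is, with parameters $\alpha_i,\alpha_j$. The elementary cubes with $3$, $1$, $2$ directions in $S$ carry, for $k=1,2,3$, the nine 3D consistent six-tuples: all faces rhombic $H_k^\epsilon$; four trapezoidal $H_k^\epsilon$ faces and two type-Q faces; four trapezoidal and two rhombic $H_k^\epsilon$ faces. (Cubes with no direction in $S$ carry the six-tuple consisting of type-Q equations.) **Lagrangians.** Put $x=f(X)$, where $f(X)=X$ for $k=1$, $f(X)=X(1+\epsilon X)$ for $k=2$, and for $k=3$ $f(X)=2\delta\epsilon\cosh 2X$ if $\epsilon\ne0$, $f(X)=e^{2X}$ if $\epsilon=0$ (at white vertices with $\epsilon=0$). Biquadratics: for $x$ black, $y$ white, $h(x,y;\alpha)=\frac{1-\epsilon^2y^2}2$, resp. $x+y+\alpha-\epsilon(y+\alpha)^2$,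 resp. $-2(xy+\delta^2e^{2\alpha}+\epsilon^2y^2e^{-2\alpha})$; for two black vertices, $h(x,y;\beta)=-\frac12\big(\frac{(x-y)^2}\beta-\epsilon^2\beta\big)$, resp. $-\frac1{2\beta}\big((x-y)^2-\beta^2-2\epsilon\beta^2(x+y)+\epsilon^2\beta^4\big)$, resp. $-\frac{(e^\beta x-e^{-\beta}y)(e^{-\beta}x-e^\beta y)}{\sinh2\beta}-4\delta^2\epsilon^2\sinh2\beta$; for two white vertices the same with $\epsilon=0$. The multivalued leg functions are as follows. - $\psi(x,y;\alpha)$ ($x$ black, $y$ white): $k=1$: $\frac1\epsilon\log\frac{1+\epsilon Y}{1-\epsilon Y}$ (for $\epsilon=0$: $2Y$); $k=2$: $\log\frac{X+Y+\alpha}{1+\epsilon(X-Y-\alpha)}$; $k=3$: $\log\frac{\epsilon e^{2Y-2X}+\delta e^{2\alpha}}{\epsilon e^{2X+2Y}+\delta e^{2\alpha}}$ (for $\epsilon=0$: $\log\frac{e^{2\alpha}}{e^{2X+2Y}+\delta^2e^{2\alpha}}$). - $\bar\psi(y,x;\alpha)$ ($y$ white, $x$ black): $k=1$: $2\frac{X-\epsilon^2\alpha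 Y}{1-\epsilon^2Y^2}$; $k=2$: $\log\big((X+Y+\alpha)(1+\epsilon(X-Y-\alpha))\big)$; $k=3$: $\log\frac{e^{4\alpha}}{(\epsilon e^{2Y-2X}+\delta e^{2\alpha})(\epsilon e^{2X+2Y}+\delta e^{2\alpha})}$ (for $\epsilon=0$: $\log\frac{e^{2\alpha}}{e^{2X+2Y}+\delta^2e^{2\alpha}}$). - $\phi(x,y;\beta)$ (both black; $\bar\phi$ for both white is the same with $\epsilon=0$): $k=1$: $\frac1\epsilon\log\frac{X-Y+\epsilon\beta}{X-Y-\epsilon\beta}$ (for $\epsilon=0$: $\frac{2\beta}{X-Y}$); $k=2$: $\log\frac{(X-Y+\beta)(1+\epsilon(X+Y+\beta))}{(X-Y-\beta)(1+\epsilon(X+Y-\beta))}$; $k=3$: $\log\frac{\sinh(X+Y+\beta)\sinh(X-Y+\beta)}{\sinh(X+Y-\beta)\sinh(X-Y-\beta)}$ (for $\epsilon=0$: $\log\frac{\sinh(X-Y+\beta)}{\sinh(X-Y-\beta)}+2\beta$). A (branch of a) Lagrangian on an edge or diagonal is a holomorphic function, defined near the given values, with - $L(X,Y;\alpha)$, $X$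 black, $Y$ white: $\partial_XL=\psi(x,y;\alpha)$, $\partial_YL=\bar\psi(y,x;\alpha)$, $\partial_\alpha L=\log h(x,y;\alpha)$; - $\Lambda(X,Y;\beta)$, both black: $\partial_X\Lambda=\phi(x,y;\beta)$, $\partial_Y\Lambda=\phi(y,x;\beta)$, $\partial_\beta\Lambda=\log h(x,y;\beta)$; - $\bar\Lambda(X,Y;\beta)$, both white: the same with $\bar\phi$ and $\epsilon=0$, each equality meaning "is a value of"; $\Lambda,\bar\Lambda$ are moreover extended to be symmetric in the two vertices and odd in $\beta$. The parameter of an edge in direction $i$ is $\alpha_i$, that of the diagonal from $n+e_i$ to $n+e_j$ is $\alpha_i-\alpha_j$, except that it is $\alpha_j-\alpha_i$ if $i\notin S$, $j\in S$. The two derivatives $\partial_\alpha,\partial_\beta$ are required at the parameters of the squares in directions $i<j$ (for the reversed orientation use oddness). The discrete Lagrangian two-form $\mathcal L(X,X_1,X_2;\alpha_1,\alpha_2)$ on a square with vertices $X,X_1,X_{12},X_2$ is - (a) $X$ black, $X_1,X_2$ white: $L(X,X_1;\alpha_1)-L(X,X_2;\alpha_2)-\bar\Lambda(X_1,X_2;\alpha_1-\alpha_2)$;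 - (b) $X$ white, $X_1,X_2$ black: $L(X_1,X;\alpha_1)-L(X_2,X;\alpha_2)-\Lambda(X_1,X_2;\alpha_1-\alpha_2)$; - (c) $X,X_2$ black, $X_1$ white: $L(X,X_1;\alpha_1)-\Lambda(X,X_2;\alpha_2)-L(X_2,X_1;\alpha_1-\alpha_2)$; - (d) $X,X_2$ white, $X_1$ black: $L(X_1,X;\alpha_1)-\bar\Lambda(X,X_2;\alpha_2)-L(X_1,X_2;\alpha_1-\alpha_2)$; - (e) $X,X_1$ black, $X_2$ white: $\Lambda(X,X_1;\alpha_1)-L(X,X_2;\alpha_2)+L(X_1,X_2;\alpha_2-\alpha_1)$; - (f) $X,X_1$ white, $X_2$ black: $\bar\Lambda(X,X_1;\alpha_1)-L(X_2,X;\alpha_2)+L(X_2,X_1;\alpha_2-\alpha_1)$; - (g) all black: $\Lambda(X,X_1;\alpha_1)-\Lambda(X,X_2;\alpha_2)-\Lambda(X_1,X_2;\alpha_1-\alpha_2)$; - (h) all white: $\bar\Lambda(X,X_1;\alpha_1)-\bar\Lambda(X,X_2;\alpha_2)-\bar\Lambda(X_1,X_2;\alpha_1-\alpha_2)$. The action of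 a finite quad-surface $\Sigma$ (a finite integral combination of oriented elementary squares of $\mathbb Z^m$) is $S(\Sigma)=\sum_{\sigma\in\Sigma}\mathcal L(\sigma)$; a flip along an elementary cube replaces a part of the boundary of the cube by the complementary part, i.e. changes $\Sigma$ by plus or minus the oriented boundary of the cube. A solution is called *regular* on a set of squares if, at their vertices, $f'(X)\neq0$ and, on their edges and diagonals, the biquadratics $h$ above are well defined and non-zero (in particular $\beta\ne0$, resp. $\sinh2\beta\neq0$ if $k=3$, on pairs of equal colour). **Theorem.** 1. Let $C$ be an elementary cube of $\mathbb Z^m$ in directions $i<j<l$, and let $X^0,\alpha^0$ be a regular solution of the six equations on its faces. The Lagrangians on the edges and diagonals of $C$ can be chosen so that, for all $(X,\alpha)$ near $(X^0,\alpha^0)$ which solve the six equations, $$\Delta_i\mathcal L(X,X_j,X_l;\alpha_j,\alpha_l)+\Delta_j\mathcal L(X,X_l,X_i;\alpha_l,\alpha_i)+\Delta_l\mathcal L(X,X_i,X_j;\alpha_i,\alpha_j)=0,$$ where $\Delta_i$ is the difference of the values on the shifted square (by $e_i$) and on the original one; and the action is invariant under flips along $C$. 2. Let $X^0$ be a solution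 on the whole of $\mathbb Z^m$ with parameters $\alpha^0$ which is regular on all squares. The Lagrangians on all edges and on all diagonals from $n+e_i$ to $n+e_j$ of $\mathbb Z^m$ can be chosen simultaneously so that, for every elementary cube, the same relation holds, and the action of every quad-surface is invariant under flips along that cube, for all fields $X$ near $X^0$ which solve (with parameters $\alpha^0$) the equations on the faces of the cube. -/

import Mathlib

open Complex Filter Topology

noncomputable section

namespace QuadLagr

/-- The three families of quad-equations `H_k^ε`, `Q_k^ε`, `k = 1, 2, 3`. -/
inductive Family where
  | I
  | II
  | III

/-! ## Quad-equations on one square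

`ε`, `δ` are the constants of the list, `a = α₁`, `b = α₂` the parameters of the two
pairs of opposite edges; `x₁, x₂, x₃, x₄` are the fields in cyclic order around the square. -/

/-- The polynomial `H_k^ε` in its rhombic version: `x₁, x₃` black, `x₂, x₄` white. -/
def polyH (k : Family) (ε δ a b x₁ x₂ x₃ x₄ : ℂ) : ℂ :=
  match k with
  | .I => (x₁ - x₃) * (x₂ - x₄) + (b - a) * (1 - ε ^ 2 * x₂ * x₄)
  | .II => (x₁ - x₃) * (x₂ - x₄) + (b - a) * (x₁ + x₂ + x₃ + x₄) + b ^ 2 - a ^ 2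
      - ε / 2 * (b - a) * (2 * x₂ + a + b) * (2 * x₄ + a + b) - ε / 2 * (b - a) ^ 3
  | .III => exp (2 * a) * (x₁ * x₂ + x₃ * x₄) - exp (2 * b) * (x₁ * x₄ + x₂ * x₃)
      + (exp (4 * a) - exp (4 * b)) * (δ ^ 2 + ε ^ 2 * x₂ * x₄ / exp (2 * (a + b)))

/-- The trapezoidal version of `H_k^ε`: `x₁, x₂` black, `x₃, x₄` white. It is obtained from the
rhombic one by `x₂ ↔ x₃`, `α₁ ↔ α₂ - α₁`; the edges `x₁x₂`, `x₃x₄` carry `a`. -/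
def polyTrap (k : Family) (ε δ a b x₁ x₂ x₃ x₄ : ℂ) : ℂ :=
  polyH k ε δ (b - a) b x₁ x₃ x₂ x₄

/-- The polynomial `Q_k^ε`. -/
def polyQ (k : Family) (ε δ a b x₁ x₂ x₃ x₄ : ℂ) : ℂ :=
  match k with
  | .I => a * (x₁ * x₂ + x₃ * x₄) - b * (x₁ * x₄ + x₂ * x₃) - (a - b) * (x₁ * x₃ + x₂ * x₄)
      + ε ^ 2 * a * b * (a - b)
  | .II => a * (x₁ * x₂ + x₃ * x₄) - b * (x₁ * x₄ + x₂ * x₃) - (a - b) * (x₁ * x₃ + x₂ * x₄)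
      + a * b * (a - b) + ε * a * b * (a - b) * (x₁ + x₂ + x₃ + x₄)
      - ε ^ 2 * a * b * (a - b) * (a ^ 2 - a * b + b ^ 2)
  | .III => sinh (2 * a) * (x₁ * x₂ + x₃ * x₄) - sinh (2 * b) * (x₁ * x₄ + x₂ * x₃)
      - sinh (2 * (a - b)) * (x₁ * x₃ + x₂ * x₄)
      - 4 * δ ^ 2 * ε ^ 2 * sinh (2 * a) * sinh (2 * b) * sinh (2 * (a - b))

/-- The uniformizing change of variables `x = f(X)` at a vertex. It is used with the constant
`ε` of the system at black vertices and with `ε = 0` at white vertices. -/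
def unif (k : Family) (ε δ X : ℂ) : ℂ :=
  match k with
  | .I => X
  | .II => X * (1 + ε * X)
  | .III => if ε = 0 then exp (2 * X) else 2 * δ * ε * cosh (2 * X)

/-- The degenerate (rescaled) biquadratic `h^{1,2}(x, y; α)` of `H_k^ε`, `x` black, `y` white. -/
def hShort (k : Family) (ε δ α x y : ℂ) : ℂ :=
  match k with
  | .I => (1 - ε ^ 2 * y ^ 2) / 2
  | .II => x + y + α - ε * (y + α) ^ 2
  | .III => -2 * (x * y + δ ^ 2 * exp (2 * α) + ε ^ 2 * y ^ 2 / exp (2 * α))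

/-- The non-degenerate (rescaled) biquadratic `h^{1,3}(x, y; β)` of `H_k^ε` on two black vertices.
With `ε = 0` it is the biquadratic `h^{2,4}` on two white vertices. -/
def hLong (k : Family) (ε δ β x y : ℂ) : ℂ :=
  match k with
  | .I => -(1 / 2) * ((x - y) ^ 2 / β - ε ^ 2 * β)
  | .II => -(1 / (2 * β)) *
      ((x - y) ^ 2 - β ^ 2 - 2 * ε * β ^ 2 * (x + y) + ε ^ 2 * β ^ 4)
  | .III => -((exp β * x - exp (-β) * y) * (exp (-β) * x - exp β * y) / sinh (2 * β))
      - 4 * δ ^ 2 * ε ^ 2 * sinh (2 * β)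

/-! ## Leg functions

The leg functions are multivalued (they contain logarithms). For each of them we define the
predicate "`w` is one of its values". -/

/-- `w` is a value of `ψ(x, y; α)`: `X` belongs to the black centre, `Y` to a white vertex. -/
def IsPsi (k : Family) (ε δ α X Y w : ℂ) : Prop :=
  match k with
  | .I => if ε = 0 then w = 2 * Y else exp (ε * w) = (1 + ε * Y) / (1 - ε * Y)
  | .II => exp w = (X + Y + α) / (1 + ε * (X - Y - α))
  | .III =>
      if ε = 0 then exp w = exp (2 * α) / (exp (2 * X + 2 * Y) + δ ^ 2 * exp (2 * α))
      else exp w = (ε * exp (2 * Y - 2 * X) + δ * exp (2 * α)) /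
        (ε * exp (2 * X + 2 * Y) + δ * exp (2 * α))

/-- `w` is a value of `ψ̄(y, x; α)`: `Y` belongs to the white centre, `X` to a black vertex. -/
def IsPsiBar (k : Family) (ε δ α Y X w : ℂ) : Prop :=
  match k with
  | .I => w = 2 * (X - ε ^ 2 * α * Y) / (1 - ε ^ 2 * Y ^ 2)
  | .II => exp w = (X + Y + α) * (1 + ε * (X - Y - α))
  | .III =>
      if ε = 0 then exp w = exp (2 * α) / (exp (2 * X + 2 * Y) + δ ^ 2 * exp (2 * α))
      else exp w = exp (4 * α) / ((ε * exp (2 * Y - 2 * X) + δ * exp (2 * α)) *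
        (ε * exp (2 * X + 2 * Y) + δ * exp (2 * α)))

/-- `w` is a value of `φ(x, y; β)`, with `X` at the centre, both vertices black. With `ε = 0`
this is the leg function `φ̄` for two white vertices. -/
def IsPhi (k : Family) (ε β X Y w : ℂ) : Prop :=
  match k with
  | .I =>
      if ε = 0 then w = 2 * β / (X - Y)
      else exp (ε * w) = (X - Y + ε * β) / (X - Y - ε * β)
  | .II => exp w = ((X - Y + β) * (1 + ε * (X + Y + β))) /
      ((X - Y - β) * (1 + ε * (X + Y - β)))
  | .III =>
      if ε = 0 then exp (w - 2 * β) = sinh (X - Y + β) / sinh (X - Y - β)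
      else exp w = (sinh (X + Y + β) * sinh (X - Y + β)) /
        (sinh (X + Y - β) * sinh (X - Y - β))

/-! ## Systems on `ℤ^m` -/

abbrev Lattice (m : ℕ) := Fin m → ℤ

/-- The neighbour `n + e_i`. -/
def step {m : ℕ} (n : Lattice m) (i : Fin m) : Lattice m := n + Pi.single i 1

/-- A black-and-white system of quad-equations on `ℤ^m`. The vertices `n` and `n + e_i` have
different colours iff `i ∈ S`; `c` fixes the colour of the origin. For an elementary cube in
directions `i, j, l` the number of these directions in `S` decides the biquadratics pattern:
three: all faces rhombic `H`; one: four trapezoidal `H` faces and two `Q` faces;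
two: four trapezoidal and two rhombic `H` faces; none: all faces `Q`. -/
structure QuadSystem (m : ℕ) where
  k : Family
  ε : ℂ
  δ : ℂ
  S : Finset (Fin m)
  c : ℤ

variable {m : ℕ}

/-- `true` for black vertices, `false` for white ones. -/
def QuadSystem.black (s : QuadSystem m) (n : Lattice m) : Bool :=
  decide (Even (s.c + ∑ i ∈ s.S, n i))

/-- The value of `ε` carried by a vertex: black vertices carry `ε`, white ones `0`. -/
def QuadSystem.epsAt (s : QuadSystem m) (n : Lattice m) : ℂ := if s.black n then s.ε else 0

/-- The field `x_n = f_n(X_n)`. -/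
def QuadSystem.field (s : QuadSystem m) (X : Lattice m → ℂ) (n : Lattice m) : ℂ :=
  unif s.k (s.epsAt n) s.δ (X n)

/-- The left-hand side of the quad-equation on the square `(n, n+e_i, n+e_i+e_j, n+e_j)`. -/
def QuadSystem.face (s : QuadSystem m) (X : Lattice m → ℂ) (α : Fin m → ℂ)
    (n : Lattice m) (i j : Fin m) : ℂ :=
  let x := s.field X n
  let xi := s.field X (step n i)
  let xj := s.field X (step n j)
  let xij := s.field X (step (step n i) j)
  match s.black n, decide (i ∈ s.S), decide (j ∈ s.S) with
  | true, true, true => polyH s.k s.ε s.δ (α i) (α j) x xi xij xj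
  | false, true, true => polyH s.k s.ε s.δ (α i) (α j) xi x xj xij
  | true, true, false => polyTrap s.k s.ε s.δ (α j) (α i) x xj xij xi
  | false, true, false => polyTrap s.k s.ε s.δ (α j) (α i) xi xij xj x
  | true, false, true => polyTrap s.k s.ε s.δ (α i) (α j) x xi xij xj
  | false, false, true => polyTrap s.k s.ε s.δ (α i) (α j) xj xij xi x
  | true, false, false => polyQ s.k s.ε s.δ (α i) (α j) x xi xij xj
  | false, false, false => polyQ s.k 0 s.δ (α i) (α j) x xi xij xj

/-- The parameter carried by the diagonals of a square in directions `i, j`. -/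
def QuadSystem.diagParam (s : QuadSystem m) (α : Fin m → ℂ) (i j : Fin m) : ℂ :=
  if i ∉ s.S ∧ j ∈ s.S then α j - α i else α i - α j

/-- An elementary square of `ℤ^m` with base point `n` and directions `i < j`, oriented by `(i, j)`. -/
structure Square (m : ℕ) where
  n : Lattice m
  i : Fin m
  j : Fin m
  lt : i < j

/-- An elementary cube of `ℤ^m` with base point `n` and directions `i < j < l`. -/
structure Cube (m : ℕ) where
  n : Lattice m
  i : Fin m
  j : Fin m
  l : Fin m
  ij : i < j
  jl : j < l

/-- The six faces of a cube. -/
def Cube.faces (C : Cube m) : Set (Square m) :=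
  {⟨C.n, C.i, C.j, C.ij⟩, ⟨step C.n C.l, C.i, C.j, C.ij⟩,
   ⟨C.n, C.j, C.l, C.jl⟩, ⟨step C.n C.i, C.j, C.l, C.jl⟩,
   ⟨C.n, C.i, C.l, C.ij.trans C.jl⟩, ⟨step C.n C.j, C.i, C.l, C.ij.trans C.jl⟩}

/-- `X` (in uniformizing variables) solves the quad-equations on all squares of `A`. -/
def QuadSystem.Solves (s : QuadSystem m) (X : Lattice m → ℂ) (α : Fin m → ℂ)
    (A : Set (Square m)) : Prop :=
  ∀ q ∈ A, s.face X α q.n q.i q.j = 0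

/-! ## Regular solutions -/

/-- The biquadratic on the pair of vertices `u, v` with parameter `β`. -/
def QuadSystem.biquad (s : QuadSystem m) (X : Lattice m → ℂ) (u v : Lattice m) (β : ℂ) : ℂ :=
  match s.black u, s.black v with
  | true, true => hLong s.k s.ε s.δ β (s.field X u) (s.field X v)
  | false, false => hLong s.k 0 s.δ β (s.field X u) (s.field X v)
  | true, false => hShort s.k s.ε s.δ β (s.field X u) (s.field X v)
  | false, true => hShort s.k s.ε s.δ β (s.field X v) (s.field X u)

/-- The parameter of a non-degenerate biquadratic is admissible. -/
def ParamOK (k : Family) (β : ℂ) : Prop :=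
  match k with
  | .III => sinh (2 * β) ≠ 0
  | _ => β ≠ 0

/-- The biquadratic on the pair `u, v` is well defined and does not vanish. -/
def QuadSystem.RegularPair (s : QuadSystem m) (X : Lattice m → ℂ) (u v : Lattice m) (β : ℂ) :
    Prop :=
  (s.black u = s.black v → ParamOK s.k β) ∧ s.biquad X u v β ≠ 0

/-- The change of variables `x = f(X)` is locally invertible at the vertex `n`. -/
def QuadSystem.RegularVertex (s : QuadSystem m) (X : Lattice m → ℂ) (n : Lattice m) : Prop :=
  deriv (unif s.k (s.epsAt n) s.δ) (X n) ≠ 0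

/-- Regularity on the squares of `A`: at their four vertices, four edges and two diagonals. -/
def QuadSystem.Regular (s : QuadSystem m) (X : Lattice m → ℂ) (α : Fin m → ℂ)
    (A : Set (Square m)) : Prop :=
  ∀ q ∈ A,
    (s.RegularVertex X q.n ∧ s.RegularVertex X (step q.n q.i) ∧
      s.RegularVertex X (step q.n q.j) ∧ s.RegularVertex X (step (step q.n q.i) q.j)) ∧
    (s.RegularPair X q.n (step q.n q.i) (α q.i) ∧
      s.RegularPair X (step q.n q.j) (step (step q.n q.i) q.j) (α q.i) ∧
      s.RegularPair X q.n (step q.n q.j) (α q.j) ∧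
      s.RegularPair X (step q.n q.i) (step (step q.n q.i) q.j) (α q.j)) ∧
    s.RegularPair X q.n (step (step q.n q.i) q.j) (s.diagParam α q.i q.j) ∧
    s.RegularPair X (step q.n q.i) (step q.n q.j) (s.diagParam α q.i q.j)

/-! ## Lagrangians -/

/-- Near `(X₀, Y₀, β₀)` the function `F(X, Y; β)` is holomorphic, its derivatives in `X` and `Y`
are values of the given leg functions, and its derivative in `β` is a value of `log h`. -/
def IsPotential (F : ℂ → ℂ → ℂ → ℂ) (legX legY : ℂ → ℂ → ℂ → ℂ → Prop)
    (h : ℂ → ℂ → ℂ → ℂ) (X₀ Y₀ β₀ : ℂ) : Prop :=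
  ∀ᶠ z : ℂ × ℂ × ℂ in 𝓝 (X₀, Y₀, β₀), ∃ p q r : ℂ,
    HasFDerivAt (fun y : ℂ × ℂ × ℂ => F y.1 y.2.1 y.2.2)
      (p • ContinuousLinearMap.fst ℂ ℂ (ℂ × ℂ)
        + q • (ContinuousLinearMap.fst ℂ ℂ ℂ).comp (ContinuousLinearMap.snd ℂ ℂ (ℂ × ℂ))
        + r • (ContinuousLinearMap.snd ℂ ℂ ℂ).comp (ContinuousLinearMap.snd ℂ ℂ (ℂ × ℂ))) z ∧
    legX z.1 z.2.1 z.2.2 p ∧ legY z.1 z.2.1 z.2.2 q ∧ exp r = h z.1 z.2.1 z.2.2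

/-- `F(X, Y; α)` is a branch of the Lagrangian `L`; `X` black, `Y` white. -/
def IsL (k : Family) (ε δ : ℂ) (F : ℂ → ℂ → ℂ → ℂ) (X₀ Y₀ α₀ : ℂ) : Prop :=
  IsPotential F (fun X Y α w => IsPsi k ε δ α X Y w) (fun X Y α w => IsPsiBar k ε δ α Y X w)
    (fun X Y α => hShort k ε δ α (unif k ε δ X) (unif k 0 δ Y)) X₀ Y₀ α₀

/-- `F(X, Y; β)` is a branch of the Lagrangian `Λ`; with `ε = 0`, of the Lagrangian `Λ̄`. -/
def IsLam (k : Family) (ε δ : ℂ) (F : ℂ → ℂ → ℂ → ℂ) (X₀ Y₀ β₀ : ℂ) : Prop :=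
  IsPotential F (fun X Y β w => IsPhi k ε β X Y w) (fun X Y β w => IsPhi k ε β Y X w)
    (fun X Y β => hLong k ε δ β (unif k ε δ X) (unif k ε δ Y)) X₀ Y₀ β₀

/-- Lagrangians on the edges and diagonals of `ℤ^m`. `L u v` is the branch of `L` carried by the
pair of a black vertex `u` and a white vertex `v`, as a function of `X_u, X_v` and the parameter;
similarly `Lam u v` for two black vertices and `LamBar u v` for two white ones. -/
structure Lagrangians (m : ℕ) where
  L : Lattice m → Lattice m → ℂ → ℂ → ℂ → ℂ
  Lam : Lattice m → Lattice m → ℂ → ℂ → ℂ → ℂ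
  LamBar : Lattice m → Lattice m → ℂ → ℂ → ℂ → ℂ

/-- Near `(X_u, X_v; β)` the pair `u, v` carries a branch of the Lagrangian of its colour type. -/
def QuadSystem.Carries (s : QuadSystem m) (𝔏 : Lagrangians m) (X : Lattice m → ℂ)
    (u v : Lattice m) (β : ℂ) : Prop :=
  match s.black u, s.black v with
  | true, true => IsLam s.k s.ε s.δ (𝔏.Lam u v) (X u) (X v) β
  | false, false => IsLam s.k 0 s.δ (𝔏.LamBar u v) (X u) (X v) β
  | true, false => IsL s.k s.ε s.δ (𝔏.L u v) (X u) (X v) β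
  | false, true => IsL s.k s.ε s.δ (𝔏.L v u) (X v) (X u) β

/-- `𝔏` is a choice of branches of the Lagrangians on the squares of `A` near `(X, α)`: `Λ`, `Λ̄`
are symmetric in their two vertices and odd in the parameter, and the edges of each square and
its diagonal from `n + e_i` to `n + e_j` carry the Lagrangians of their colour types. -/
def QuadSystem.IsLagrangian (s : QuadSystem m) (𝔏 : Lagrangians m) (X : Lattice m → ℂ)
    (α : Fin m → ℂ) (A : Set (Square m)) : Prop :=
  (∀ u v Y Z β, 𝔏.Lam u v Y Z β = 𝔏.Lam v u Z Y β) ∧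
  (∀ u v Y Z β, 𝔏.LamBar u v Y Z β = 𝔏.LamBar v u Z Y β) ∧
  (∀ u v Y Z β, 𝔏.Lam u v Y Z (-β) = -𝔏.Lam u v Y Z β) ∧
  (∀ u v Y Z β, 𝔏.LamBar u v Y Z (-β) = -𝔏.LamBar u v Y Z β) ∧
  ∀ q ∈ A,
    s.Carries 𝔏 X q.n (step q.n q.i) (α q.i) ∧
    s.Carries 𝔏 X (step q.n q.j) (step (step q.n q.i) q.j) (α q.i) ∧
    s.Carries 𝔏 X q.n (step q.n q.j) (α q.j) ∧
    s.Carries 𝔏 X (step q.n q.i) (step (step q.n q.i) q.j) (α q.j) ∧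
    s.Carries 𝔏 X (step q.n q.i) (step q.n q.j) (s.diagParam α q.i q.j)

/-- The discrete Lagrangian two-form `𝓛(X, X_i, X_j; α_i, α_j)` on the square
`(n, n+e_i, n+e_i+e_j, n+e_j)`, for the eight types (a), ..., (h) of black-and-white squares
(in this order). -/
def QuadSystem.twoForm (s : QuadSystem m) (𝔏 : Lagrangians m) (X : Lattice m → ℂ)
    (α : Fin m → ℂ) (n : Lattice m) (i j : Fin m) : ℂ :=
  let ni := step n i
  let nj := step n j
  match s.black n, decide (i ∈ s.S), decide (j ∈ s.S) with
  | true, true, true =>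
      𝔏.L n ni (X n) (X ni) (α i) - 𝔏.L n nj (X n) (X nj) (α j)
        - 𝔏.LamBar ni nj (X ni) (X nj) (α i - α j)
  | false, true, true =>
      𝔏.L ni n (X ni) (X n) (α i) - 𝔏.L nj n (X nj) (X n) (α j)
        - 𝔏.Lam ni nj (X ni) (X nj) (α i - α j)
  | true, true, false =>
      𝔏.L n ni (X n) (X ni) (α i) - 𝔏.Lam n nj (X n) (X nj) (α j)
        - 𝔏.L nj ni (X nj) (X ni) (α i - α j)
  | false, true, false =>
      𝔏.L ni n (X ni) (X n) (α i) - 𝔏.LamBar n nj (X n) (X nj) (α j)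
        - 𝔏.L ni nj (X ni) (X nj) (α i - α j)
  | true, false, true =>
      𝔏.Lam n ni (X n) (X ni) (α i) - 𝔏.L n nj (X n) (X nj) (α j)
        + 𝔏.L ni nj (X ni) (X nj) (α j - α i)
  | false, false, true =>
      𝔏.LamBar n ni (X n) (X ni) (α i) - 𝔏.L nj n (X nj) (X n) (α j)
        + 𝔏.L nj ni (X nj) (X ni) (α j - α i)
  | true, false, false =>
      𝔏.Lam n ni (X n) (X ni) (α i) - 𝔏.Lam n nj (X n) (X nj) (α j)
        - 𝔏.Lam ni nj (X ni) (X nj) (α i - α j)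
  | false, false, false =>
      𝔏.LamBar n ni (X n) (X ni) (α i) - 𝔏.LamBar n nj (X n) (X nj) (α j)
        - 𝔏.LamBar ni nj (X ni) (X nj) (α i - α j)

/-- `Δ₁ 𝓛(X, X₂, X₃) + Δ₂ 𝓛(X, X₃, X₁) + Δ₃ 𝓛(X, X₁, X₂)` on the cube `C`. -/
def QuadSystem.flipSum (s : QuadSystem m) (𝔏 : Lagrangians m) (X : Lattice m → ℂ)
    (α : Fin m → ℂ) (C : Cube m) : ℂ :=
  (s.twoForm 𝔏 X α (step C.n C.i) C.j C.l - s.twoForm 𝔏 X α C.n C.j C.l) +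
  (s.twoForm 𝔏 X α (step C.n C.j) C.l C.i - s.twoForm 𝔏 X α C.n C.l C.i) +
  (s.twoForm 𝔏 X α (step C.n C.l) C.i C.j - s.twoForm 𝔏 X α C.n C.i C.j)

/-! ## Quad-surfaces and flips -/

/-- A (finite) quad-surface: elementary squares with multiplicities, where `-1` stands for the
orientation `(j, i)`. -/
abbrev QuadSurface (m : ℕ) := Square m →₀ ℤ

/-- The action functional: the sum of the two-form over the surface. -/
def QuadSystem.action (s : QuadSystem m) (𝔏 : Lagrangians m) (X : Lattice m → ℂ)
    (α : Fin m → ℂ) (Sg : QuadSurface m) : ℂ :=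
  Sg.sum fun q a => (a : ℂ) * s.twoForm 𝔏 X α q.n q.i q.j

/-- The oriented boundary of an elementary cube. -/
def Cube.boundary (C : Cube m) : QuadSurface m :=
  (Finsupp.single ⟨step C.n C.i, C.j, C.l, C.jl⟩ 1 - Finsupp.single ⟨C.n, C.j, C.l, C.jl⟩ 1)
  - (Finsupp.single ⟨step C.n C.j, C.i, C.l, C.ij.trans C.jl⟩ 1
      - Finsupp.single ⟨C.n, C.i, C.l, C.ij.trans C.jl⟩ 1)
  + (Finsupp.single ⟨step C.n C.l, C.i, C.j, C.ij⟩ 1 - Finsupp.single ⟨C.n, C.i, C.j, C.ij⟩ 1)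

/-- `Sg'` is obtained from `Sg` by a flip along `C`: a part of the boundary of the cube is replaced
by the complementary part with the same boundary curve, so that the surfaces differ by `± ∂C`. -/
def IsFlip (C : Cube m) (Sg Sg' : QuadSurface m) : Prop :=
  Sg' = Sg + C.boundary ∨ Sg' = Sg - C.boundary

end QuadLagr

end

noncomputable section

namespace QuadLagr

set_option linter.unusedSimpArgs false

section

/-! ## Quad-equations on a coloured square -/

/-! The alternating sum of the two-form over a cube has zero differential along solutions and
vanishes at the given one.

Fields. The Lagrangian of a diagonal has leg functions of the diagonal as derivatives. The three-leg
form of the quad-equation (`three_leg`, `three_leg'`) expresses such a leg as a difference of legs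
on the two edges meeting at its centre. On solutions the differential of the two-form therefore
contains only edge legs in front of the field differentials. In the sum over the cube every such leg
occurs twice with opposite signs, and all field derivatives cancel (`Cube.hasDerivAt_flipSum`).

Parameters. For each parameter there remains an alternating sum of logarithms of biquadratics,
`Cube.clos`. Where a multi-affine polynomial vanishes, the product of two of its partial derivatives
is, up to constants, the biquadratic in the other two fields. Multiplying such products in different
orders yields relations between the biquadratics on opposite pairs (`product_identities`). Combining
them on two faces and on the tetrahedron equation, which is again a quad-equation of the list, gives
`CubeEq.prod_i`, and so `exp` of the sum is `1` (`Cube.exp_clos`). The sum lies in the discrete set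
2πiℤ. If it is zero at the given solution, it stays zero on nearby ones.

Branches. Legs and logarithms are determined only up to discrete periods. The branches on the edges
are chosen freely. Each diagonal of the kind used belongs to a single square, so its branch can be
adjusted until both three-leg relations of that square hold exactly at the given solution
(`exists_lagrangians`); discreteness of the periods extends them to neighbouring solutions. All
Lagrangians are normalised to vanish at the given solution.

Solutions. By 3D consistency the solutions on a cube are locally the graph of a differentiable
function of the fields at the base vertex and its neighbours and of the three parameters
(`exists_cube_solution`). Integration along a segment in this domain gives the closure relation
(`Adapted.eventually_flipSum`). For a single cube the logarithms can be shifted so that the three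
parameter sums vanish (`Cube.exists_logs`). On the whole lattice the parameters are fixed, their
differentials vanish, and no condition on the logarithms is needed. -/

/-- The quad-equation on a square `x, xi, xij, xj` whose base vertex has colour `c` and whose
directions change the colour iff `si`, resp. `sj`. -/
def vquad (k : Family) (ε δ : ℂ) (c si sj : Bool) (a b x xi xij xj : ℂ) : ℂ :=
  match c, si, sj with
  | true, true, true => polyH k ε δ a b x xi xij xj
  | false, true, true => polyH k ε δ a b xi x xj xij
  | true, true, false => polyTrap k ε δ b a x xj xij xi
  | false, true, false => polyTrap k ε δ b a xi xij xj x
  | true, false, true => polyTrap k ε δ a b x xi xij xj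
  | false, false, true => polyTrap k ε δ a b xj xij xi x
  | true, false, false => polyQ k ε δ a b x xi xij xj
  | false, false, false => polyQ k 0 δ a b x xi xij xj

/-- The biquadratic on two vertices of given colours. -/
def pairH (k : Family) (ε δ : ℂ) (cu cv : Bool) (β x y : ℂ) : ℂ :=
  match cu, cv with
  | true, true => hLong k ε δ β x y
  | false, false => hLong k 0 δ β x y
  | true, false => hShort k ε δ β x y
  | false, true => hShort k ε δ β y x

/-- The weight of a parameter; `s` tells whether the two ends have different colours. -/
def weight (k : Family) (s : Bool) (β : ℂ) : ℂ :=
  match k, s with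
  | .III, true => exp (2 * β)
  | .III, false => sinh (2 * β)
  | _, true => 1
  | _, false => β

/-- The parameter of the diagonals. -/
def dpar (si sj : Bool) (a b : ℂ) : ℂ := bif !si && sj then b - a else a - b

/-- The product `weight * pairH`, a polynomial. -/
def pairG (k : Family) (ε δ : ℂ) (cu cv : Bool) (β x y : ℂ) : ℂ :=
  match cu, cv with
  | true, true => longG k ε δ β x y
  | false, false => longG k 0 δ β x y
  | true, false => shortG k ε δ β x y
  | false, true => shortG k ε δ β y x
where
  longG (k : Family) (ε δ β x y : ℂ) : ℂ :=
    match k with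
    | .I => -(1 / 2) * ((x - y) ^ 2 - ε ^ 2 * β ^ 2)
    | .II => -(1 / 2) * ((x - y) ^ 2 - β ^ 2 - 2 * ε * β ^ 2 * (x + y) + ε ^ 2 * β ^ 4)
    | .III => -(x ^ 2 + y ^ 2 - 2 * cosh (2 * β) * x * y) - 4 * δ ^ 2 * ε ^ 2 * sinh (2 * β) ^ 2
  shortG (k : Family) (ε δ β x y : ℂ) : ℂ :=
    match k with
    | .III => exp (2 * β) * hShort .III ε δ β x y
    | k => hShort k ε δ β x y

/-- Clearing the denominator makes the discriminant identities below valid for all parameters; the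
division is undone only where the weight is non-zero. -/
theorem pairG_eq (k : Family) (ε δ : ℂ) (cu cv : Bool) (β x y : ℂ)
    (hw : weight k (xor cu cv) β ≠ 0) :
    pairG k ε δ cu cv β x y = weight k (xor cu cv) β * pairH k ε δ cu cv β x y := by
  have key (e : ℂ) (h : sinh (2 * β) ≠ 0) : pairG.longG .III e δ β x y
      = sinh (2 * β) * hLong .III e δ β x y := by
    simp only [pairG.longG, hLong]
    field_simp
    have h1 : exp β * exp (-β) = 1 := by rw [← exp_add]; simp
    have h2 : cosh (2 * β) = (exp β ^ 2 + exp (-β) ^ 2) / 2 := by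
      rw [cosh, ← exp_nat_mul, ← exp_nat_mul]; push_cast; ring_nf
    rw [h2]
    linear_combination (x ^ 2 + y ^ 2) * h1
  cases k <;> cases cu <;> cases cv <;>
    simp only [Bool.xor_false, Bool.xor_true, Bool.not_true, Bool.not_false, weight, pairG,
      pairG.longG, pairG.shortG, pairH, one_mul] at hw ⊢
  any_goals exact key _ hw
  all_goals
    simp only [hLong]
    field_simp

/-- With the convention that division by zero gives zero, an inadmissible parameter makes the
biquadratic vanish, so non-vanishing alone carries the condition on the parameter. -/
theorem weight_ne_zero_of_pairH {k : Family} {ε δ : ℂ} {cu cv : Bool} {β x y : ℂ}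
    (h : pairH k ε δ cu cv β x y ≠ 0) : weight k (xor cu cv) β ≠ 0 := by
  intro hw
  apply h
  cases k <;> cases cu <;> cases cv <;>
    simp only [Bool.xor_false, Bool.xor_true, Bool.not_true, Bool.not_false, weight,
      one_ne_zero, exp_ne_zero] at hw <;> simp [pairH, hLong, hw]

/-- The normalising constant of the biquadratics. -/
def kap (k : Family) : ℂ :=
  match k with
  | .III => 1
  | _ => 2

/-- `1` if one of the two directions changes the colour, otherwise `-1`. -/
def sg (si sj : Bool) : ℂ := bif si || sj then 1 else -1

/-- `-1` if precisely the second of the directions changes the colour. -/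
def sgd (si sj : Bool) : ℂ := bif !si && sj then -1 else 1

set_option maxHeartbeats 4000000

/-- Degree at most one in each field: the values at `0` and `1` determine the polynomial. This lets
one solve for a vertex and write partial derivatives as differences of values. -/
theorem affine₁ (k : Family) (ε δ : ℂ) (c si sj : Bool) (a b x xi xij xj : ℂ) :
    vquad k ε δ c si sj a b x xi xij xj = (1 - x) * vquad k ε δ c si sj a b 0 xi xij xj
      + x * vquad k ε δ c si sj a b 1 xi xij xj := by
  cases k <;> cases c <;> cases si <;> cases sj <;>
    simp only [vquad, polyH, polyTrap, polyQ] <;> ring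

theorem affine₂ (k : Family) (ε δ : ℂ) (c si sj : Bool) (a b x xi xij xj : ℂ) :
    vquad k ε δ c si sj a b x xi xij xj = (1 - xi) * vquad k ε δ c si sj a b x 0 xij xj
      + xi * vquad k ε δ c si sj a b x 1 xij xj := by
  cases k <;> cases c <;> cases si <;> cases sj <;>
    simp only [vquad, polyH, polyTrap, polyQ] <;> ring

theorem affine₃ (k : Family) (ε δ : ℂ) (c si sj : Bool) (a b x xi xij xj : ℂ) :
    vquad k ε δ c si sj a b x xi xij xj = (1 - xij) * vquad k ε δ c si sj a b x xi 0 xj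
      + xij * vquad k ε δ c si sj a b x xi 1 xj := by
  cases k <;> cases c <;> cases si <;> cases sj <;>
    simp only [vquad, polyH, polyTrap, polyQ] <;> ring

theorem affine₄ (k : Family) (ε δ : ℂ) (c si sj : Bool) (a b x xi xij xj : ℂ) :
    vquad k ε δ c si sj a b x xi xij xj = (1 - xj) * vquad k ε δ c si sj a b x xi xij 0
      + xj * vquad k ε δ c si sj a b x xi xij 1 := by
  cases k <;> cases c <;> cases si <;> cases sj <;>
    simp only [vquad, polyH, polyTrap, polyQ] <;> ring

/-- Reflection of the square in the diagonal from `x` to `xij`. Faces with exactly one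
colour-changing direction use the same polynomial for both orders; the others are antisymmetric. -/
theorem vquad_swap (k : Family) (ε δ : ℂ) (c si sj : Bool) (a b x xi xij xj : ℂ) :
    vquad k ε δ c sj si b a x xj xij xi
      = (bif xor si sj then 1 else -1) * vquad k ε δ c si sj a b x xi xij xj := by
  cases k <;> cases c <;> cases si <;> cases sj <;>
    simp only [vquad, polyH, polyTrap, polyQ, Bool.xor_false, Bool.xor_true, Bool.not_true,
      Bool.not_false, cond_true, cond_false, one_mul, mul_sub, sinh_sub, mul_add, exp_add] <;> ring

end

/-! ### Biquadratics as discriminants, and elimination on a cube -/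

section

set_option maxHeartbeats 4000000

theorem exp_two_mul_sub (a b : ℂ) : exp (2 * (a - b)) = exp (2 * a) / exp (2 * b) := by
  rw [mul_sub, exp_sub]

/-- Only `exp (2 * a)` and `exp (2 * b)` occur, so that the identities for the third family become
identities of rational functions. -/
theorem polyH_III (ε δ a b x₁ x₂ x₃ x₄ : ℂ) : polyH .III ε δ a b x₁ x₂ x₃ x₄ =
    exp (2 * a) * (x₁ * x₂ + x₃ * x₄) - exp (2 * b) * (x₁ * x₄ + x₂ * x₃)
      + (exp (2 * a) ^ 2 - exp (2 * b) ^ 2) *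
        (δ ^ 2 + ε ^ 2 * x₂ * x₄ / (exp (2 * a) * exp (2 * b))) := by
  have h (z : ℂ) : exp (4 * z) = exp (2 * z) ^ 2 := by rw [← exp_nat_mul]; push_cast; ring_nf
  rw [polyH, h, h, mul_add 2 a b, exp_add]

theorem sinh_eq_exp (a : ℂ) : sinh a = (exp a - (exp a)⁻¹) / 2 := by rw [sinh, exp_neg]

theorem cosh_eq_exp (a : ℂ) : cosh a = (exp a + (exp a)⁻¹) / 2 := by rw [cosh, exp_neg]

/-- On bilinear functions this is `f_u f_v - f f_uv`. -/
def bqd (f : ℂ → ℂ → ℂ) : ℂ := f 1 0 * f 0 1 - f 0 0 * f 1 1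

/-- The discriminant of the quad-polynomial in two fields is the biquadratic in the other two, times
the normalising constant, a sign and the weights of the two parameters that the biquadratic does not
contain. The next five lemmas treat the other pairs of vertices. -/
theorem bqd₁₂ (k : Family) (ε δ : ℂ) (c si sj : Bool) (a b x xi : ℂ) :
    bqd (fun u v => vquad k ε δ c si sj a b x xi u v) =
      sg si sj * kap k * weight k sj b * weight k (xor si sj) (dpar si sj a b) * pairG k ε δ c (xor c si) a x xi := by
  cases k
  case III =>
    have hA := exp_ne_zero (2 * a)
    have hB := exp_ne_zero (2 * b)
    cases c <;> cases si <;> cases sj <;>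
    simp only [vquad, polyTrap, polyQ, bqd, polyH_III, sinh_eq_exp, cosh_eq_exp, exp_two_mul_sub,
      weight, dpar, kap, sg, pairG, pairG.longG, pairG.shortG, hShort,
      Bool.xor_false, Bool.xor_true, Bool.not_true, Bool.and_true, Bool.and_false, Bool.or_true, Bool.or_false,
      Bool.not_false, cond_true, cond_false] <;>
    generalize exp (2 * a) = A at * <;>
    generalize exp (2 * b) = B at * <;>
    field_simp <;> ring
  all_goals
    cases c <;> cases si <;> cases sj <;>
    simp only [vquad, polyH, polyTrap, polyQ, bqd,
      weight, dpar, kap, sg, pairG, pairG.longG, pairG.shortG, hShort,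
      Bool.xor_false, Bool.xor_true, Bool.not_true, Bool.and_true, Bool.and_false, Bool.or_true, Bool.or_false,
      Bool.not_false, cond_true, cond_false] <;> ring

theorem bqd₃₄ (k : Family) (ε δ : ℂ) (c si sj : Bool) (a b xij xj : ℂ) :
    bqd (fun u v => vquad k ε δ c si sj a b u v xij xj) =
      sg si sj * kap k * weight k sj b * weight k (xor si sj) (dpar si sj a b) * pairG k ε δ (xor c sj) (xor (xor c si) sj) a xj xij := by
  cases k
  case III =>
    have hA := exp_ne_zero (2 * a)
    have hB := exp_ne_zero (2 * b)
    cases c <;> cases si <;> cases sj <;>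
    simp only [vquad, polyTrap, polyQ, bqd, polyH_III, sinh_eq_exp, cosh_eq_exp, exp_two_mul_sub,
      weight, dpar, kap, sg, pairG, pairG.longG, pairG.shortG, hShort,
      Bool.xor_false, Bool.xor_true, Bool.not_true, Bool.and_true, Bool.and_false, Bool.or_true, Bool.or_false,
      Bool.not_false, cond_true, cond_false] <;>
    generalize exp (2 * a) = A at * <;>
    generalize exp (2 * b) = B at * <;>
    field_simp <;> ring
  all_goals
    cases c <;> cases si <;> cases sj <;>
    simp only [vquad, polyH, polyTrap, polyQ, bqd,
      weight, dpar, kap, sg, pairG, pairG.longG, pairG.shortG, hShort,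
      Bool.xor_false, Bool.xor_true, Bool.not_true, Bool.and_true, Bool.and_false, Bool.or_true, Bool.or_false,
      Bool.not_false, cond_true, cond_false] <;> ring

theorem bqd₁₄ (k : Family) (ε δ : ℂ) (c si sj : Bool) (a b x xj : ℂ) :
    bqd (fun u v => vquad k ε δ c si sj a b x u v xj) =
      (bif si && sj then -1 else 1) * kap k * weight k si a * weight k (xor si sj) (dpar si sj a b) * pairG k ε δ c (xor c sj) b x xj := by
  cases k
  case III =>
    have hA := exp_ne_zero (2 * a)
    have hB := exp_ne_zero (2 * b)
    cases c <;> cases si <;> cases sj <;>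
    simp only [vquad, polyTrap, polyQ, bqd, polyH_III, sinh_eq_exp, cosh_eq_exp, exp_two_mul_sub,
      weight, dpar, kap, sg, pairG, pairG.longG, pairG.shortG, hShort,
      Bool.xor_false, Bool.xor_true, Bool.not_true, Bool.and_true, Bool.and_false, Bool.or_true, Bool.or_false,
      Bool.not_false, cond_true, cond_false] <;>
    generalize exp (2 * a) = A at * <;>
    generalize exp (2 * b) = B at * <;>
    field_simp <;> ring
  all_goals
    cases c <;> cases si <;> cases sj <;>
    simp only [vquad, polyH, polyTrap, polyQ, bqd,
      weight, dpar, kap, sg, pairG, pairG.longG, pairG.shortG, hShort,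
      Bool.xor_false, Bool.xor_true, Bool.not_true, Bool.and_true, Bool.and_false, Bool.or_true, Bool.or_false,
      Bool.not_false, cond_true, cond_false] <;> ring

theorem bqd₂₃ (k : Family) (ε δ : ℂ) (c si sj : Bool) (a b xi xij : ℂ) :
    bqd (fun u v => vquad k ε δ c si sj a b u xi xij v) =
      (bif si && sj then -1 else 1) * kap k * weight k si a * weight k (xor si sj) (dpar si sj a b) * pairG k ε δ (xor c si) (xor (xor c si) sj) b xi xij := by
  cases k
  case III =>
    have hA := exp_ne_zero (2 * a)
    have hB := exp_ne_zero (2 * b)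
    cases c <;> cases si <;> cases sj <;>
    simp only [vquad, polyTrap, polyQ, bqd, polyH_III, sinh_eq_exp, cosh_eq_exp, exp_two_mul_sub,
      weight, dpar, kap, sg, pairG, pairG.longG, pairG.shortG, hShort,
      Bool.xor_false, Bool.xor_true, Bool.not_true, Bool.and_true, Bool.and_false, Bool.or_true, Bool.or_false,
      Bool.not_false, cond_true, cond_false] <;>
    generalize exp (2 * a) = A at * <;>
    generalize exp (2 * b) = B at * <;>
    field_simp <;> ring
  all_goals
    cases c <;> cases si <;> cases sj <;>
    simp only [vquad, polyH, polyTrap, polyQ, bqd,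
      weight, dpar, kap, sg, pairG, pairG.longG, pairG.shortG, hShort,
      Bool.xor_false, Bool.xor_true, Bool.not_true, Bool.and_true, Bool.and_false, Bool.or_true, Bool.or_false,
      Bool.not_false, cond_true, cond_false] <;> ring

theorem bqd₂₄ (k : Family) (ε δ : ℂ) (c si sj : Bool) (a b xi xj : ℂ) :
    bqd (fun u v => vquad k ε δ c si sj a b u xi v xj) =
      (bif xor si sj then -1 else 1) * kap k * weight k si a * weight k sj b * pairG k ε δ (xor c si) (xor c sj) (dpar si sj a b) xi xj := by
  cases k
  case III =>
    have hA := exp_ne_zero (2 * a)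
    have hB := exp_ne_zero (2 * b)
    cases c <;> cases si <;> cases sj <;>
    simp only [vquad, polyTrap, polyQ, bqd, polyH_III, sinh_eq_exp, cosh_eq_exp, exp_two_mul_sub,
      weight, dpar, kap, sg, pairG, pairG.longG, pairG.shortG, hShort,
      Bool.xor_false, Bool.xor_true, Bool.not_true, Bool.and_true, Bool.and_false, Bool.or_true, Bool.or_false,
      Bool.not_false, cond_true, cond_false] <;>
    generalize exp (2 * a) = A at * <;>
    generalize exp (2 * b) = B at * <;>
    field_simp <;> ring
  all_goals
    cases c <;> cases si <;> cases sj <;>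
    simp only [vquad, polyH, polyTrap, polyQ, bqd,
      weight, dpar, kap, sg, pairG, pairG.longG, pairG.shortG, hShort,
      Bool.xor_false, Bool.xor_true, Bool.not_true, Bool.and_true, Bool.and_false, Bool.or_true, Bool.or_false,
      Bool.not_false, cond_true, cond_false] <;> ring

theorem bqd₁₃ (k : Family) (ε δ : ℂ) (c si sj : Bool) (a b x xij : ℂ) :
    bqd (fun u v => vquad k ε δ c si sj a b x u xij v) =
      (bif xor si sj then -1 else 1) * kap k * weight k si a * weight k sj b * pairG k ε δ c (xor (xor c si) sj) (dpar si sj a b) x xij := by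
  cases k
  case III =>
    have hA := exp_ne_zero (2 * a)
    have hB := exp_ne_zero (2 * b)
    cases c <;> cases si <;> cases sj <;>
    simp only [vquad, polyTrap, polyQ, bqd, polyH_III, sinh_eq_exp, cosh_eq_exp, exp_two_mul_sub,
      weight, dpar, kap, sg, pairG, pairG.longG, pairG.shortG, hShort,
      Bool.xor_false, Bool.xor_true, Bool.not_true, Bool.and_true, Bool.and_false, Bool.or_true, Bool.or_false,
      Bool.not_false, cond_true, cond_false] <;>
    generalize exp (2 * a) = A at * <;>
    generalize exp (2 * b) = B at * <;>
    field_simp <;> ring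
  all_goals
    cases c <;> cases si <;> cases sj <;>
    simp only [vquad, polyH, polyTrap, polyQ, bqd,
      weight, dpar, kap, sg, pairG, pairG.longG, pairG.shortG, hShort,
      Bool.xor_false, Bool.xor_true, Bool.not_true, Bool.and_true, Bool.and_false, Bool.or_true, Bool.or_false,
      Bool.not_false, cond_true, cond_false] <;> ring

/-- Elimination of `xij` and `xil` from the equation on the square `xi, xij, y, xil`. -/
theorem consistency (k : Family) (ε δ : ℂ) (c si sj sl : Bool) (a b d x xi xj xl y : ℂ) :
    let q := vquad k ε δ (xor c si) sj sl b d
    let r := vquad k ε δ c si sj a b x xi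
    let t := vquad k ε δ c si sl a d x xi
    (r 1 xj - r 0 xj) * (t 1 xl - t 0 xl) * q xi 0 y 0
      - r 0 xj * (t 1 xl - t 0 xl) * (q xi 1 y 0 - q xi 0 y 0)
      - (r 1 xj - r 0 xj) * t 0 xl * (q xi 0 y 1 - q xi 0 y 0)
      + r 0 xj * t 0 xl * (q xi 1 y 1 - q xi 1 y 0 - q xi 0 y 1 + q xi 0 y 0)
    = - kap k * weight k sj b * weight k sl d * pairG k ε δ c (xor c si) a x xi *
      vquad k ε δ (xor c si) (xor si sj) (xor si sl) (bif si then a - b else b - a)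
        (bif si then a - d else d - a) xi xj y xl := by
  -- The left-hand side is `q` at `xij = -r 0 xj / (r 1 xj - r 0 xj)` and `xil = -t 0 xl / (t 1 xl -
  -- t 0 xl)`, multiplied by both denominators. The content of the identity is that `x` survives
  -- only in the biquadratic factor.
  cases k
  case III =>
    have hA := exp_ne_zero (2 * a)
    have hB := exp_ne_zero (2 * b)
    have hD := exp_ne_zero (2 * d)
    cases c <;> cases si <;> cases sj <;> cases sl <;>
    simp only [vquad, polyTrap, polyQ, bqd, polyH_III, sinh_eq_exp, cosh_eq_exp, exp_two_mul_sub,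
      weight, dpar, kap, sg, pairG, pairG.longG, pairG.shortG, hShort,
      Bool.xor_false, Bool.xor_true, Bool.not_true, Bool.and_true, Bool.and_false, Bool.or_true, Bool.or_false,
      Bool.not_false, cond_true, cond_false] <;>
    generalize exp (2 * a) = A at * <;>
    generalize exp (2 * b) = B at * <;>
    generalize exp (2 * d) = D at * <;>
    field_simp <;> ring
  all_goals
    cases c <;> cases si <;> cases sj <;> cases sl <;>
    simp only [vquad, polyH, polyTrap, polyQ, bqd,
      weight, dpar, kap, sg, pairG, pairG.longG, pairG.shortG, hShort,
      Bool.xor_false, Bool.xor_true, Bool.not_true, Bool.and_true, Bool.and_false, Bool.or_true, Bool.or_false,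
      Bool.not_false, cond_true, cond_false] <;> ring

end

/-! ### Product identities on a face and the tetrahedron equation -/

section

set_option maxHeartbeats 4000000

theorem pairH_symm (k : Family) (ε δ : ℂ) (cu cv : Bool) (β x y : ℂ) :
    pairH k ε δ cv cu β y x = pairH k ε δ cu cv β x y := by
  cases k <;> cases cu <;> cases cv <;> simp only [pairH, hLong] <;> ring

theorem pairH_neg (k : Family) (ε δ : ℂ) (c : Bool) (β x y : ℂ) :
    pairH k ε δ c c (-β) x y = -pairH k ε δ c c β x y := by
  cases k <;> cases c <;> simp only [pairH, hLong, mul_neg, neg_neg, sinh_neg, div_neg] <;> ring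

theorem weight_neg (k : Family) (β : ℂ) : weight k false (-β) = -weight k false β := by
  cases k <;> simp [weight, sinh_neg]

theorem kap_ne_zero (k : Family) : kap k ≠ 0 := by cases k <;> simp [kap]

/-- The coefficient of the third vertex in a quad-equation. -/
def coef₃ (k : Family) (ε δ : ℂ) (c si sj : Bool) (a b x xi xj : ℂ) : ℂ :=
  vquad k ε δ c si sj a b x xi 1 xj - vquad k ε δ c si sj a b x xi 0 xj

section products

variable {k : Family} {ε δ : ℂ} {c si sj : Bool} {a b x xi xij xj : ℂ}

/-- Let `d₁, …, d₄` be the partial derivatives at a zero. Each `d_p * d_q` is a discriminant, hence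
a multiple of the biquadratic in the complementary fields. The identities come from grouping `d₁ *
d₂ * d₃ * d₄` in three ways; the last claim holds because `coef₃` is `d₃`, a factor of the non-zero
product `d₁ * d₃`. -/
theorem product_identities (hq : vquad k ε δ c si sj a b x xi xij xj = 0)
    (ha : weight k si a ≠ 0) (hb : weight k sj b ≠ 0)
    (hd : weight k (xor si sj) (dpar si sj a b) ≠ 0) :
    (pairH k ε δ c (xor c si) a x xi * pairH k ε δ (xor c sj) (xor (xor c si) sj) a xj xij =
      pairH k ε δ c (xor c sj) b x xj * pairH k ε δ (xor c si) (xor (xor c si) sj) b xi xij) ∧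
    (pairH k ε δ c (xor c si) a x xi * pairH k ε δ (xor c sj) (xor (xor c si) sj) a xj xij =
      pairH k ε δ (xor c si) (xor c sj) (dpar si sj a b) xi xj *
        pairH k ε δ c (xor (xor c si) sj) (dpar si sj a b) x xij) ∧
    (pairH k ε δ (xor c si) (xor c sj) (dpar si sj a b) xi xj ≠ 0 →
      coef₃ k ε δ c si sj a b x xi xj ≠ 0) := by
  have e12 := bqd₁₂ k ε δ c si sj a b x xi
  have e34 := bqd₃₄ k ε δ c si sj a b xij xj
  have e14 := bqd₁₄ k ε δ c si sj a b x xj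
  have e23 := bqd₂₃ k ε δ c si sj a b xi xij
  have e24 := bqd₂₄ k ε δ c si sj a b xi xj
  have e13 := bqd₁₃ k ε δ c si sj a b x xij
  rw [pairG_eq _ _ _ _ _ _ _ _ (by simpa using ha)] at e12
  rw [pairG_eq _ _ _ _ _ _ _ _ (by cases c <;> cases si <;> cases sj <;> simpa using ha)] at e34
  rw [pairG_eq _ _ _ _ _ _ _ _ (by simpa using hb)] at e14
  rw [pairG_eq _ _ _ _ _ _ _ _ (by cases c <;> cases si <;> cases sj <;> simpa using hb)] at e23
  rw [pairG_eq _ _ _ _ _ _ _ _ (by cases c <;> cases si <;> cases sj <;> simpa using hd)] at e24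
  rw [pairG_eq _ _ _ _ _ _ _ _ (by cases c <;> cases si <;> cases sj <;> simpa using hd)] at e13
  rw [show xor c (xor c si) = si by cases c <;> cases si <;> rfl] at e12
  rw [show xor (xor c sj) (xor (xor c si) sj) = si by
    cases c <;> cases si <;> cases sj <;> rfl] at e34
  rw [show xor c (xor c sj) = sj by cases c <;> cases sj <;> rfl] at e14
  rw [show xor (xor c si) (xor (xor c si) sj) = sj by
    cases c <;> cases si <;> cases sj <;> rfl] at e23
  rw [show xor (xor c si) (xor c sj) = xor si sj by
    cases c <;> cases si <;> cases sj <;> rfl] at e24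
  rw [show xor c (xor (xor c si) sj) = xor si sj by
    cases c <;> cases si <;> cases sj <;> rfl] at e13
  -- the four partial derivatives
  set Q := vquad k ε δ c si sj a b with hQ
  have a1 (x xi xij xj) : Q x xi xij xj = (1 - x) * Q 0 xi xij xj + x * Q 1 xi xij xj :=
    affine₁ ..
  have a2 (x xi xij xj) : Q x xi xij xj = (1 - xi) * Q x 0 xij xj + xi * Q x 1 xij xj :=
    affine₂ ..
  have a3 (x xi xij xj) : Q x xi xij xj = (1 - xij) * Q x xi 0 xj + xij * Q x xi 1 xj :=
    affine₃ ..
  have a4 (x xi xij xj) : Q x xi xij xj = (1 - xj) * Q x xi xij 0 + xj * Q x xi xij 1 :=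
    affine₄ ..
  -- product of partial derivatives of a bilinear function at a zero
  have bil (f : ℂ → ℂ → ℂ) (h1 : ∀ u v, f u v = (1 - u) * f 0 v + u * f 1 v)
      (h2 : ∀ u v, f u v = (1 - v) * f u 0 + v * f u 1) (u v : ℂ) (h0 : f u v = 0) :
      (f 1 v - f 0 v) * (f u 1 - f u 0) = bqd f := by
    have h3 := h2 u v
    rw [h1 u 0, h1 u 1, h0] at h3
    rw [h2 1 v, h2 0 v, h1 u 0, h1 u 1, bqd]
    linear_combination (f 1 1 - f 1 0 - f 0 1 + f 0 0) * (-h3)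
  have p12 := bil (fun u v => Q x xi u v) (fun u v => a3 ..) (fun u v => a4 ..) _ _ hq
  have p34 := bil (fun u v => Q u v xij xj) (fun u v => a1 ..) (fun u v => a2 ..) _ _ hq
  have p14 := bil (fun u v => Q x u v xj) (fun u v => a2 ..) (fun u v => a3 ..) _ _ hq
  have p23 := bil (fun u v => Q u xi xij v) (fun u v => a1 ..) (fun u v => a4 ..) _ _ hq
  have p24 := bil (fun u v => Q u xi v xj) (fun u v => a1 ..) (fun u v => a3 ..) _ _ hq
  have p13 := bil (fun u v => Q x u xij v) (fun u v => a2 ..) (fun u v => a4 ..) _ _ hq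
  rw [e12] at p12
  rw [e34] at p34
  rw [e14] at p14
  rw [e23] at p23
  rw [e24] at p24
  rw [e13] at p13
  have s1 : sg si sj ^ 2 = 1 := by cases si <;> cases sj <;> norm_num [sg]
  have s2 : (bif si && sj then (-1 : ℂ) else 1) ^ 2 = 1 := by
    cases si <;> cases sj <;> norm_num
  have s3 : (bif xor si sj then (-1 : ℂ) else 1) ^ 2 = 1 := by
    cases si <;> cases sj <;> norm_num
  -- The factor common to all the products: the signs in the discriminants enter as squares and
  -- disappear.
  have hC : (kap k * weight k si a * weight k sj b * weight k (xor si sj) (dpar si sj a b)) ^ 2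
      ≠ 0 := pow_ne_zero _ (mul_ne_zero (mul_ne_zero (mul_ne_zero (kap_ne_zero k) ha) hb) hd)
  have comb (d1 d2 d3 d4 s t κ u v w h12 h34 h14 h23 : ℂ) (hs : s ^ 2 = 1) (ht : t ^ 2 = 1)
      (p12 : d3 * d4 = s * κ * v * w * (u * h12)) (p34 : d1 * d2 = s * κ * v * w * (u * h34))
      (p14 : d2 * d3 = t * κ * u * w * (v * h14)) (p23 : d1 * d4 = t * κ * u * w * (v * h23)) :
      (κ * u * v * w) ^ 2 * (h12 * h34) = (κ * u * v * w) ^ 2 * (h14 * h23) := by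
    have q : (d3 * d4) * (d1 * d2) = (d2 * d3) * (d1 * d4) := by ring
    rw [p12, p34, p14, p23] at q
    linear_combination q - (κ * u * v * w) ^ 2 * h12 * h34 * hs +
      (κ * u * v * w) ^ 2 * h14 * h23 * ht
  have comb' (d1 d2 d3 d4 s t κ u v w h12 h34 h24 h13 : ℂ) (hs : s ^ 2 = 1) (ht : t ^ 2 = 1)
      (p12 : d3 * d4 = s * κ * v * w * (u * h12)) (p34 : d1 * d2 = s * κ * v * w * (u * h34))
      (p24 : d1 * d3 = t * κ * u * v * (w * h24)) (p13 : d2 * d4 = t * κ * u * v * (w * h13)) :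
      (κ * u * v * w) ^ 2 * (h12 * h34) = (κ * u * v * w) ^ 2 * (h24 * h13) := by
    have q : (d3 * d4) * (d1 * d2) = (d1 * d3) * (d2 * d4) := by ring
    rw [p12, p34, p24, p13] at q
    linear_combination q - (κ * u * v * w) ^ 2 * h12 * h34 * hs +
      (κ * u * v * w) ^ 2 * h24 * h13 * ht
  refine ⟨mul_left_cancel₀ hC ?_, mul_left_cancel₀ hC ?_, fun h24 h3 => ?_⟩
  · exact comb _ _ _ _ _ _ _ _ _ _ _ _ _ _ s1 s2 p12 p34 p14 p23
  · exact comb' _ _ _ _ _ _ _ _ _ _ _ _ _ _ s1 s3 p12 p34 p24 p13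
  · simp only [coef₃] at h3
    rw [← hQ] at h3
    simp only [h3, mul_zero] at p24
    have hs3 : (bif xor si sj then (-1 : ℂ) else 1) ≠ 0 := by
      intro h; rw [h] at s3; norm_num at s3
    simp [kap_ne_zero, ha, hb, hd, h24, hs3] at p24

end products

/-- The parameter on an edge of the tetrahedron equation differs from the diagonal parameter at most
by sign, and a sign occurs only for vertices of equal colour, where the biquadratic is odd. -/
theorem pairH_par (k : Family) (ε δ : ℂ) (si sj : Bool) (a b : ℂ) :
    ∃ s : ℂ, s ^ 2 = 1 ∧ ∀ cu x y, pairH k ε δ cu (xor cu (xor si sj))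
      (bif si then a - b else b - a) x y =
        s * pairH k ε δ cu (xor cu (xor si sj)) (dpar si sj a b) x y := by
  cases si <;> cases sj
  · refine ⟨-1, by norm_num, fun cu x y => ?_⟩
    rw [show (bif false then a - b else b - a) = -dpar false false a b by simp [dpar]]
    simp only [Bool.xor_self, Bool.xor_false]
    rw [pairH_neg]; ring
  all_goals exact ⟨1, by norm_num, fun cu x y => by simp [dpar]⟩

theorem weight_par (k : Family) (si sj : Bool) (a b : ℂ)
    (h : weight k (xor si sj) (dpar si sj a b) ≠ 0) :
    weight k (xor si sj) (bif si then a - b else b - a) ≠ 0 := by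
  cases si <;> cases sj
  · rw [show (bif false then a - b else b - a) = -dpar false false a b by simp [dpar]]
    simp only [Bool.xor_self] at h ⊢
    rw [weight_neg]; exact neg_ne_zero.2 h
  all_goals simpa [dpar] using h

theorem weight_dpar (k : Family) (si sj sl : Bool) (a b d : ℂ)
    (h : weight k (xor sj sl) (dpar sj sl b d) ≠ 0) :
    weight k (xor (xor si sj) (xor si sl)) (dpar (xor si sj) (xor si sl)
      (bif si then a - b else b - a) (bif si then a - d else d - a)) ≠ 0 := by
  have h' : k = .III ∨ k ≠ .III := by cases k <;> simp
  have key (z w : ℂ) (hz : z = -w) (hw : weight k false w ≠ 0) : weight k false z ≠ 0 := by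
    rw [hz, weight_neg]; exact neg_ne_zero.2 hw
  cases si <;> cases sj <;> cases sl <;> simp [dpar] at h ⊢ <;>
    first | exact h | exact key _ _ (by ring) h

/-- The equation on the vertices `xi, xj, y, xl` of a cube. -/
def tetra (k : Family) (ε δ : ℂ) (c si sj sl : Bool) (a b d xi xj xl y : ℂ) : ℂ :=
  vquad k ε δ (xor c si) (xor si sj) (xor si sl) (bif si then a - b else b - a)
        (bif si then a - d else d - a) xi xj y xl

theorem tetra_swap₂₃ (k : Family) (ε δ : ℂ) (c si sj sl : Bool) (a b d xi xj xl y : ℂ) :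
    tetra k ε δ c si sl sj a d b xi xl xj y = 0 ↔ tetra k ε δ c si sj sl a b d xi xj xl y = 0 := by
  rw [tetra, vquad_swap]
  cases si <;> cases sj <;> cases sl <;> simp [tetra]

/-- Together with `tetra_swap₂₃` this makes the tetrahedron equation symmetric in the three
directions, so that one equation controls all three faces away from `x`. The polynomials themselves
agree only up to sign. -/
theorem tetra_swap₁₂ (k : Family) (ε δ : ℂ) (c si sj sl : Bool) (a b d xi xj xl y : ℂ) :
    tetra k ε δ c sj si sl b a d xj xi xl y = 0 ↔ tetra k ε δ c si sj sl a b d xi xj xl y = 0 := by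
  have key (z w : ℂ) (h : z = w ∨ z = -w) : z = 0 ↔ w = 0 := by
    rcases h with rfl | rfl <;> simp
  apply key
  cases k
  case III =>
    have hA := exp_ne_zero (2 * a)
    have hB := exp_ne_zero (2 * b)
    have hD := exp_ne_zero (2 * d)
    cases c <;> cases si <;> cases sj <;> cases sl <;>
    simp only [tetra, vquad, polyTrap, polyQ, polyH_III, sinh_eq_exp, exp_two_mul_sub,
      Bool.xor_false, Bool.xor_true, Bool.not_true, Bool.not_false, cond_true, cond_false] <;>
    generalize exp (2 * a) = A at * <;>
    generalize exp (2 * b) = B at * <;>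
    generalize exp (2 * d) = D at * <;>
    first
    | (left; field_simp; ring1)
    | (right; field_simp; ring1)
  all_goals
    cases c <;> cases si <;> cases sj <;> cases sl <;>
    simp only [tetra, vquad, polyTrap, polyQ, polyH,
      Bool.xor_false, Bool.xor_true, Bool.not_true, Bool.not_false, cond_true, cond_false] <;>
    first
    | (left; ring1)
    | (right; ring1)

/-- On the solutions of two faces at the edge `x, xi`, the opposite face of one of the directions
is equivalent to the tetrahedron equation. -/
theorem far_iff_tetra {k : Family} {ε δ : ℂ} {c si sj sl : Bool} {a b d x xi xj xl xij xil y : ℂ}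
    (h1 : vquad k ε δ c si sj a b x xi xij xj = 0) (h2 : vquad k ε δ c si sl a d x xi xil xl = 0)
    (hc1 : coef₃ k ε δ c si sj a b x xi xj ≠ 0) (hc2 : coef₃ k ε δ c si sl a d x xi xl ≠ 0)
    (ha : weight k si a ≠ 0) (hb : weight k sj b ≠ 0) (hd : weight k sl d ≠ 0)
    (hh : pairH k ε δ c (xor c si) a x xi ≠ 0) :
    vquad k ε δ (xor c si) sj sl b d xi xij y xil = 0 ↔
      tetra k ε δ c si sj sl a b d xi xj xl y = 0 := by
  have h := consistency k ε δ c si sj sl a b d x xi xj xl y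
  rw [pairG_eq _ _ _ _ _ _ _ _ (by simpa using ha), ← tetra,
    show xor c (xor c si) = si by cases c <;> cases si <;> rfl] at h
  rw [affine₃] at h1 h2
  rw [affine₂]
  rw [affine₄ k ε δ _ _ _ _ _ _ 0, affine₄ k ε δ _ _ _ _ _ _ 1]
  simp only [coef₃] at hc1 hc2
  simp only at h
  set q := vquad k ε δ (xor c si) sj sl b d
  set r := vquad k ε δ c si sj a b x xi
  set t := vquad k ε δ c si sl a d x xi
  set M := r 1 xj - r 0 xj with hM
  set N := t 1 xl - t 0 xl with hN
  have h1' : M * xij = - r 0 xj := by rw [hM]; linear_combination h1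
  have h2' : N * xil = - t 0 xl := by rw [hN]; linear_combination h2
  -- The face is affine in `xij` and in `xil`; after multiplication by `M * N` both can be
  -- eliminated by `h1'` and `h2'`, which leaves the left-hand side of `consistency`.
  have key : M * N * ((1 - xij) * ((1 - xil) * q xi 0 y 0 + xil * q xi 0 y 1) +
      xij * ((1 - xil) * q xi 1 y 0 + xil * q xi 1 y 1)) = -kap k * weight k sj b * weight k sl d *
      (weight k si a * pairH k ε δ c (xor c si) a x xi) * tetra k ε δ c si sj sl a b d xi xj xl y := by
    rw [← h]
    linear_combination (N * (q xi 1 y 0 - q xi 0 y 0)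
      + N * xil * (q xi 1 y 1 - q xi 1 y 0 - q xi 0 y 1 + q xi 0 y 0)) * h1' +
      (M * (q xi 0 y 1 - q xi 0 y 0) - r 0 xj * (q xi 1 y 1 - q xi 1 y 0 - q xi 0 y 1 + q xi 0 y 0)) * h2'
  constructor
  · intro h0
    rw [h0, mul_zero] at key
    simpa [kap_ne_zero, hb, hd, ha, hh] using key.symm
  · intro h0
    rw [h0, mul_zero] at key
    simpa [hc1, hc2] using key

end

section

set_option maxHeartbeats 4000000

/-! ## Leg functions on coloured pairs -/

/-- The uniformizing change of variables at a vertex of colour `c`. -/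
def cunif (k : Family) (ε δ : ℂ) (c : Bool) (X : ℂ) : ℂ := unif k (if c then ε else 0) δ X

/-- The leg function centred at a vertex of colour `cu`. -/
def leg (k : Family) (ε δ : ℂ) (cu cv : Bool) (β X Y w : ℂ) : Prop :=
  match cu, cv with
  | true, true => IsPhi k ε β X Y w
  | false, false => IsPhi k 0 β X Y w
  | true, false => IsPsi k ε δ β X Y w
  | false, true => IsPsiBar k ε δ β X Y w

/-- The leg function is rational if the rate is `0`, otherwise a logarithm divided by the rate. -/
def rate (k : Family) (ε : ℂ) (cu : Bool) : ℂ :=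
  match k with
  | .I => if cu then ε else 0
  | _ => 1

/-- The numerator of the leg function or of its exponential. -/
def legN (k : Family) (ε δ : ℂ) (cu cv : Bool) (β X Y : ℂ) : ℂ :=
  match cu, cv with
  | true, true => phiN k ε β X Y
  | false, false => phiN k 0 β X Y
  | true, false =>
    match k with
    | .I => if ε = 0 then 2 * Y else 1 + ε * Y
    | .II => X + Y + β
    | .III => if ε = 0 then exp (2 * β) else ε * exp (2 * Y - 2 * X) + δ * exp (2 * β)
  | false, true =>
    match k with
    | .I => 2 * (Y - ε ^ 2 * β * X)
    | .II => (Y + X + β) * (1 + ε * (Y - X - β))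
    | .III => if ε = 0 then exp (2 * β) else exp (4 * β)
where
  phiN (k : Family) (ε β X Y : ℂ) : ℂ :=
    match k with
    | .I => if ε = 0 then 2 * β else X - Y + ε * β
    | .II => (X - Y + β) * (1 + ε * (X + Y + β))
    | .III => if ε = 0 then exp (2 * β) * sinh (X - Y + β)
        else sinh (X + Y + β) * sinh (X - Y + β)

/-- The denominator of the leg function or of its exponential. -/
def legD (k : Family) (ε δ : ℂ) (cu cv : Bool) (β X Y : ℂ) : ℂ :=
  match cu, cv with
  | true, true => phiD k ε β X Y
  | false, false => phiD k 0 β X Y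
  | true, false =>
    match k with
    | .I => if ε = 0 then 1 else 1 - ε * Y
    | .II => 1 + ε * (X - Y - β)
    | .III => if ε = 0 then exp (2 * X + 2 * Y) + δ ^ 2 * exp (2 * β)
        else ε * exp (2 * X + 2 * Y) + δ * exp (2 * β)
  | false, true =>
    match k with
    | .I => 1 - ε ^ 2 * X ^ 2
    | .II => 1
    | .III => if ε = 0 then exp (2 * Y + 2 * X) + δ ^ 2 * exp (2 * β) else
        (ε * exp (2 * X - 2 * Y) + δ * exp (2 * β)) * (ε * exp (2 * Y + 2 * X) + δ * exp (2 * β))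
where
  phiD (k : Family) (ε β X Y : ℂ) : ℂ :=
    match k with
    | .I => if ε = 0 then X - Y else X - Y - ε * β
    | .II => (X - Y - β) * (1 + ε * (X + Y - β))
    | .III => if ε = 0 then sinh (X - Y - β) else sinh (X + Y - β) * sinh (X - Y - β)

/-- A uniform shape for all legs, a quotient or a logarithm of a quotient, so that periods and
three-leg forms can be handled without separating the families. -/
theorem leg_iff (k : Family) (ε δ : ℂ) (cu cv : Bool) (β X Y w : ℂ) :
    leg k ε δ cu cv β X Y w ↔
      if rate k ε cu = 0 then w = legN k ε δ cu cv β X Y / legD k ε δ cu cv β X Y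
      else exp (rate k ε cu * w) = legN k ε δ cu cv β X Y / legD k ε δ cu cv β X Y := by
  have hsub (N D : ℂ) : exp (w - 2 * β) = N / D ↔ exp w = exp (2 * β) * N / D := by
    rw [exp_sub, div_eq_iff (exp_ne_zero _)]; ring_nf
  by_cases hε : ε = 0 <;> cases k <;> cases cu <;> cases cv <;>
    simp [leg, rate, legN, legD, legN.phiN, legD.phiD, IsPhi, IsPsi, IsPsiBar, hε, hsub]

/-- The multiples of the period of a leg function. -/
def IsPer (k : Family) (ε : ℂ) (cu : Bool) (d : ℂ) : Prop :=
  if rate k ε cu = 0 then d = 0 else exp (rate k ε cu * d) = 1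

theorem leg_iff_isPer {k : Family} {ε δ : ℂ} {cu cv : Bool} {β X Y w w' : ℂ}
    (h : leg k ε δ cu cv β X Y w) :
    leg k ε δ cu cv β X Y w' ↔ IsPer k ε cu (w' - w) := by
  rw [leg_iff] at h ⊢
  rw [IsPer]
  split_ifs at h ⊢
  · rw [sub_eq_zero, h]
  · rw [← h, mul_sub, exp_sub, div_eq_one_iff_eq (exp_ne_zero _)]

/-- The periods are the multiples of 2πi divided by the rate, or only `0`; in either case they are
discrete. This rigidity makes relations between branches persist under small changes. -/
theorem exists_isPer_eq_zero (k : Family) (ε : ℂ) (cu : Bool) :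
    ∃ r > 0, ∀ d, IsPer k ε cu d → ‖d‖ < r → d = 0 := by
  by_cases h : rate k ε cu = 0
  · exact ⟨1, one_pos, fun d hd _ => by simpa [IsPer, h] using hd⟩
  · have hr : 0 < ‖rate k ε cu‖ := norm_pos_iff.2 h
    -- Non-zero periods have norm at least 2π divided by the norm of the rate, so this radius is
    -- small enough.
    refine ⟨1 / ‖rate k ε cu‖, by positivity, fun d hd hn => ?_⟩
    rw [IsPer, if_neg h, exp_eq_one_iff] at hd
    obtain ⟨n, hn'⟩ := hd
    have h1 : ‖rate k ε cu * d‖ < 1 := by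
      rw [norm_mul]
      rwa [lt_div_iff₀' hr] at hn
    rw [hn'] at h1
    have h2 : n = 0 := by
      by_contra hne
      have h3 : (1 : ℝ) ≤ |(n : ℝ)| := by exact_mod_cast Int.one_le_abs hne
      have h4 : ‖(n : ℂ) * (2 * Real.pi * I)‖ = |(n : ℝ)| * (2 * Real.pi) := by
        simp [abs_of_pos Real.pi_pos]
      rw [h4] at h1
      nlinarith [Real.pi_gt_three]
    rw [h2] at hn'
    simpa [h] using hn'

theorem exp_two_mul_eq (z : ℂ) : exp (2 * z) = exp z ^ 2 := by
  rw [← exp_nat_mul]; push_cast; ring_nf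

theorem exp_four_mul_eq (z : ℂ) : exp (4 * z) = exp z ^ 4 := by
  rw [← exp_nat_mul]; push_cast; ring_nf

/-- The biquadratic is, up to a unit, the product of numerator and denominator of the leg function. -/
theorem pairH_zero_of_leg {k : Family} {ε δ : ℂ} {cu cv : Bool} {β X Y : ℂ}
    (hr : rate k ε cu ≠ 0)
    (h : legN k ε δ cu cv β X Y * legD k ε δ cu cv β X Y = 0) :
    pairH k ε δ cu cv β (cunif k ε δ cu X) (cunif k ε δ cv Y) = 0 := by
  cases k
  case I =>
    cases cu
    · simp [rate] at hr
    · replace hr : ε ≠ 0 := by simpa [rate] using hr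
      cases cv <;>
      simp only [pairH, legN, legD, hLong, hShort, cunif, unif, legN.phiN, legD.phiD, hr, if_false] at h ⊢
      · linear_combination h / 2
      · by_cases hb : β = 0
        · simp [hb]
        · field_simp
          linear_combination -h
  case II =>
    cases cu <;> cases cv <;>
      simp only [pairH, legN, legD, hLong, hShort, cunif, unif, legN.phiN, legD.phiD, if_true,
        Bool.false_eq_true, if_false] at h ⊢
    any_goals linear_combination h
    all_goals
      by_cases hb : β = 0
      · simp [hb]
      · field_simp
        linear_combination -h
  case III =>
    have hβ := exp_ne_zero β
    have hX := exp_ne_zero X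
    have hY := exp_ne_zero Y
    have e2 (z w : ℂ) : exp (2 * z + 2 * w) = exp z ^ 2 * exp w ^ 2 := by
      rw [exp_add, exp_two_mul_eq, exp_two_mul_eq]
    have e3 (z w : ℂ) : exp (2 * z - 2 * w) = exp z ^ 2 / exp w ^ 2 := by
      rw [exp_sub, exp_two_mul_eq, exp_two_mul_eq]
    by_cases hε : ε = 0 <;> cases cu <;> cases cv <;>
      simp only [pairH, legN, legD, hLong, hShort, cunif, unif, legN.phiN, legD.phiD, if_true,
        Bool.false_eq_true, if_false, hε] at h ⊢
    case pos.false.false | pos.true.true | neg.false.false =>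
      by_cases hb : sinh (2 * β) = 0
      · simp [hb]
      -- With `x = exp (2 * X)` and `y = exp (2 * Y)` one has `exp β * x - exp (-β) * y = 2 * exp (X
      -- + Y) * sinh (X - Y + β)`, and likewise for `-β`. This explains the exponential factor and
      -- the constant `-4`.
      · refine (mul_eq_zero_iff_left (mul_ne_zero (exp_ne_zero (2 * β - 2 * X - 2 * Y)) hb)).1 ?_
        refine Eq.trans ?_ (congrArg (-4 * ·) h |>.trans (mul_zero _))
        field_simp
        simp only [sinh_eq_exp, exp_add, exp_sub, exp_neg, exp_two_mul_eq, neg_mul]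
        field_simp
        ring
    case neg.true.true =>
      by_cases hb : sinh (2 * β) = 0
      · simp [hb]
      · refine (mul_eq_zero_iff_left hb).1 ?_
        refine Eq.trans ?_ (congrArg (-16 * δ ^ 2 * ε ^ 2 * ·) h |>.trans (mul_zero _))
        field_simp
        simp only [sinh_eq_exp, cosh_eq_exp, exp_add, exp_sub, exp_neg, exp_two_mul_eq]
        field_simp
        ring
    all_goals
      simp only [cosh_eq_exp, e2, e3, exp_two_mul_eq, exp_four_mul_eq] at h ⊢
      field_simp at h ⊢
      first
      | linear_combination h
      | (simp at h ⊢; linear_combination h)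
      | (simp at h ⊢; linear_combination mul_eq_zero.2 h)

end

/-! ### Three-leg forms -/

section

set_option maxHeartbeats 4000000

/-- The three-leg relation centred at `xi`, with denominators cleared, is the quad-polynomial times
an explicit factor: a multiple of `sinh (2 * Xi)` at a black centre with `ε ≠ 0`, an exponential
otherwise. The exceptional case `u = 0` is an all-black face with `δ = 0`, on which all fields are
zero. The `bif` reflects that for `sgd = -1` the difference of the two edge legs is reversed. -/
theorem vquad_III_legs (ε δ : ℂ) (c si sj : Bool) (a b X Xi Xij Xj : ℂ) :
    let ci := xor c si
    let n₁ := legN .III ε δ ci c a Xi X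
    let d₁ := legD .III ε δ ci c a Xi X
    let n₂ := legN .III ε δ ci (xor ci sj) b Xi Xij
    let d₂ := legD .III ε δ ci (xor ci sj) b Xi Xij
    let n₃ := legN .III ε δ ci (xor c sj) (dpar si sj a b) Xi Xj
    let d₃ := legD .III ε δ ci (xor c sj) (dpar si sj a b) Xi Xj
    ∃ u v : ℂ, (ε = 0 ∨ δ ≠ 0 ∨ ¬ (c = true ∧ si = false ∧ sj = false) → u ≠ 0) ∧
      u * (bif !si && sj then n₂ * d₁ * d₃ - n₁ * d₂ * n₃ else n₁ * d₂ * d₃ - d₁ * n₂ * n₃) =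
      v * vquad .III ε δ c si sj a b (cunif .III ε δ c X) (cunif .III ε δ ci Xi)
        (cunif .III ε δ (xor ci sj) Xij) (cunif .III ε δ (xor c sj) Xj) := by
  have hA := exp_ne_zero a
  have hB := exp_ne_zero b
  have h1 := exp_ne_zero X
  have h2 := exp_ne_zero Xi
  have h3 := exp_ne_zero Xij
  have h4 := exp_ne_zero Xj
  have e2 (z w : ℂ) : exp (2 * z + 2 * w) = exp z ^ 2 * exp w ^ 2 := by
    rw [exp_add, exp_two_mul_eq, exp_two_mul_eq]
  have e3 (z w : ℂ) : exp (2 * z - 2 * w) = exp z ^ 2 / exp w ^ 2 := by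
    rw [exp_sub, exp_two_mul_eq, exp_two_mul_eq]
  have e4 (z w : ℂ) : exp (4 * (z - w)) = exp z ^ 4 / exp w ^ 4 := by
    rw [mul_sub, exp_sub, exp_four_mul_eq, exp_four_mul_eq]
  have hp := polyH_III
  by_cases hε : ε = 0 <;> cases c <;> cases si <;> cases sj <;>
    simp only [Bool.xor_false, Bool.xor_true, Bool.not_true, Bool.not_false, Bool.and_true,
      Bool.and_false, cond_true, cond_false]
  case pos.false.false.false | pos.true.false.false | neg.false.false.false =>
    refine ⟨1, exp (2 * a - X - Xi - Xij - Xj) / 4, by simp, ?_⟩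
    simp only [vquad, polyTrap, polyQ, hp, legN, legD, legN.phiN, legD.phiD, cunif, unif, if_true,
      Bool.false_eq_true, if_false, hε, dpar, Bool.not_true, Bool.not_false, Bool.and_true,
      Bool.and_false, cond_true, cond_false, e2, e3, e4, sinh_eq_exp, cosh_eq_exp, exp_two_mul_sub,
      exp_add, exp_sub, exp_two_mul_eq, exp_four_mul_eq]
    field_simp
    ring
  case pos.false.true.true | pos.true.true.true =>
    refine ⟨1, -exp (a - b + Xi - Xj) / 2, by simp, ?_⟩
    simp only [vquad, polyTrap, polyQ, hp, legN, legD, legN.phiN, legD.phiD, cunif, unif, if_true,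
      Bool.false_eq_true, if_false, hε, dpar, Bool.not_true, Bool.not_false, Bool.and_true,
      Bool.and_false, cond_true, cond_false, e2, e3, e4, sinh_eq_exp, cosh_eq_exp, exp_two_mul_sub,
      exp_add, exp_sub, exp_two_mul_eq, exp_four_mul_eq]
    field_simp
    ring
  case pos.false.true.false | pos.true.true.false =>
    refine ⟨1, exp (b + Xi - Xij) / 2, by simp, ?_⟩
    simp only [vquad, polyTrap, polyQ, hp, legN, legD, legN.phiN, legD.phiD, cunif, unif, if_true,
      Bool.false_eq_true, if_false, hε, dpar, Bool.not_true, Bool.not_false, Bool.and_true,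
      Bool.and_false, cond_true, cond_false, e2, e3, e4, sinh_eq_exp, cosh_eq_exp, exp_two_mul_sub,
      exp_add, exp_sub, exp_two_mul_eq, exp_four_mul_eq]
    field_simp
    ring
  case pos.false.false.true | pos.true.false.true =>
    refine ⟨1, exp (a - X + Xi) / 2, by simp, ?_⟩
    simp only [vquad, polyTrap, polyQ, hp, legN, legD, legN.phiN, legD.phiD, cunif, unif, if_true,
      Bool.false_eq_true, if_false, hε, dpar, Bool.not_true, Bool.not_false, Bool.and_true,
      Bool.and_false, cond_true, cond_false, e2, e3, e4, sinh_eq_exp, cosh_eq_exp, exp_two_mul_sub,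
      exp_add, exp_sub, exp_two_mul_eq, exp_four_mul_eq]
    field_simp
    ring
  case neg.true.false.false =>
    refine ⟨16 * ε ^ 2 * δ ^ 2, sinh (2 * Xi), by simp [hε], ?_⟩
    simp only [vquad, polyTrap, polyQ, hp, legN, legD, legN.phiN, legD.phiD, cunif, unif, if_true,
      Bool.false_eq_true, if_false, hε, dpar, Bool.not_true, Bool.not_false, Bool.and_true,
      Bool.and_false, cond_true, cond_false, e2, e3, e4, sinh_eq_exp, cosh_eq_exp, exp_two_mul_sub,
      exp_add, exp_sub, exp_two_mul_eq, exp_four_mul_eq]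
    field_simp
    ring
  case neg.false.true.true =>
    refine ⟨1, -sinh (2 * Xi) / 2, by simp, ?_⟩
    simp only [vquad, polyTrap, polyQ, hp, legN, legD, legN.phiN, legD.phiD, cunif, unif, if_true,
      Bool.false_eq_true, if_false, hε, dpar, Bool.not_true, Bool.not_false, Bool.and_true,
      Bool.and_false, cond_true, cond_false, e2, e3, e4, sinh_eq_exp, cosh_eq_exp, exp_two_mul_sub,
      exp_add, exp_sub, exp_two_mul_eq, exp_four_mul_eq]
    field_simp
    ring
  case neg.false.true.false | neg.true.false.true =>
    refine ⟨1, sinh (2 * Xi) / 2, by simp, ?_⟩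
    simp only [vquad, polyTrap, polyQ, hp, legN, legD, legN.phiN, legD.phiD, cunif, unif, if_true,
      Bool.false_eq_true, if_false, hε, dpar, Bool.not_true, Bool.not_false, Bool.and_true,
      Bool.and_false, cond_true, cond_false, e2, e3, e4, sinh_eq_exp, cosh_eq_exp, exp_two_mul_sub,
      exp_add, exp_sub, exp_two_mul_eq, exp_four_mul_eq]
    field_simp
    ring
  case neg.true.true.true =>
    refine ⟨1, -exp (a + a + a + b + Xi - Xj) / 2, by simp, ?_⟩
    simp only [vquad, polyTrap, polyQ, hp, legN, legD, legN.phiN, legD.phiD, cunif, unif, if_true,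
      Bool.false_eq_true, if_false, hε, dpar, Bool.not_true, Bool.not_false, Bool.and_true,
      Bool.and_false, cond_true, cond_false, e2, e3, e4, sinh_eq_exp, cosh_eq_exp, exp_two_mul_sub,
      exp_add, exp_sub, exp_two_mul_eq, exp_four_mul_eq]
    field_simp
    ring
  case neg.true.true.false =>
    refine ⟨1, exp (4 * a - b + Xi - Xij) / 2, by simp, ?_⟩
    simp only [vquad, polyTrap, polyQ, hp, legN, legD, legN.phiN, legD.phiD, cunif, unif, if_true,
      Bool.false_eq_true, if_false, hε, dpar, Bool.not_true, Bool.not_false, Bool.and_true,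
      Bool.and_false, cond_true, cond_false, e2, e3, e4, sinh_eq_exp, cosh_eq_exp, exp_two_mul_sub,
      exp_add, exp_sub, exp_two_mul_eq, exp_four_mul_eq]
    field_simp
    ring
  case neg.false.false.true =>
    refine ⟨1, exp (4 * b - a - X + Xi) / 2, by simp, ?_⟩
    simp only [vquad, polyTrap, polyQ, hp, legN, legD, legN.phiN, legD.phiD, cunif, unif, if_true,
      Bool.false_eq_true, if_false, hε, dpar, Bool.not_true, Bool.not_false, Bool.and_true,
      Bool.and_false, cond_true, cond_false, e2, e3, e4, sinh_eq_exp, cosh_eq_exp, exp_two_mul_sub,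
      exp_add, exp_sub, exp_two_mul_eq, exp_four_mul_eq]
    field_simp
    ring

end

section

set_option maxHeartbeats 4000000

/-- At a black centre the factor contains `1 + 2 * ε * Xi`, the derivative of the uniformization. -/
theorem legs_II {ε δ : ℂ} {c si sj : Bool} {a b X Xi Xij Xj : ℂ}
    (hq : vquad .II ε δ c si sj a b (cunif .II ε δ c X) (cunif .II ε δ (xor c si) Xi)
        (cunif .II ε δ (xor (xor c si) sj) Xij) (cunif .II ε δ (xor c sj) Xj) = 0) :
    let ci := xor c si
    let n₁ := legN .II ε δ ci c a Xi X
    let d₁ := legD .II ε δ ci c a Xi X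
    let n₂ := legN .II ε δ ci (xor ci sj) b Xi Xij
    let d₂ := legD .II ε δ ci (xor ci sj) b Xi Xij
    let n₃ := legN .II ε δ ci (xor c sj) (dpar si sj a b) Xi Xj
    let d₃ := legD .II ε δ ci (xor c sj) (dpar si sj a b) Xi Xj
    (bif !si && sj then n₂ * d₁ * d₃ - n₁ * d₂ * n₃ else n₁ * d₂ * d₃ - d₁ * n₂ * n₃) = 0 := by
  cases c <;> cases si <;> cases sj <;>
    simp only [Bool.xor_false, Bool.xor_true, Bool.not_true, Bool.not_false, Bool.and_true,
      Bool.and_false, cond_true, cond_false, vquad, polyTrap, polyQ, polyH, legN, legD, legN.phiN,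
      legD.phiD, cunif, unif, if_true, Bool.false_eq_true, if_false, dpar] at hq ⊢
  all_goals
    first
    | linear_combination hq
    | linear_combination -hq
    | linear_combination 2 * hq
    | linear_combination (1 + 2 * ε * Xi) * hq
    | linear_combination -(1 + 2 * ε * Xi) * hq
    | linear_combination 2 * (1 + 2 * ε * Xi) * hq

/-- The relation is additive when the leg at the centre is rational, and multiplicative when it is a
logarithm. -/
theorem legs_I {ε δ : ℂ} {c si sj : Bool} {a b X Xi Xij Xj : ℂ}
    (hq : vquad .I ε δ c si sj a b (cunif .I ε δ c X) (cunif .I ε δ (xor c si) Xi)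
        (cunif .I ε δ (xor (xor c si) sj) Xij) (cunif .I ε δ (xor c sj) Xj) = 0) :
    let ci := xor c si
    let n₁ := legN .I ε δ ci c a Xi X
    let d₁ := legD .I ε δ ci c a Xi X
    let n₂ := legN .I ε δ ci (xor ci sj) b Xi Xij
    let d₂ := legD .I ε δ ci (xor ci sj) b Xi Xij
    let n₃ := legN .I ε δ ci (xor c sj) (dpar si sj a b) Xi Xj
    let d₃ := legD .I ε δ ci (xor c sj) (dpar si sj a b) Xi Xj
    (rate .I ε ci = 0 → sgd si sj * (n₁ * d₂ - n₂ * d₁) * d₃ - d₁ * d₂ * n₃ = 0) ∧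
    (rate .I ε ci ≠ 0 →
    (bif !si && sj then n₂ * d₁ * d₃ - n₁ * d₂ * n₃ else n₁ * d₂ * d₃ - d₁ * n₂ * n₃) = 0) := by
  by_cases hε : ε = 0 <;> cases c <;> cases si <;> cases sj <;>
    simp only [Bool.xor_false, Bool.xor_true, Bool.not_true, Bool.not_false, Bool.and_true,
      Bool.and_false, cond_true, cond_false, vquad, polyTrap, polyQ, polyH, legN, legD, legN.phiN,
      legD.phiD, cunif, unif, if_true, Bool.false_eq_true, if_false, dpar, rate, hε, sgd,
      ne_eq, not_true_eq_false, not_false_eq_true, false_implies, true_implies, and_true, true_and] at hq ⊢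
  all_goals
    first
    | linear_combination 2 * hq
    | linear_combination -2 * hq
    | linear_combination 2 * ε * hq
    | linear_combination -2 * ε * hq
    | linear_combination 2 * (1 - ε ^ 2 * Xi ^ 2) * hq
    | linear_combination -2 * (1 - ε ^ 2 * Xi ^ 2) * hq

theorem legD_ne_zero_of_rate {k : Family} {ε δ : ℂ} {cu cv : Bool} {β X Y : ℂ}
    (hr : rate k ε cu = 0) (h : pairH k ε δ cu cv β (cunif k ε δ cu X) (cunif k ε δ cv Y) ≠ 0) :
    legD k ε δ cu cv β X Y ≠ 0 := by
  intro h0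
  apply h
  cases k
  case I =>
    by_cases hε : ε = 0 <;> cases cu <;> cases cv <;>
    simp only [pairH, legD, hLong, hShort, cunif, unif, legD.phiD, hε, rate, if_true, if_false,
      one_ne_zero, Bool.false_eq_true] at h0 hr ⊢ <;> simp_all
  all_goals simp [rate] at hr

theorem div_div_div_of_cross {n₁ d₁ n₂ d₂ n₃ d₃ : ℂ} (h₁ : d₁ ≠ 0) (h₂ : n₂ ≠ 0) (_ : d₂ ≠ 0)
    (h₃ : d₃ ≠ 0) (h : n₁ * d₂ * d₃ = d₁ * n₂ * n₃) : n₁ / d₁ / (n₂ / d₂) = n₃ / d₃ := by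
  field_simp
  linear_combination h

/-- The three-leg form of a quad-equation, centred at the vertex `xi`. -/
theorem three_leg {k : Family} {ε δ : ℂ} {c si sj : Bool} {a b X Xi Xij Xj w₁ w₂ : ℂ}
    (hq : vquad k ε δ c si sj a b (cunif k ε δ c X) (cunif k ε δ (xor c si) Xi)
        (cunif k ε δ (xor (xor c si) sj) Xij) (cunif k ε δ (xor c sj) Xj) = 0)
    (h₁ : pairH k ε δ (xor c si) c a (cunif k ε δ (xor c si) Xi) (cunif k ε δ c X) ≠ 0)
    (h₂ : pairH k ε δ (xor c si) (xor (xor c si) sj) b (cunif k ε δ (xor c si) Xi)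
      (cunif k ε δ (xor (xor c si) sj) Xij) ≠ 0)
    (h₃ : pairH k ε δ (xor c si) (xor c sj) (dpar si sj a b) (cunif k ε δ (xor c si) Xi)
      (cunif k ε δ (xor c sj) Xj) ≠ 0)
    (hw₁ : leg k ε δ (xor c si) c a Xi X w₁)
    (hw₂ : leg k ε δ (xor c si) (xor (xor c si) sj) b Xi Xij w₂) :
    leg k ε δ (xor c si) (xor c sj) (dpar si sj a b) Xi Xj (sgd si sj * (w₁ - w₂)) := by
  rw [leg_iff] at hw₁ hw₂ ⊢
  by_cases hr : rate k ε (xor c si) = 0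
  · have D1 := legD_ne_zero_of_rate hr h₁
    have D2 := legD_ne_zero_of_rate hr h₂
    have D3 := legD_ne_zero_of_rate hr h₃
    rw [if_pos hr] at *
    have hk : k = .I := by cases k <;> simp [rate] at hr <;> rfl
    subst hk
    have h := (legs_I hq).1 hr
    rw [hw₁, hw₂]
    field_simp
    linear_combination h
  · have D1 := mt (pairH_zero_of_leg (δ := δ) (cv := c) (β := a) (X := Xi) (Y := X) hr) h₁
    have D2 := mt (pairH_zero_of_leg (δ := δ) (cv := xor (xor c si) sj) (β := b) (X := Xi)
      (Y := Xij) hr) h₂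
    have D3 := mt (pairH_zero_of_leg (δ := δ) (cv := xor c sj) (β := dpar si sj a b) (X := Xi)
      (Y := Xj) hr) h₃
    rw [mul_eq_zero, not_or] at D1 D2 D3
    rw [if_neg hr] at *
    have h : (bif !si && sj then legN k ε δ (xor c si) (xor (xor c si) sj) b Xi Xij *
        legD k ε δ (xor c si) c a Xi X *
        legD k ε δ (xor c si) (xor c sj) (dpar si sj a b) Xi Xj -
        legN k ε δ (xor c si) c a Xi X *
        legD k ε δ (xor c si) (xor (xor c si) sj) b Xi Xij *
        legN k ε δ (xor c si) (xor c sj) (dpar si sj a b) Xi Xj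
        else legN k ε δ (xor c si) c a Xi X *
        legD k ε δ (xor c si) (xor (xor c si) sj) b Xi Xij *
        legD k ε δ (xor c si) (xor c sj) (dpar si sj a b) Xi Xj -
        legD k ε δ (xor c si) c a Xi X *
        legN k ε δ (xor c si) (xor (xor c si) sj) b Xi Xij *
        legN k ε δ (xor c si) (xor c sj) (dpar si sj a b) Xi Xj) = 0 := by
      cases k
      · exact (legs_I hq).2 hr
      · exact legs_II hq
      · obtain ⟨u, v, hu, h⟩ := vquad_III_legs ε δ c si sj a b X Xi Xij Xj
        rw [hq, mul_zero, mul_eq_zero] at h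
        refine h.resolve_left (hu ?_)
        -- In the degenerate case the uniformized fields are zero, which contradicts the regularity
        -- of the edge from `xi` to `x`.
        by_contra! hc
        obtain ⟨hε, hδ, rfl, rfl, rfl⟩ := hc
        exact h₁ (by simp [pairH, hLong, cunif, unif, hε, hδ])
    rw [sgd]
    cases hs : (!si && sj)
    · rw [hs] at h
      simp only [cond_false] at h ⊢
      rw [one_mul, mul_sub, exp_sub, hw₁, hw₂]
      exact div_div_div_of_cross D1.2 D2.1 D2.2 D3.2 (by linear_combination h)
    · rw [hs] at h
      simp only [cond_true] at h ⊢
      rw [neg_one_mul, neg_sub, mul_sub, exp_sub, hw₁, hw₂]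
      exact div_div_div_of_cross D2.2 D1.1 D1.2 D3.2 (by linear_combination h)

/-- Changing the sign of `β` exchanges numerator and denominator. -/
theorem isPhi_neg {k : Family} {ε β X Y w : ℂ} (h : IsPhi k ε (-β) X Y w) :
    IsPhi k ε β X Y (-w) := by
  cases k
  · by_cases hε : ε = 0
    · simp only [IsPhi, hε, if_true] at h ⊢
      rw [h]; ring
    · simp only [IsPhi, hε, if_false] at h ⊢
      rw [mul_neg, exp_neg, h, inv_div]; congr 1 <;> ring
  · simp only [IsPhi] at h ⊢
    rw [exp_neg, h, inv_div]; congr 1 <;> ring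
  · by_cases hε : ε = 0
    · simp only [IsPhi, hε, if_true] at h ⊢
      rw [show -w - 2 * β = -(w - 2 * -β) by ring, exp_neg, h, inv_div]; congr 1 <;> ring_nf
    · simp only [IsPhi, hε, if_false] at h ⊢
      rw [exp_neg, h, inv_div]; congr 1 <;> ring_nf

theorem leg_neg {k : Family} {ε δ : ℂ} {c : Bool} {β X Y w : ℂ}
    (h : leg k ε δ c c (-β) X Y w) : leg k ε δ c c β X Y (-w) := by
  cases c <;> exact isPhi_neg h

/-- The three-leg form of a quad-equation, centred at the vertex `xj`. -/
theorem three_leg' {k : Family} {ε δ : ℂ} {c si sj : Bool} {a b X Xi Xij Xj w₁ w₂ : ℂ}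
    (hq : vquad k ε δ c si sj a b (cunif k ε δ c X) (cunif k ε δ (xor c si) Xi)
        (cunif k ε δ (xor (xor c si) sj) Xij) (cunif k ε δ (xor c sj) Xj) = 0)
    (h₁ : pairH k ε δ (xor c sj) c b (cunif k ε δ (xor c sj) Xj) (cunif k ε δ c X) ≠ 0)
    (h₂ : pairH k ε δ (xor c sj) (xor (xor c si) sj) a (cunif k ε δ (xor c sj) Xj)
      (cunif k ε δ (xor (xor c si) sj) Xij) ≠ 0)
    (h₃ : pairH k ε δ (xor c si) (xor c sj) (dpar si sj a b) (cunif k ε δ (xor c si) Xi)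
      (cunif k ε δ (xor c sj) Xj) ≠ 0)
    (hw₁ : leg k ε δ (xor c sj) c b Xj X w₁)
    (hw₂ : leg k ε δ (xor c sj) (xor (xor c si) sj) a Xj Xij w₂) :
    leg k ε δ (xor c sj) (xor c si) (dpar si sj a b) Xj Xi (-(sgd si sj * (w₁ - w₂))) := by
  have e : xor (xor c si) sj = xor (xor c sj) si := by cases c <;> cases si <;> cases sj <;> rfl
  rw [e] at hq h₂ hw₂
  have hq' : vquad k ε δ c sj si b a (cunif k ε δ c X) (cunif k ε δ (xor c sj) Xj)
      (cunif k ε δ (xor (xor c sj) si) Xij) (cunif k ε δ (xor c si) Xi) = 0 := by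
    rw [vquad_swap, hq, mul_zero]
  rw [← pairH_symm] at h₃
  -- Reflecting the square reverses the diagonal parameter when `si = sj` and reverses `sgd`
  -- otherwise. In both cases the leg changes sign once, in the first because it is odd in the
  -- parameter.
  have hd : dpar sj si b a = if si = sj then -dpar si sj a b else dpar si sj a b := by
    cases si <;> cases sj <;> simp [dpar]
  have hs : sgd sj si = if si = sj then sgd si sj else - sgd si sj := by
    cases si <;> cases sj <;> simp [sgd]
  have h₃' : pairH k ε δ (xor c sj) (xor c si) (dpar sj si b a) (cunif k ε δ (xor c sj) Xj)
      (cunif k ε δ (xor c si) Xi) ≠ 0 := by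
    rw [hd]
    split_ifs with h
    · subst h; rw [pairH_neg]; exact neg_ne_zero.2 h₃
    · exact h₃
  have := three_leg hq' h₁ h₂ h₃' hw₁ hw₂
  rw [hd, hs] at this
  split_ifs at this with h
  · subst h; exact leg_neg this
  · rwa [neg_mul] at this

end

section

/-! ## Functions of three variables with continuous partial derivatives -/

/-- The linear form with coefficients `p, q, r`. -/
def form₃ (p q r : ℂ) : ℂ × ℂ × ℂ →L[ℂ] ℂ :=
  p • ContinuousLinearMap.fst ℂ ℂ (ℂ × ℂ)
    + q • (ContinuousLinearMap.fst ℂ ℂ ℂ).comp (ContinuousLinearMap.snd ℂ ℂ (ℂ × ℂ))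
    + r • (ContinuousLinearMap.snd ℂ ℂ ℂ).comp (ContinuousLinearMap.snd ℂ ℂ (ℂ × ℂ))

theorem form₃_apply (p q r : ℂ) (z : ℂ × ℂ × ℂ) :
    form₃ p q r z = p * z.1 + q * z.2.1 + r * z.2.2 := by simp [form₃]

/-- Near `z₀` the function `F` is differentiable, and its partial derivatives `P, Q, R` are
continuous at `z₀`. -/
def GradAt (F P Q R : ℂ × ℂ × ℂ → ℂ) (z₀ : ℂ × ℂ × ℂ) : Prop :=
  ContinuousAt P z₀ ∧ ContinuousAt Q z₀ ∧ ContinuousAt R z₀ ∧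
    ∀ᶠ z in 𝓝 z₀, HasFDerivAt F (form₃ (P z) (Q z) (R z)) z

variable {F P Q R F' P' Q' R' : ℂ × ℂ × ℂ → ℂ} {z₀ : ℂ × ℂ × ℂ}

theorem GradAt.add (h : GradAt F P Q R z₀) (h' : GradAt F' P' Q' R' z₀) :
    GradAt (fun z => F z + F' z) (fun z => P z + P' z) (fun z => Q z + Q' z)
      (fun z => R z + R' z) z₀ := by
  refine ⟨h.1.add h'.1, h.2.1.add h'.2.1, h.2.2.1.add h'.2.2.1, ?_⟩
  filter_upwards [h.2.2.2, h'.2.2.2] with z hz hz'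
  refine (hz.add hz').congr_fderiv ?_
  ext <;> simp [form₃]

theorem GradAt.mul (h : GradAt F P Q R z₀) (h' : GradAt F' P' Q' R' z₀) :
    GradAt (fun z => F z * F' z) (fun z => F z * P' z + F' z * P z)
      (fun z => F z * Q' z + F' z * Q z) (fun z => F z * R' z + F' z * R z) z₀ := by
  have c := h.2.2.2.self_of_nhds.continuousAt
  have c' := h'.2.2.2.self_of_nhds.continuousAt
  refine ⟨(c.mul h'.1).add (c'.mul h.1), (c.mul h'.2.1).add (c'.mul h.2.1),
    (c.mul h'.2.2.1).add (c'.mul h.2.2.1), ?_⟩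
  filter_upwards [h.2.2.2, h'.2.2.2] with z hz hz'
  refine (hz.mul hz').congr_fderiv ?_
  ext <;> simp [form₃]

theorem gradAt_const (a : ℂ) : GradAt (fun _ => a) (fun _ => 0) (fun _ => 0) (fun _ => 0) z₀ := by
  refine ⟨continuousAt_const, continuousAt_const, continuousAt_const, .of_forall fun z => ?_⟩
  refine (hasFDerivAt_const a z).congr_fderiv ?_
  ext <;> simp [form₃]

/-- The value of a linear form. -/
def lin (u v w : ℂ) (z : ℂ × ℂ × ℂ) : ℂ := u * z.1 + v * z.2.1 + w * z.2.2

theorem hasFDerivAt_lin (u v w : ℂ) (z : ℂ × ℂ × ℂ) : HasFDerivAt (lin u v w) (form₃ u v w) z := by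
  have : lin u v w = form₃ u v w := by ext z; simp [lin, form₃]
  rw [this]
  exact (form₃ u v w).hasFDerivAt

theorem gradAt_lin (u v w : ℂ) : GradAt (lin u v w) (fun _ => u) (fun _ => v) (fun _ => w) z₀ :=
  ⟨continuousAt_const, continuousAt_const, continuousAt_const,
    .of_forall fun z => hasFDerivAt_lin u v w z⟩

theorem GradAt.const_mul (a : ℂ) (h : GradAt F P Q R z₀) :
    GradAt (fun z => a * F z) (fun z => a * P z) (fun z => a * Q z) (fun z => a * R z) z₀ := by
  simpa using (gradAt_const a).mul h

theorem GradAt.neg (h : GradAt F P Q R z₀) :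
    GradAt (fun z => -F z) (fun z => -P z) (fun z => -Q z) (fun z => -R z) z₀ := by
  simpa using h.const_mul (-1)

theorem GradAt.sub (h : GradAt F P Q R z₀) (h' : GradAt F' P' Q' R' z₀) :
    GradAt (fun z => F z - F' z) (fun z => P z - P' z) (fun z => Q z - Q' z)
      (fun z => R z - R' z) z₀ := by
  simpa [sub_eq_add_neg] using h.add h'.neg

theorem GradAt.swap (h : GradAt F P Q R z₀) :
    GradAt (fun z => F (z.2.1, z.1, z.2.2)) (fun z => Q (z.2.1, z.1, z.2.2))
      (fun z => P (z.2.1, z.1, z.2.2)) (fun z => R (z.2.1, z.1, z.2.2))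
      (z₀.2.1, z₀.1, z₀.2.2) := by
  let T : ℂ × ℂ × ℂ →L[ℂ] ℂ × ℂ × ℂ := (form₃ 0 1 0).prod ((form₃ 1 0 0).prod (form₃ 0 0 1))
  have hT : ∀ z, (z.2.1, z.1, z.2.2) = T z := fun z => by simp [T, form₃]
  have hc : ContinuousAt T (z₀.2.1, z₀.1, z₀.2.2) := T.continuous.continuousAt
  have h0 : T (z₀.2.1, z₀.1, z₀.2.2) = z₀ := by rw [← hT]
  simp only [hT]
  rw [← hT z₀]
  refine ⟨ContinuousAt.comp (by rw [h0]; exact h.2.1) hc,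
    ContinuousAt.comp (by rw [h0]; exact h.1) hc,
    ContinuousAt.comp (by rw [h0]; exact h.2.2.1) hc, ?_⟩
  have ht : Tendsto T (𝓝 (z₀.2.1, z₀.1, z₀.2.2)) (𝓝 z₀) := by
    have := hc.tendsto; rwa [h0] at this
  filter_upwards [ht.eventually h.2.2.2] with z hz
  refine (hz.comp z T.hasFDerivAt).congr_fderiv ?_
  ext <;> simp [form₃, T]

/-- A branch of the logarithm and a primitive of it on a disc. Such primitives replace dilogarithms
in the Lagrangians, so no closed formula for them is needed. -/
theorem exists_local_log {g : ℂ → ℂ} (hg : Differentiable ℂ g) {t₀ : ℂ} (h : g t₀ ≠ 0) :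
    ∃ l G : ℂ → ℂ, ∀ᶠ t in 𝓝 t₀, exp (l t) = g t ∧ HasDerivAt l (deriv g t / g t) t ∧
      HasDerivAt G (l t) t := by
  -- Division by `g t₀` moves the value at `t₀` to `1`, away from the cut of the principal
  -- logarithm.
  let l : ℂ → ℂ := fun t => log (g t / g t₀) + log (g t₀)
  have h1 : ∀ᶠ t in 𝓝 t₀, g t / g t₀ ∈ slitPlane := by
    have hc : ContinuousAt (fun t => g t / g t₀) t₀ :=
      hg.continuous.continuousAt.div_const _
    refine hc.eventually_mem (isOpen_slitPlane.mem_nhds ?_)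
    simp [h]
  have h2 : ∀ᶠ t in 𝓝 t₀, g t ≠ 0 := hg.continuous.continuousAt.eventually_ne h
  have h3 : ∀ᶠ t in 𝓝 t₀, HasDerivAt l (deriv g t / g t) t := by
    filter_upwards [h1, h2] with t ht ht2
    have := (((hg t).hasDerivAt.div_const (g t₀)).clog ht).add_const (log (g t₀))
    refine this.congr_deriv ?_
    field_simp
  obtain ⟨r, hr, hb⟩ := Metric.eventually_nhds_iff_ball.1 h3
  have hd : DifferentiableOn ℂ l (Metric.ball t₀ r) := fun t ht =>
    (hb t ht).differentiableAt.differentiableWithinAt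
  obtain ⟨G, hG⟩ := hd.isExactOn_ball
  refine ⟨l, G, ?_⟩
  filter_upwards [h2, h3, Metric.ball_mem_nhds t₀ hr] with t ht1 ht2 ht3
  refine ⟨?_, ht2, hG t ht3⟩
  simp only [l]
  rw [exp_add, exp_log (div_ne_zero ht1 h), exp_log h, div_mul_cancel₀ _ h]

theorem continuous_lin (u v w : ℂ) : Continuous (lin u v w) := by unfold lin; fun_prop

theorem GradAt.congr (h : GradAt F P Q R z₀) (hP : ∀ z, P' z = P z) (hQ : ∀ z, Q' z = Q z)
    (hR : ∀ z, R' z = R z) : GradAt F P' Q' R' z₀ := by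
  rwa [funext hP, funext hQ, funext hR]

theorem exists_log_lin (u v w μ : ℂ) (h : lin u v w z₀ + μ ≠ 0) :
    ∃ l : ℂ × ℂ × ℂ → ℂ, GradAt l (fun z => u / (lin u v w z + μ))
      (fun z => v / (lin u v w z + μ)) (fun z => w / (lin u v w z + μ)) z₀ ∧
      ∀ᶠ z in 𝓝 z₀, exp (l z) = lin u v w z + μ := by
  obtain ⟨l, G, hl⟩ := exists_local_log (g := fun t => t + μ) (by fun_prop) h
  have hl' := (continuous_lin u v w).continuousAt.eventually hl
  have hc (a : ℂ) : ContinuousAt (fun z => a / (lin u v w z + μ)) z₀ :=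
    continuousAt_const.div ((continuous_lin u v w).continuousAt.add continuousAt_const) h
  refine ⟨fun z => l (lin u v w z), ⟨hc u, hc v, hc w, ?_⟩, hl'.mono fun z hz => hz.1⟩
  filter_upwards [hl'] with z hz
  refine (hz.2.1.comp_hasFDerivAt z (hasFDerivAt_lin u v w z)).congr_fderiv ?_
  ext <;> simp [form₃] <;> ring

/-- A primitive of a logarithm composed with a linear form has partial derivatives proportional to
the same logarithm. Sums of such functions have derivatives matching the factorised legs and
biquadratics. -/
theorem exists_log_primitive {g : ℂ → ℂ} (hg : Differentiable ℂ g) (u v w : ℂ)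
    (h : g (lin u v w z₀) ≠ 0) :
    ∃ G l : ℂ × ℂ × ℂ → ℂ, GradAt G (fun z => l z * u) (fun z => l z * v) (fun z => l z * w) z₀ ∧
      ∀ᶠ z in 𝓝 z₀, exp (l z) = g (lin u v w z) := by
  obtain ⟨l, G, hl⟩ := exists_local_log hg h
  have hl' := (continuous_lin u v w).continuousAt.eventually hl
  have hc : ContinuousAt (fun z => l (lin u v w z)) z₀ :=
    ContinuousAt.comp hl.self_of_nhds.2.1.continuousAt (continuous_lin u v w).continuousAt
  refine ⟨fun z => G (lin u v w z), fun z => l (lin u v w z), ⟨hc.mul continuousAt_const,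
    hc.mul continuousAt_const, hc.mul continuousAt_const, ?_⟩, hl'.mono fun z hz => hz.1⟩
  filter_upwards [hl'] with z hz
  refine (hz.2.2.comp_hasFDerivAt z (hasFDerivAt_lin u v w z)).congr_fderiv ?_
  ext <;> simp [form₃]

end

section

/-! ## Existence of the Lagrangians -/

/-- `F` is a potential of the leg functions and of the logarithm of the biquadratic. -/
def Potential (k : Family) (ε δ : ℂ) (cu cv : Bool) (F P Q R : ℂ × ℂ × ℂ → ℂ)
    (z₀ : ℂ × ℂ × ℂ) : Prop :=
  GradAt F P Q R z₀ ∧ ∀ᶠ z in 𝓝 z₀, leg k ε δ cu cv z.2.2 z.1 z.2.1 (P z) ∧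
    leg k ε δ cv cu z.2.2 z.2.1 z.1 (Q z) ∧
    exp (R z) = pairH k ε δ cu cv z.2.2 (cunif k ε δ cu z.1) (cunif k ε δ cv z.2.1)

variable {ε δ : ℂ} {z₀ : ℂ × ℂ × ℂ}

theorem exists_long_I_zero
    (h : pairH .I 0 δ true true z₀.2.2 (cunif .I 0 δ true z₀.1) (cunif .I 0 δ true z₀.2.1) ≠ 0) :
    ∃ F P Q R, Potential .I 0 δ true true F P Q R z₀ := by
  have hβ : z₀.2.2 ≠ 0 := by simpa [weight] using weight_ne_zero_of_pairH h
  have h1 : z₀.1 - z₀.2.1 ≠ 0 := by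
    intro h0
    apply h
    simp [pairH, hLong, h0, cunif, unif]
  obtain ⟨l, hl, el⟩ := exists_log_lin (z₀ := z₀) 1 (-1) 0 0
    (by simpa [lin, ← sub_eq_add_neg] using h1)
  obtain ⟨G, l₀, hG, e₀⟩ := exists_log_primitive (z₀ := z₀) (g := fun t => -2 * t) (by fun_prop)
    0 0 1 (by simpa [lin] using hβ)
  -- The potential is `2 * β * log (X - Y) - G(β)`, where the derivative of `G` is a branch of `log
  -- (-2 * β)`.
  refine ⟨_, fun z => 2 * z.2.2 / (z.1 - z.2.1), fun z => 2 * z.2.2 / (z.2.1 - z.1),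
    fun z => l z + l z - l₀ z, (((gradAt_lin 0 0 2).mul hl).sub hG).congr ?_ ?_ ?_, ?_⟩
  · intro z; simp only [lin]; ring_nf
  · intro z; rw [← neg_sub z.1 z.2.1, div_neg]; simp only [lin]; ring_nf
  · intro z; simp only [lin]; ring_nf
  filter_upwards [el, e₀] with z h1 h0
  refine ⟨by simp [leg, IsPhi], by simp [leg, IsPhi], ?_⟩
  rw [exp_sub, exp_add, h1, h0]
  simp only [pairH, hLong, cunif, unif, lin]
  ring_nf

theorem exists_long_I (hε : ε ≠ 0)
    (h : pairH .I ε δ true true z₀.2.2 (cunif .I ε δ true z₀.1) (cunif .I ε δ true z₀.2.1) ≠ 0) :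
    ∃ F P Q R, Potential .I ε δ true true F P Q R z₀ := by
  have hβ : z₀.2.2 ≠ 0 := by simpa [weight] using weight_ne_zero_of_pairH h
  have h1 := mt (pairH_zero_of_leg (by simpa [rate] using hε)) h
  simp only [legN, legD, legN.phiN, legD.phiD, hε, if_false, mul_eq_zero, not_or] at h1
  obtain ⟨G₁, l₁, hG₁, e₁⟩ := exists_log_primitive (z₀ := z₀) (g := fun t => t) (by fun_prop)
    1 (-1) ε (by convert h1.1 using 1; simp only [lin]; ring)
  obtain ⟨G₂, l₂, hG₂, e₂⟩ := exists_log_primitive (z₀ := z₀) (g := fun t => t) (by fun_prop)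
    1 (-1) (-ε) (by convert h1.2 using 1; simp only [lin]; ring)
  obtain ⟨G, l₀, hG, e₀⟩ := exists_log_primitive (z₀ := z₀) (g := fun t => -2 * t) (by fun_prop)
    0 0 1 (by simpa [lin] using hβ)
  -- The potential is `(G₁(X - Y + ε * β) - G₂(X - Y - ε * β)) / ε - G(β)`; the two factors of the
  -- biquadratic are the arguments of `G₁` and `G₂`.
  refine ⟨_, fun z => (l₁ z - l₂ z) / ε, fun z => (l₂ z - l₁ z) / ε,
    fun z => l₁ z + l₂ z - l₀ z, (((hG₁.sub hG₂).const_mul ε⁻¹).sub hG).congr ?_ ?_ ?_, ?_⟩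
  · intro z; ring
  · intro z; ring
  · intro z; field_simp; ring
  filter_upwards [e₁, e₂, e₀] with z h1 h2 h0
  simp only [show lin 0 0 1 z = z.2.2 by simp [lin]] at h0
  simp only [leg, IsPhi, hε, if_false, mul_div_cancel₀ _ hε]
  refine ⟨?_, ?_, ?_⟩
  · rw [exp_sub, h1, h2]
    simp only [lin]
    ring_nf
  · rw [exp_sub, h1, h2, ← neg_div_neg_eq]
    simp only [lin]
    ring_nf
  · have hz : z.2.2 ≠ 0 := by
      intro hz
      have := exp_ne_zero (l₀ z)
      simp [h0, hz] at this
    rw [exp_sub, exp_add, h1, h2, h0]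
    simp only [pairH, hLong, cunif, unif, lin]
    field_simp
    ring

theorem exists_long_II
    (h : pairH .II ε δ true true z₀.2.2 (cunif .II ε δ true z₀.1) (cunif .II ε δ true z₀.2.1) ≠ 0) :
    ∃ F P Q R, Potential .II ε δ true true F P Q R z₀ := by
  have hβ : z₀.2.2 ≠ 0 := by simpa [weight] using weight_ne_zero_of_pairH h
  have h1 := mt (pairH_zero_of_leg (by simp [rate])) h
  simp only [legN, legD, legN.phiN, legD.phiD, mul_eq_zero, not_or] at h1
  obtain ⟨G₁, l₁, hG₁, e₁⟩ := exists_log_primitive (z₀ := z₀) (g := fun t => t) (by fun_prop)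
    1 (-1) 1 (by convert h1.1.1 using 1; simp only [lin]; ring)
  obtain ⟨G₂, l₂, hG₂, e₂⟩ := exists_log_primitive (z₀ := z₀) (g := fun t => 1 + ε * t)
    (by fun_prop) 1 1 1 (by convert h1.1.2 using 1; simp only [lin]; ring)
  obtain ⟨G₃, l₃, hG₃, e₃⟩ := exists_log_primitive (z₀ := z₀) (g := fun t => t) (by fun_prop)
    1 (-1) (-1) (by convert h1.2.1 using 1; simp only [lin]; ring)
  obtain ⟨G₄, l₄, hG₄, e₄⟩ := exists_log_primitive (z₀ := z₀) (g := fun t => 1 + ε * t)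
    (by fun_prop) 1 1 (-1) (by convert h1.2.2 using 1; simp only [lin]; ring)
  obtain ⟨G, l₀, hG, e₀⟩ := exists_log_primitive (z₀ := z₀) (g := fun t => -2 * t) (by fun_prop)
    0 0 1 (by simpa [lin] using hβ)
  -- Each linear factor of the leg contributes one primitive; passing from `X` to `Y` reverses the
  -- sign of the terms in `X - Y ± β` only.
  refine ⟨_, fun z => l₁ z + l₂ z - (l₃ z + l₄ z), fun z => l₃ z + l₂ z - (l₁ z + l₄ z),
    fun z => l₁ z + l₂ z + (l₃ z + l₄ z) - l₀ z,
    (((hG₁.add hG₂).sub (hG₃.add hG₄)).sub hG).congr ?_ ?_ ?_, ?_⟩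
  · intro z; ring
  · intro z; ring
  · intro z; ring
  filter_upwards [e₁, e₂, e₃, e₄, e₀] with z h1 h2 h3 h4 h0
  simp only [show lin 0 0 1 z = z.2.2 by simp [lin]] at h0
  simp only [leg, IsPhi]
  refine ⟨?_, ?_, ?_⟩
  · simp only [exp_sub, exp_add, h1, h2, h3, h4, lin]
    ring_nf
  · simp only [exp_sub, exp_add, h1, h2, h3, h4]
    -- Exchanging the ends turns `X - Y ± β` into `-(Y - X ∓ β)`. The two minus signs cancel in the
    -- quotient, so no half-period appears.
    rw [← neg_div_neg_eq]
    simp only [lin]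
    ring_nf
  · have hz : z.2.2 ≠ 0 := by
      intro hz
      have := exp_ne_zero (l₀ z)
      simp [h0, hz] at this
    simp only [exp_sub, exp_add, h1, h2, h3, h4, h0]
    simp only [pairH, hLong, cunif, unif, lin, if_true]
    field_simp
    ring

theorem exists_long_III_zero
    (h : pairH .III 0 δ true true z₀.2.2 (cunif .III 0 δ true z₀.1) (cunif .III 0 δ true z₀.2.1)
      ≠ 0) :
    ∃ F P Q R, Potential .III 0 δ true true F P Q R z₀ := by
  have hβ : sinh (2 * z₀.2.2) ≠ 0 := by simpa [weight] using weight_ne_zero_of_pairH h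
  have h1 := mt (pairH_zero_of_leg (by simp [rate])) h
  simp only [legN, legD, legN.phiN, legD.phiD, mul_eq_zero, not_or, if_true, exp_ne_zero,
    not_false_eq_true, true_and] at h1
  obtain ⟨G₁, l₁, hG₁, e₁⟩ := exists_log_primitive (z₀ := z₀) (g := sinh) differentiable_sinh
    1 (-1) 1 (by convert h1.1 using 2; simp only [lin]; ring)
  obtain ⟨G₂, l₂, hG₂, e₂⟩ := exists_log_primitive (z₀ := z₀) (g := sinh) differentiable_sinh
    1 (-1) (-1) (by convert h1.2 using 2; simp only [lin]; ring)
  obtain ⟨G, l₀, hG, e₀⟩ := exists_log_primitive (z₀ := z₀) (g := fun t => -sinh (2 * t) / 4)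
    (by fun_prop) 0 0 1 (by simpa [lin] using hβ)
  -- The biquadratic is `-4 * exp (2 * X + 2 * Y)` times the two hyperbolic sines over `sinh (2 *
  -- β)`; its exponential factor produces the term `2 * β * (X + Y)`, which also accounts for the
  -- shift `2 * β` in the leg.
  refine ⟨_, fun z => l₁ z - l₂ z + 2 * z.2.2, fun z => l₂ z - l₁ z + 2 * z.2.2,
    fun z => l₁ z + l₂ z - l₀ z + (2 * z.1 + 2 * z.2.1),
    (((hG₁.sub hG₂).sub hG).add ((gradAt_lin 0 0 2).mul (gradAt_lin 1 1 0))).congr ?_ ?_ ?_, ?_⟩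
  · intro z; simp only [lin]; ring
  · intro z; simp only [lin]; ring
  · intro z; simp only [lin]; ring
  filter_upwards [e₁, e₂, e₀] with z h1 h2 h0
  simp only [show lin 0 0 1 z = z.2.2 by simp [lin]] at h0
  simp only [leg, IsPhi, if_true, add_sub_cancel_right]
  refine ⟨?_, ?_, ?_⟩
  · rw [exp_sub, h1, h2]
    simp only [lin]
    ring_nf
  · rw [exp_sub, h1, h2, ← neg_div_neg_eq, ← sinh_neg, ← sinh_neg]
    simp only [lin]
    ring_nf
  · have hz : sinh (2 * z.2.2) ≠ 0 := by
      intro hz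
      have := exp_ne_zero (l₀ z)
      simp [h0, hz] at this
    rw [exp_add, exp_sub, exp_add, h1, h2, h0]
    simp only [pairH, hLong, cunif, unif, lin, if_true, one_mul, neg_one_mul]
    generalize sinh (2 * z.2.2) = t at hz ⊢
    have := exp_ne_zero z.1
    have := exp_ne_zero z.2.1
    have := exp_ne_zero z.2.2
    simp only [sinh_eq_exp, exp_add, exp_neg, exp_two_mul_eq, neg_neg]
    generalize exp z.1 = x at *
    generalize exp z.2.1 = y at *
    generalize exp z.2.2 = b at *
    field_simp
    ring

theorem exists_long_III (hε : ε ≠ 0)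
    (h : pairH .III ε δ true true z₀.2.2 (cunif .III ε δ true z₀.1) (cunif .III ε δ true z₀.2.1)
      ≠ 0) :
    ∃ F P Q R, Potential .III ε δ true true F P Q R z₀ := by
  have hβ : sinh (2 * z₀.2.2) ≠ 0 := by simpa [weight] using weight_ne_zero_of_pairH h
  have hδ : δ ≠ 0 := by
    rintro rfl
    exact h (by simp [pairH, hLong, cunif, unif, hε])
  have h1 := mt (pairH_zero_of_leg (by simp [rate])) h
  simp only [legN, legD, legN.phiN, legD.phiD, mul_eq_zero, not_or, if_false, hε] at h1
  obtain ⟨G₁, l₁, hG₁, e₁⟩ := exists_log_primitive (z₀ := z₀) (g := sinh) differentiable_sinh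
    1 (-1) 1 (by convert h1.1.2 using 2; simp only [lin]; ring)
  obtain ⟨G₂, l₂, hG₂, e₂⟩ := exists_log_primitive (z₀ := z₀) (g := sinh) differentiable_sinh
    1 1 1 (by convert h1.1.1 using 2; simp only [lin]; ring)
  obtain ⟨G₃, l₃, hG₃, e₃⟩ := exists_log_primitive (z₀ := z₀) (g := sinh) differentiable_sinh
    1 (-1) (-1) (by convert h1.2.2 using 2; simp only [lin]; ring)
  obtain ⟨G₄, l₄, hG₄, e₄⟩ := exists_log_primitive (z₀ := z₀) (g := sinh) differentiable_sinh
    1 1 (-1) (by convert h1.2.1 using 2; simp only [lin]; ring)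
  obtain ⟨G, l₀, hG, e₀⟩ := exists_log_primitive (z₀ := z₀)
    (g := fun t => -sinh (2 * t) / (16 * δ ^ 2 * ε ^ 2)) (by fun_prop) 0 0 1
    (by simpa [lin, hε, hδ] using hβ)
  refine ⟨_, fun z => l₂ z + l₁ z - (l₄ z + l₃ z), fun z => l₂ z + l₃ z - (l₄ z + l₁ z),
    fun z => l₁ z + l₂ z + (l₃ z + l₄ z) - l₀ z,
    (((hG₁.add hG₂).sub (hG₃.add hG₄)).sub hG).congr ?_ ?_ ?_, ?_⟩
  · intro z; ring
  · intro z; ring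
  · intro z; ring
  filter_upwards [e₁, e₂, e₃, e₄, e₀] with z h1 h2 h3 h4 h0
  simp only [show lin 0 0 1 z = z.2.2 by simp [lin]] at h0
  simp only [leg, IsPhi, if_false, hε]
  refine ⟨?_, ?_, ?_⟩
  · simp only [exp_sub, exp_add, h1, h2, h3, h4, lin]
    ring_nf
  · simp only [exp_sub, exp_add, h1, h2, h3, h4]
    rw [← neg_div_neg_eq, ← mul_neg, ← mul_neg, ← sinh_neg, ← sinh_neg]
    simp only [lin]
    ring_nf
  · have hz : sinh (2 * z.2.2) ≠ 0 := by
      intro hz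
      have := exp_ne_zero (l₀ z)
      simp [h0, hz] at this
    simp only [exp_sub, exp_add, h1, h2, h3, h4, h0]
    simp only [pairH, hLong, cunif, unif, lin, if_true, if_false, one_mul, neg_one_mul, hε]
    rw [eq_comm, ← sub_eq_zero]
    have hs : sinh (2 * z.2.2) = (exp z.2.2 ^ 2 - (exp z.2.2 ^ 2)⁻¹) / 2 := by
      simp only [sinh_eq_exp, exp_neg, exp_two_mul_eq]
    have := exp_ne_zero z.1
    have := exp_ne_zero z.2.1
    have := exp_ne_zero z.2.2
    generalize sinh (2 * z.2.2) = t at hz hs ⊢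
    simp only [sinh_eq_exp, cosh_eq_exp, exp_add, exp_neg, exp_two_mul_eq, neg_neg]
    generalize exp z.1 = x at *
    generalize exp z.2.1 = y at *
    generalize exp z.2.2 = b at *
    field_simp at hs ⊢
    grind

theorem exists_short_I_zero : ∃ F P Q R, Potential .I 0 δ true false F P Q R z₀ := by
  refine ⟨_, fun z => 2 * z.2.1, fun z => 2 * z.1, fun z => -log 2,
    (((gradAt_lin 2 0 0).mul (gradAt_lin 0 1 0)).sub (gradAt_lin 0 0 (log 2))).congr ?_ ?_ ?_, ?_⟩
  · intro z; simp only [lin]; ring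
  · intro z; simp only [lin]; ring
  · intro z; simp only [lin]; ring
  refine .of_forall fun z => ⟨by simp [leg, IsPsi], by simp [leg, IsPsiBar], ?_⟩
  rw [exp_neg, exp_log two_ne_zero]
  simp [pairH, hShort]

theorem exists_short_I (hε : ε ≠ 0)
    (h : pairH .I ε δ true false z₀.2.2 (cunif .I ε δ true z₀.1) (cunif .I ε δ false z₀.2.1) ≠ 0) :
    ∃ F P Q R, Potential .I ε δ true false F P Q R z₀ := by
  have h1 := mt (pairH_zero_of_leg (by simpa [rate] using hε)) h
  simp only [legN, legD, hε, if_false, mul_eq_zero, not_or] at h1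
  obtain ⟨l₁, hl₁, e₁⟩ := exists_log_lin (z₀ := z₀) 0 ε 0 1
    (by convert h1.1 using 1; simp only [lin]; ring)
  obtain ⟨l₂, hl₂, e₂⟩ := exists_log_lin (z₀ := z₀) 0 (-ε) 0 1
    (by convert h1.2 using 1; simp only [lin]; ring)
  -- The potential is `X * (l₁ - l₂) / ε + α * (l₁ + l₂) - α * log 2`, with `l₁`, `l₂` the
  -- logarithms of `1 ± ε * Y`. It is affine in `X` and in `α`, so the logarithms need not be
  -- integrated.
  refine ⟨_, fun z => (l₁ z - l₂ z) / ε, fun z => z.1 * (1 / (1 + ε * z.2.1) + 1 / (1 - ε * z.2.1))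
    + z.2.2 * (ε / (1 + ε * z.2.1) - ε / (1 - ε * z.2.1)),
    fun z => l₁ z + l₂ z - log 2, ((((gradAt_lin ε⁻¹ 0 0).mul (hl₁.sub hl₂)).add
      ((gradAt_lin 0 0 1).mul (hl₁.add hl₂))).sub (gradAt_lin 0 0 (log 2))).congr ?_ ?_ ?_, ?_⟩
  · intro z; simp only [lin]; ring
  · intro z; simp only [lin]; field_simp; ring_nf
  · intro z; simp only [lin]; ring
  filter_upwards [e₁, e₂] with z h1 h2
  have n1 : 1 + ε * z.2.1 ≠ 0 := by
    rw [show 1 + ε * z.2.1 = exp (l₁ z) by rw [h1]; simp only [lin]; ring]; exact exp_ne_zero _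
  have n2 : 1 - ε * z.2.1 ≠ 0 := by
    rw [show 1 - ε * z.2.1 = exp (l₂ z) by rw [h2]; simp only [lin]; ring]; exact exp_ne_zero _
  have n3 : 1 - ε ^ 2 * z.2.1 ^ 2 ≠ 0 := by
    rw [show 1 - ε ^ 2 * z.2.1 ^ 2 = (1 + ε * z.2.1) * (1 - ε * z.2.1) by ring]
    exact mul_ne_zero n1 n2
  simp only [leg, IsPsi, IsPsiBar, hε, if_false]
  refine ⟨?_, ?_, ?_⟩
  · rw [mul_div_cancel₀ _ hε, exp_sub, h1, h2]
    simp only [lin]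
    ring_nf
  · field_simp
    ring
  · rw [exp_sub, exp_add, h1, h2, exp_log two_ne_zero]
    simp only [pairH, hShort, cunif, unif, lin]
    ring_nf

theorem exists_short_II
    (h : pairH .II ε δ true false z₀.2.2 (cunif .II ε δ true z₀.1) (cunif .II ε δ false z₀.2.1)
      ≠ 0) :
    ∃ F P Q R, Potential .II ε δ true false F P Q R z₀ := by
  have h1 := mt (pairH_zero_of_leg (by simp [rate])) h
  simp only [legN, legD, mul_eq_zero, not_or] at h1
  obtain ⟨G₁, l₁, hG₁, e₁⟩ := exists_log_primitive (z₀ := z₀) (g := fun t => t) (by fun_prop)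
    1 1 1 (by convert h1.1 using 1; simp only [lin]; ring)
  obtain ⟨G₂, l₂, hG₂, e₂⟩ := exists_log_primitive (z₀ := z₀) (g := fun t => 1 + ε * t)
    (by fun_prop) 1 (-1) (-1) (by convert h1.2 using 1; simp only [lin]; ring)
  -- The potential is `G₁(X + Y + α) - G₂(X - Y - α)`; its derivatives in `Y` and in `α` coincide,
  -- as do `exp` of the leg at the white vertex and the biquadratic.
  refine ⟨_, fun z => l₁ z - l₂ z, fun z => l₁ z + l₂ z, fun z => l₁ z + l₂ z,
    (hG₁.sub hG₂).congr ?_ ?_ ?_, ?_⟩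
  · intro z; ring
  · intro z; ring
  · intro z; ring
  filter_upwards [e₁, e₂] with z h1 h2
  simp only [leg, IsPsi, IsPsiBar]
  refine ⟨?_, ?_, ?_⟩
  · rw [exp_sub, h1, h2]
    simp only [lin]
    ring_nf
  · rw [exp_add, h1, h2]
    simp only [lin]
    ring_nf
  · rw [exp_add, h1, h2]
    simp only [lin, pairH, hShort, cunif, unif, Bool.false_eq_true, if_true, if_false]
    ring_nf

theorem exists_short_III_zero
    (h : pairH .III 0 δ true false z₀.2.2 (cunif .III 0 δ true z₀.1) (cunif .III 0 δ false z₀.2.1)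
      ≠ 0) :
    ∃ F P Q R, Potential .III 0 δ true false F P Q R z₀ := by
  have hg (z : ℂ × ℂ × ℂ) : exp (2 * lin 1 1 (-1) z) + δ ^ 2 =
      (exp (2 * z.1 + 2 * z.2.1) + δ ^ 2 * exp (2 * z.2.2)) / exp (2 * z.2.2) := by
    rw [show 2 * lin 1 1 (-1) z = 2 * z.1 + 2 * z.2.1 - 2 * z.2.2 by simp only [lin]; ring, exp_sub]
    field_simp
  have h1 := mt (pairH_zero_of_leg (by simp [rate])) h
  simp only [legN, legD, mul_eq_zero, not_or, if_true, exp_ne_zero, not_false_eq_true,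
    true_and] at h1
  obtain ⟨G₁, l₁, hG₁, e₁⟩ := exists_log_primitive (z₀ := z₀) (g := fun t => exp (2 * t) + δ ^ 2)
    (by fun_prop) 1 1 (-1) (by rw [hg]; exact div_ne_zero h1 (exp_ne_zero _))
  refine ⟨_, fun z => -l₁ z, fun z => -l₁ z, fun z => l₁ z + 2 * z.2.2 + log (-2),
    ((((gradAt_lin 0 0 1).mul (gradAt_lin 0 0 1)).add (gradAt_lin 0 0 (log (-2)))).sub hG₁).congr
      ?_ ?_ ?_, ?_⟩
  · intro z; simp only [lin]; ring
  · intro z; simp only [lin]; ring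
  · intro z; simp only [lin]; ring
  filter_upwards [e₁] with z h1
  rw [hg] at h1
  simp only [leg, IsPsi, IsPsiBar, if_true]
  refine ⟨?_, ?_, ?_⟩
  · rw [exp_neg, h1, inv_div]
  · rw [exp_neg, h1, inv_div]
  · rw [exp_add, exp_add, h1, exp_log (by norm_num)]
    simp only [pairH, hShort, cunif, unif, Bool.false_eq_true, if_true, if_false, exp_add]
    field_simp
    ring

theorem exists_short_III (hε : ε ≠ 0)
    (h : pairH .III ε δ true false z₀.2.2 (cunif .III ε δ true z₀.1) (cunif .III ε δ false z₀.2.1)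
      ≠ 0) :
    ∃ F P Q R, Potential .III ε δ true false F P Q R z₀ := by
  have hg (z : ℂ × ℂ × ℂ) : ε * exp (2 * lin 1 1 (-1) z) + δ =
      (ε * exp (2 * z.1 + 2 * z.2.1) + δ * exp (2 * z.2.2)) / exp (2 * z.2.2) := by
    rw [show 2 * lin 1 1 (-1) z = 2 * z.1 + 2 * z.2.1 - 2 * z.2.2 by simp only [lin]; ring, exp_sub]
    field_simp
  have hg' (z : ℂ × ℂ × ℂ) : ε * exp (2 * lin (-1) 1 (-1) z) + δ =
      (ε * exp (2 * z.2.1 - 2 * z.1) + δ * exp (2 * z.2.2)) / exp (2 * z.2.2) := by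
    rw [show 2 * lin (-1) 1 (-1) z = 2 * z.2.1 - 2 * z.1 - 2 * z.2.2 by simp only [lin]; ring,
      exp_sub _ (2 * z.2.2)]
    field_simp
  have h1 := mt (pairH_zero_of_leg (by simp [rate])) h
  simp only [legN, legD, mul_eq_zero, not_or, if_false, hε] at h1
  obtain ⟨G₁, l₁, hG₁, e₁⟩ := exists_log_primitive (z₀ := z₀) (g := fun t => ε * exp (2 * t) + δ)
    (by fun_prop) (-1) 1 (-1) (by rw [hg']; exact div_ne_zero h1.1 (exp_ne_zero _))
  obtain ⟨G₂, l₂, hG₂, e₂⟩ := exists_log_primitive (z₀ := z₀) (g := fun t => ε * exp (2 * t) + δ)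
    (by fun_prop) 1 1 (-1) (by rw [hg]; exact div_ne_zero h1.2 (exp_ne_zero _))
  -- The potential is `α² + α * log (-2) - G₁(Y - X - α) - G₂(X + Y - α)`. Dividing by `exp (2 * α)`
  -- made the arguments of the logarithms functions of one linear form, and `α²` restores that
  -- factor in the biquadratic.
  refine ⟨_, fun z => l₁ z - l₂ z, fun z => -(l₁ z + l₂ z),
    fun z => l₁ z + l₂ z + 2 * z.2.2 + log (-2),
    ((((gradAt_lin 0 0 1).mul (gradAt_lin 0 0 1)).add (gradAt_lin 0 0 (log (-2)))).sub
      (hG₁.add hG₂)).congr ?_ ?_ ?_, ?_⟩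
  · intro z; simp only [lin]; ring
  · intro z; simp only [lin]; ring
  · intro z; simp only [lin]; ring
  filter_upwards [e₁, e₂] with z h1 h2
  rw [hg'] at h1
  rw [hg] at h2
  simp only [leg, IsPsi, IsPsiBar, if_false, hε]
  refine ⟨?_, ?_, ?_⟩
  · rw [exp_sub, h1, h2, div_div_div_cancel_right₀ (exp_ne_zero _)]
  · rw [exp_neg, exp_add, h1, h2, div_mul_div_comm, inv_div, exp_four_mul_eq, exp_two_mul_eq]
    ring_nf
  · rw [exp_add, exp_add, exp_add, h1, h2, exp_log (by norm_num)]
    simp only [pairH, hShort, cunif, unif, Bool.false_eq_true, if_true, if_false, exp_add, exp_sub,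
      cosh_eq_exp, hε]
    field_simp
    ring

theorem Potential.swap {k : Family} {cu cv : Bool} {F P Q R : ℂ × ℂ × ℂ → ℂ}
    (h : Potential k ε δ cu cv F P Q R z₀) :
    Potential k ε δ cv cu (fun z => F (z.2.1, z.1, z.2.2)) (fun z => Q (z.2.1, z.1, z.2.2))
      (fun z => P (z.2.1, z.1, z.2.2)) (fun z => R (z.2.1, z.1, z.2.2))
      (z₀.2.1, z₀.1, z₀.2.2) := by
  refine ⟨h.1.swap, ?_⟩
  have hc : Tendsto (fun z : ℂ × ℂ × ℂ => (z.2.1, z.1, z.2.2)) (𝓝 (z₀.2.1, z₀.1, z₀.2.2))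
      (𝓝 z₀) :=
    (by fun_prop : Continuous fun z : ℂ × ℂ × ℂ => (z.2.1, z.1, z.2.2)).tendsto
      (z₀.2.1, z₀.1, z₀.2.2)
  filter_upwards [hc.eventually h.2] with z hz
  exact ⟨hz.2.1, hz.1, by rw [hz.2.2, pairH_symm]⟩

theorem exists_potential {k : Family} {cu cv : Bool}
    (h : pairH k ε δ cu cv z₀.2.2 (cunif k ε δ cu z₀.1) (cunif k ε δ cv z₀.2.1) ≠ 0) :
    ∃ F P Q R, Potential k ε δ cu cv F P Q R z₀ := by
  have long (ε : ℂ) (h : pairH k ε δ true true z₀.2.2 (cunif k ε δ true z₀.1)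
      (cunif k ε δ true z₀.2.1) ≠ 0) : ∃ F P Q R, Potential k ε δ true true F P Q R z₀ := by
    rcases eq_or_ne ε 0 with rfl | hε <;> cases k
    · exact exists_long_I_zero h
    · exact exists_long_II h
    · exact exists_long_III_zero h
    · exact exists_long_I hε h
    · exact exists_long_II h
    · exact exists_long_III hε h
  have short (z₀ : ℂ × ℂ × ℂ) (h : pairH k ε δ true false z₀.2.2 (cunif k ε δ true z₀.1)
      (cunif k ε δ false z₀.2.1) ≠ 0) : ∃ F P Q R, Potential k ε δ true false F P Q R z₀ := by
    rcases eq_or_ne ε 0 with rfl | hε <;> cases k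
    · exact exists_short_I_zero
    · exact exists_short_II h
    · exact exists_short_III_zero h
    · exact exists_short_I hε h
    · exact exists_short_II h
    · exact exists_short_III hε h
  cases cu <;> cases cv
  · obtain ⟨F, P, Q, R, hF⟩ := long 0 (by simpa [pairH, cunif] using h)
    exact ⟨F, P, Q, R, by simpa [Potential, leg, pairH, cunif] using hF⟩
  · obtain ⟨F, P, Q, R, hF⟩ := short (z₀.2.1, z₀.1, z₀.2.2) (by rwa [pairH_symm])
    exact ⟨_, _, _, _, hF.swap⟩
  · exact short z₀ h
  · exact long ε h

theorem Potential.congr {k : Family} {cu cv : Bool} {F F' P Q R : ℂ × ℂ × ℂ → ℂ}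
    (h : Potential k ε δ cu cv F P Q R z₀) (e : F' =ᶠ[𝓝 z₀] F) :
    Potential k ε δ cu cv F' P Q R z₀ := by
  refine ⟨⟨h.1.1, h.1.2.1, h.1.2.2.1, ?_⟩, h.2⟩
  filter_upwards [h.1.2.2.2, e.eventually_nhds] with z hz ez
  exact hz.congr_of_eventuallyEq ez

/-- Any admissible first jet is attained: two values of a leg differ by a period, so adding an
affine function changes the branches of all three derivatives independently and keeps them values of
the same multivalued functions. -/
theorem exists_potential_of_jet {k : Family} {cu cv : Bool} {p q r : ℂ}
    (h : pairH k ε δ cu cv z₀.2.2 (cunif k ε δ cu z₀.1) (cunif k ε δ cv z₀.2.1) ≠ 0)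
    (hp : leg k ε δ cu cv z₀.2.2 z₀.1 z₀.2.1 p) (hq : leg k ε δ cv cu z₀.2.2 z₀.2.1 z₀.1 q)
    (hr : exp r = pairH k ε δ cu cv z₀.2.2 (cunif k ε δ cu z₀.1) (cunif k ε δ cv z₀.2.1)) :
    ∃ F P Q R, Potential k ε δ cu cv F P Q R z₀ ∧ F z₀ = 0 ∧ P z₀ = p ∧ Q z₀ = q ∧ R z₀ = r := by
  obtain ⟨F, P, Q, R, hF, hF'⟩ := exists_potential h
  have h0 := hF'.self_of_nhds
  refine ⟨_, fun z => P z + (p - P z₀), fun z => Q z + (q - Q z₀), fun z => R z + (r - R z₀),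
    ⟨((hF.add (gradAt_lin (p - P z₀) (q - Q z₀) (r - R z₀))).sub (gradAt_const
      (F z₀ + lin (p - P z₀) (q - Q z₀) (r - R z₀) z₀))).congr ?_ ?_ ?_, ?_⟩, ?_, ?_, ?_, ?_⟩
  · intro z; ring
  · intro z; ring
  · intro z; ring
  rotate_left
  · ring
  · ring
  · ring
  · ring
  filter_upwards [hF'] with z hz
  refine ⟨(leg_iff_isPer hz.1).2 ?_, (leg_iff_isPer hz.2.1).2 ?_, ?_⟩
  · rw [add_sub_cancel_left]; exact (leg_iff_isPer h0.1).1 hp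
  · rw [add_sub_cancel_left]; exact (leg_iff_isPer h0.2.1).1 hq
  · rw [exp_add, exp_sub, hr, h0.2.2, div_self h, mul_one, hz.2.2]

end

section

variable {m : ℕ}

/-! ## The system in terms of coloured squares -/

theorem step_comm (n : Lattice m) (i j : Fin m) : step (step n i) j = step (step n j) i := by
  simp only [step]; abel

/-- Whether the direction `i` changes the colour. -/
def QuadSystem.alt (s : QuadSystem m) (i : Fin m) : Bool := decide (i ∈ s.S)

theorem QuadSystem.black_step (s : QuadSystem m) (n : Lattice m) (i : Fin m) :
    s.black (step n i) = xor (s.black n) (s.alt i) := by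
  have h : ∑ x ∈ s.S, step n i x = ∑ x ∈ s.S, n x + if i ∈ s.S then 1 else 0 := by
    simp only [step, Pi.add_apply, Finset.sum_add_distrib, Pi.single_apply, Finset.sum_ite_eq']
  rw [QuadSystem.black, QuadSystem.black, QuadSystem.alt, h]
  by_cases hi : i ∈ s.S
  · rw [if_pos hi, ← add_assoc]
    by_cases he : Even (s.c + ∑ x ∈ s.S, n x)
    · simp [hi, he, Int.even_add_one]
    · simp [hi, he, Int.even_add_one, Int.not_even_iff_odd.1 he]
  · simp [hi]

theorem QuadSystem.field_eq (s : QuadSystem m) (X : Lattice m → ℂ) (n : Lattice m) :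
    s.field X n = cunif s.k s.ε s.δ (s.black n) (X n) := rfl

theorem QuadSystem.face_eq (s : QuadSystem m) (X : Lattice m → ℂ) (α : Fin m → ℂ)
    (n : Lattice m) (i j : Fin m) :
    s.face X α n i j = vquad s.k s.ε s.δ (s.black n) (s.alt i) (s.alt j) (α i) (α j)
      (cunif s.k s.ε s.δ (s.black n) (X n))
      (cunif s.k s.ε s.δ (xor (s.black n) (s.alt i)) (X (step n i)))
      (cunif s.k s.ε s.δ (xor (xor (s.black n) (s.alt i)) (s.alt j)) (X (step (step n i) j)))
      (cunif s.k s.ε s.δ (xor (s.black n) (s.alt j)) (X (step n j))) := by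
  rw [← s.black_step n j, ← s.black_step n i, ← s.black_step (step n i) j]
  rfl

theorem QuadSystem.biquad_eq (s : QuadSystem m) (X : Lattice m → ℂ) (u v : Lattice m) (β : ℂ) :
    s.biquad X u v β = pairH s.k s.ε s.δ (s.black u) (s.black v) β
      (cunif s.k s.ε s.δ (s.black u) (X u)) (cunif s.k s.ε s.δ (s.black v) (X v)) := rfl

theorem QuadSystem.diagParam_eq (s : QuadSystem m) (α : Fin m → ℂ) (i j : Fin m) :
    s.diagParam α i j = dpar (s.alt i) (s.alt j) (α i) (α j) := by
  by_cases hi : i ∈ s.S <;> by_cases hj : j ∈ s.S <;>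
    simp [QuadSystem.diagParam, QuadSystem.alt, dpar, hi, hj]

/-- The Lagrangian on the pair of vertices `u, v`. -/
def QuadSystem.val (s : QuadSystem m) (𝔏 : Lagrangians m) (u v : Lattice m) (Y Z β : ℂ) : ℂ :=
  match s.black u, s.black v with
  | true, true => 𝔏.Lam u v Y Z β
  | false, false => 𝔏.LamBar u v Y Z β
  | true, false => 𝔏.L u v Y Z β
  | false, true => 𝔏.L v u Z Y β

/-- One formula for the eight types of squares: two edges minus the diagonal, with a sign depending
on the directions alone. -/
theorem QuadSystem.twoForm_eq (s : QuadSystem m) (𝔏 : Lagrangians m) (X : Lattice m → ℂ)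
    (α : Fin m → ℂ) (n : Lattice m) (i j : Fin m) :
    s.twoForm 𝔏 X α n i j = s.val 𝔏 n (step n i) (X n) (X (step n i)) (α i)
      - s.val 𝔏 n (step n j) (X n) (X (step n j)) (α j)
      - sgd (s.alt i) (s.alt j) * s.val 𝔏 (step n i) (step n j) (X (step n i)) (X (step n j))
        (s.diagParam α i j) := by
  have hi := s.black_step n i
  have hj := s.black_step n j
  rw [s.diagParam_eq]
  simp only [QuadSystem.twoForm, QuadSystem.val, hi, hj]
  rw [← QuadSystem.alt, ← QuadSystem.alt]
  cases s.black n <;> cases s.alt i <;> cases s.alt j <;> simp [sgd, dpar]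

theorem QuadSystem.twoForm_swap (s : QuadSystem m) {𝔏 : Lagrangians m} {X₀ : Lattice m → ℂ}
    {α₀ : Fin m → ℂ} {A : Set (Square m)} (h : s.IsLagrangian 𝔏 X₀ α₀ A) (X : Lattice m → ℂ)
    (α : Fin m → ℂ) (n : Lattice m) (i j : Fin m) :
    s.twoForm 𝔏 X α n j i = -s.twoForm 𝔏 X α n i j := by
  obtain ⟨h1, h2, h3, h4, -⟩ := h
  have e1 := h1 (step n j) (step n i) (X (step n j)) (X (step n i)) (α j - α i)
  have e2 := h2 (step n j) (step n i) (X (step n j)) (X (step n i)) (α j - α i)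
  have e3 := h3 (step n i) (step n j) (X (step n i)) (X (step n j)) (α i - α j)
  have e4 := h4 (step n i) (step n j) (X (step n i)) (X (step n j)) (α i - α j)
  rw [neg_sub] at e3 e4
  simp only [QuadSystem.twoForm]
  cases s.black n <;> cases decide (i ∈ s.S) <;> cases decide (j ∈ s.S) <;>
    simp only [e1, e2, e3, e4] <;> ring

theorem QuadSystem.carries_of_potential (s : QuadSystem m) {𝔏 : Lagrangians m}
    {X : Lattice m → ℂ} {u v : Lattice m} {β : ℂ} {P Q R : ℂ × ℂ × ℂ → ℂ}
    (h : Potential s.k s.ε s.δ (s.black u) (s.black v)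
      (fun z => s.val 𝔏 u v z.1 z.2.1 z.2.2) P Q R (X u, X v, β)) : s.Carries 𝔏 X u v β := by
  have key {cu cv : Bool} {F : ℂ → ℂ → ℂ → ℂ} {P Q R : ℂ × ℂ × ℂ → ℂ} {Y Z : ℂ}
      (h : Potential s.k s.ε s.δ cu cv (fun z => F z.1 z.2.1 z.2.2) P Q R (Y, Z, β)) :
      IsPotential F (fun X Y β w => leg s.k s.ε s.δ cu cv β X Y w)
        (fun X Y β w => leg s.k s.ε s.δ cv cu β Y X w)
        (fun X Y β => pairH s.k s.ε s.δ cu cv β (cunif s.k s.ε s.δ cu X) (cunif s.k s.ε s.δ cv Y))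
        Y Z β := by
    filter_upwards [h.1.2.2.2, h.2] with z hz hz'
    exact ⟨P z, Q z, R z, hz, hz'⟩
  unfold QuadSystem.Carries
  unfold QuadSystem.val at h
  split <;> rename_i hu hv <;> simp only [hu, hv] at h
  · exact key h
  · exact key h
  · exact key h
  · exact key h.swap

theorem QuadSystem.regularVertex_eq (s : QuadSystem m) (X : Lattice m → ℂ) (n : Lattice m) :
    s.RegularVertex X n ↔ deriv (cunif s.k s.ε s.δ (s.black n)) (X n) ≠ 0 := Iff.rfl

/-! ## Flips change the action by the sum over the cube -/

theorem QuadSystem.action_add (s : QuadSystem m) (𝔏 : Lagrangians m) (X : Lattice m → ℂ)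
    (α : Fin m → ℂ) (A B : QuadSurface m) :
    s.action 𝔏 X α (A + B) = s.action 𝔏 X α A + s.action 𝔏 X α B :=
  Finsupp.sum_add_index' (by simp) (by intro a b c; push_cast; ring)

theorem QuadSystem.action_sub (s : QuadSystem m) (𝔏 : Lagrangians m) (X : Lattice m → ℂ)
    (α : Fin m → ℂ) (A B : QuadSurface m) :
    s.action 𝔏 X α (A - B) = s.action 𝔏 X α A - s.action 𝔏 X α B :=
  Finsupp.sum_sub_index (by intro a b c; push_cast; ring)

theorem QuadSystem.action_single (s : QuadSystem m) (𝔏 : Lagrangians m) (X : Lattice m → ℂ)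
    (α : Fin m → ℂ) (q : Square m) :
    s.action 𝔏 X α (Finsupp.single q 1) = s.twoForm 𝔏 X α q.n q.i q.j := by
  simp [QuadSystem.action, Finsupp.sum_single_index]

/-- The action is additive and its value on the boundary of the cube is the closure sum. The
antisymmetry of the two-form matches the order `(l, i)` there with the order `(i, l)` of the stored
squares. -/
theorem QuadSystem.action_flip (s : QuadSystem m) {𝔏 : Lagrangians m} {X₀ : Lattice m → ℂ}
    {α₀ : Fin m → ℂ} {A : Set (Square m)} (h : s.IsLagrangian 𝔏 X₀ α₀ A) {X : Lattice m → ℂ}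
    {α : Fin m → ℂ} {C : Cube m} (h0 : s.flipSum 𝔏 X α C = 0) {Sg Sg' : QuadSurface m}
    (hf : IsFlip C Sg Sg') : s.action 𝔏 X α Sg' = s.action 𝔏 X α Sg := by
  have hb : s.action 𝔏 X α C.boundary = 0 := by
    rw [← h0, Cube.boundary, QuadSystem.flipSum, s.twoForm_swap h X α (step C.n C.j) C.i C.l,
      s.twoForm_swap h X α C.n C.i C.l]
    simp only [s.action_add, s.action_sub, s.action_single]
    ring
  rcases hf with rfl | rfl
  · rw [s.action_add, hb, add_zero]
  · rw [s.action_sub, hb, sub_zero]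

/-! ## Edges and diagonals -/

/-- The edges of `ℤ^m`, and the diagonals from `n + e_i` to `n + e_j`, `i < j`. -/
inductive Link (m : ℕ)
  | edge (n : Lattice m) (i : Fin m)
  | diag (q : Square m)

namespace Link

/-- The first end. -/
def src : Link m → Lattice m
  | edge n _ => n
  | diag q => step q.n q.i

/-- The second end. -/
def tgt : Link m → Lattice m
  | edge n i => step n i
  | diag q => step q.n q.j

/-- The parameter of a link. -/
def par (s : QuadSystem m) (α : Fin m → ℂ) : Link m → ℂ
  | edge _ i => α i
  | diag q => s.diagParam α q.i q.j

/-- Both ends. -/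
def ends (ℓ : Link m) : Lattice m × Lattice m := (ℓ.src, ℓ.tgt)

theorem sum_step (n : Lattice m) (i : Fin m) : ∑ x, step n i x = ∑ x, n x + 1 := by
  simp [step, Finset.sum_add_distrib]

theorem diag_sub {q : Square m} (x : Fin m) : step q.n q.j x - step q.n q.i x =
    (if x = q.j then 1 else 0) - if x = q.i then 1 else 0 := by
  simp [step, Pi.single_apply]

/-- The coordinate sum grows by one along an edge and is constant along a diagonal; the coordinate
differences of a diagonal reveal its two directions. -/
theorem ends_injective : Function.Injective (ends (m := m)) := by
  rintro (⟨n, i⟩ | q) (⟨n', i'⟩ | q') h <;> simp only [ends, src, tgt, Prod.mk.injEq] at h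
  · obtain ⟨rfl, h⟩ := h
    have := congrFun h i
    by_cases e : i = i'
    · rw [e]
    · simp [step, Pi.single_apply, e] at this
  · have h1 := congrArg (fun u => ∑ x, u x) h.1
    have h2 := congrArg (fun u => ∑ x, u x) h.2
    simp only [sum_step] at h1 h2
    omega
  · have h1 := congrArg (fun u => ∑ x, u x) h.1
    have h2 := congrArg (fun u => ∑ x, u x) h.2
    simp only [sum_step] at h1 h2
    omega
  · have key x := diag_sub (q := q) x
    simp only [h.1, h.2, diag_sub] at key
    have hq := q.lt.ne
    have hq' := q'.lt.ne
    have e1 : q.j = q'.j := by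
      have := key q.j
      by_contra e
      simp only [if_true, if_neg e, if_neg hq.symm] at this
      split_ifs at this <;> omega
    have e2 : q.i = q'.i := by
      have := key q.i
      by_contra e
      simp only [if_true, if_neg e, if_neg hq] at this
      split_ifs at this <;> omega
    obtain ⟨n, i, j, hlt⟩ := q
    obtain ⟨n', i', j', hlt'⟩ := q'
    simp only at e1 e2
    subst e1 e2
    simp only [step, add_left_inj] at h
    obtain ⟨rfl, -⟩ := h
    rfl

/-- For diagonals the order `i < j` excludes the reversed pair, for edges the coordinate sum does.
-/
theorem ends_ne_swap (ℓ ℓ' : Link m) : ℓ'.ends ≠ (ℓ.tgt, ℓ.src) := by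
  intro h
  rcases ℓ with ⟨n, i⟩ | q <;> rcases ℓ' with ⟨n', i'⟩ | q' <;>
    simp only [ends, src, tgt, Prod.mk.injEq] at h
  · have h1 := congrArg (fun u => ∑ x, u x) h.1
    have h2 := congrArg (fun u => ∑ x, u x) h.2
    simp only [sum_step] at h1 h2
    omega
  · have h1 := congrArg (fun u => ∑ x, u x) h.1
    have h2 := congrArg (fun u => ∑ x, u x) h.2
    simp only [sum_step] at h1 h2
    omega
  · have h1 := congrArg (fun u => ∑ x, u x) h.1
    have h2 := congrArg (fun u => ∑ x, u x) h.2
    simp only [sum_step] at h1 h2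
    omega
  · have key x := diag_sub (q := q') x
    simp only [h.1, h.2, ← neg_sub (step q.n q.j _), diag_sub] at key
    have hq := q.lt
    have hq' := q'.lt
    have e1 : q'.j = q.i := by
      have := key q'.j
      by_contra e
      simp only [if_true, if_neg e, if_neg hq'.ne.symm] at this
      split_ifs at this <;> omega
    have e2 : q'.i = q.j := by
      have := key q'.i
      by_contra e
      simp only [if_true, if_neg e, if_neg hq'.ne] at this
      split_ifs at this <;> omega
    rw [e1, e2] at hq'
    exact absurd hq (not_lt.2 hq'.le)

end Link

/-- The function on pairs of vertices given by `F` on the links and their reversals. -/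
def onPairs (F : Link m → ℂ → ℂ → ℂ → ℂ) (u v : Lattice m) (Y Z β : ℂ) : ℂ :=
  Function.extend Link.ends F 0 (u, v) Y Z β + Function.extend Link.ends F 0 (v, u) Z Y β

theorem onPairs_symm (F : Link m → ℂ → ℂ → ℂ → ℂ) (u v : Lattice m) (Y Z β : ℂ) :
    onPairs F u v Y Z β = onPairs F v u Z Y β := add_comm _ _

theorem onPairs_link (F : Link m → ℂ → ℂ → ℂ → ℂ) (ℓ : Link m) (Y Z β : ℂ) :
    onPairs F ℓ.src ℓ.tgt Y Z β = F ℓ Y Z β := by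
  rw [onPairs, show (ℓ.src, ℓ.tgt) = ℓ.ends from rfl, Link.ends_injective.extend_apply,
    Function.extend_apply' _ _ _ (fun ⟨ℓ', h⟩ => Link.ends_ne_swap ℓ ℓ' h)]
  simp

theorem onPairs_neg {F : Link m → ℂ → ℂ → ℂ → ℂ} (hF : ∀ ℓ Y Z β, F ℓ Y Z (-β) = -F ℓ Y Z β)
    (u v : Lattice m) (Y Z β : ℂ) : onPairs F u v Y Z (-β) = -onPairs F u v Y Z β := by
  have key (p : Lattice m × Lattice m) (Y Z : ℂ) : Function.extend Link.ends F 0 p Y Z (-β) =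
      -Function.extend Link.ends F 0 p Y Z β := by
    by_cases h : ∃ ℓ : Link m, ℓ.ends = p
    · obtain ⟨ℓ, rfl⟩ := h
      simp only [Link.ends_injective.extend_apply, hF]
    · simp [Function.extend_apply' _ _ _ h]
  rw [onPairs, onPairs, key, key]
  ring

/-- A function odd in `β` which agrees with `F` for `β` near `b ≠ 0`. -/
def oddify (b : ℂ) (F : ℂ → ℂ → ℂ → ℂ) (Y Z β : ℂ) : ℂ :=
  if 0 < (β / b).re then F Y Z β else if (β / b).re < 0 then -F Y Z (-β) else 0

theorem oddify_neg (b : ℂ) (F : ℂ → ℂ → ℂ → ℂ) (Y Z β : ℂ) :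
    oddify b F Y Z (-β) = -oddify b F Y Z β := by
  simp only [oddify, neg_div, neg_re, neg_neg]
  rcases lt_trichotomy (β / b).re 0 with h | h | h
  · rw [if_pos (by linarith), if_neg (by linarith), if_pos h, neg_neg]
  · simp [h]
  · rw [if_neg (by linarith), if_pos (by linarith), if_pos h]

theorem oddify_eventuallyEq {b : ℂ} (hb : b ≠ 0) (F : ℂ → ℂ → ℂ → ℂ) (Y Z : ℂ) :
    (fun z : ℂ × ℂ × ℂ => oddify b F z.1 z.2.1 z.2.2) =ᶠ[𝓝 (Y, Z, b)]
      fun z => F z.1 z.2.1 z.2.2 := by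
  -- At `β = b` the quotient is `1`, so nearby parameters lie in the half-plane on which `oddify` is
  -- `F`.
  have hc : Continuous fun z : ℂ × ℂ × ℂ => (z.2.2 / b).re := by fun_prop
  have : ∀ᶠ z : ℂ × ℂ × ℂ in 𝓝 (Y, Z, b), 0 < (z.2.2 / b).re :=
    (hc.tendsto (Y, Z, b)).eventually_const_lt (by simp [hb])
  filter_upwards [this] with z hz
  simp only [oddify, if_pos hz]

end

section

variable {m : ℕ}

/-! ## Construction of the Lagrangians -/

/-- The edges of a square and its diagonal from `n + e_i` to `n + e_j`. -/
def Square.links (q : Square m) : Set (Link m) :=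
  {.edge q.n q.i, .edge (step q.n q.j) q.i, .edge q.n q.j, .edge (step q.n q.i) q.j, .diag q}

namespace Link

/-- The arguments of the Lagrangian of a link. -/
def pt (s : QuadSystem m) (X : Lattice m → ℂ) (α : Fin m → ℂ) (ℓ : Link m) : ℂ × ℂ × ℂ :=
  (X ℓ.src, X ℓ.tgt, ℓ.par s α)

/-- The biquadratic of a link. -/
def biquad (s : QuadSystem m) (X : Lattice m → ℂ) (α : Fin m → ℂ) (ℓ : Link m) : ℂ :=
  s.biquad X ℓ.src ℓ.tgt (ℓ.par s α)

/-- `w` is a value of the leg function centred at the first end of a link. -/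
def SrcLeg (s : QuadSystem m) (X : Lattice m → ℂ) (α : Fin m → ℂ) (ℓ : Link m) (w : ℂ) : Prop :=
  leg s.k s.ε s.δ (s.black ℓ.src) (s.black ℓ.tgt) (ℓ.par s α) (X ℓ.src) (X ℓ.tgt) w

/-- `w` is a value of the leg function centred at the second end of a link. -/
def TgtLeg (s : QuadSystem m) (X : Lattice m → ℂ) (α : Fin m → ℂ) (ℓ : Link m) (w : ℂ) : Prop :=
  leg s.k s.ε s.δ (s.black ℓ.tgt) (s.black ℓ.src) (ℓ.par s α) (X ℓ.tgt) (X ℓ.src) w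

/-- `F` is a potential of the leg functions and of the logarithm of the biquadratic of a link. -/
def Pot (s : QuadSystem m) (X : Lattice m → ℂ) (α : Fin m → ℂ) (ℓ : Link m)
    (F P Q R : ℂ × ℂ × ℂ → ℂ) : Prop :=
  Potential s.k s.ε s.δ (s.black ℓ.src) (s.black ℓ.tgt) F P Q R (ℓ.pt s X α)

theorem exists_pot {s : QuadSystem m} {X : Lattice m → ℂ} {α : Fin m → ℂ} {ℓ : Link m}
    {p q r : ℂ} (hp : ℓ.SrcLeg s X α p) (hq : ℓ.TgtLeg s X α q) (hr : exp r = ℓ.biquad s X α) :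
    ∃ F P Q R, ℓ.Pot s X α F P Q R ∧ F (ℓ.pt s X α) = 0 ∧ P (ℓ.pt s X α) = p ∧
      Q (ℓ.pt s X α) = q ∧ R (ℓ.pt s X α) = r :=
  exists_potential_of_jet (z₀ := ℓ.pt s X α) (by
    have : ℓ.biquad s X α ≠ 0 := hr ▸ exp_ne_zero r
    exact this) hp hq hr

theorem exists_legs {s : QuadSystem m} {X : Lattice m → ℂ} {α : Fin m → ℂ} {ℓ : Link m}
    (h : ℓ.biquad s X α ≠ 0) : ∃ p q, ℓ.SrcLeg s X α p ∧ ℓ.TgtLeg s X α q := by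
  obtain ⟨F, P, Q, R, -, hF⟩ := exists_potential (z₀ := ℓ.pt s X α) h
  exact ⟨_, _, hF.self_of_nhds.1, hF.self_of_nhds.2.1⟩

end Link

section square

variable {s : QuadSystem m} {X : Lattice m → ℂ} {α : Fin m → ℂ} {q : Square m} {w₁ w₂ : ℂ}

theorem Square.srcLeg_diag (hq : s.face X α q.n q.i q.j = 0)
    (hr : ∀ ℓ ∈ q.links, ℓ.biquad s X α ≠ 0)
    (h₁ : (Link.edge q.n q.i).TgtLeg s X α w₁)
    (h₂ : (Link.edge (step q.n q.i) q.j).SrcLeg s X α w₂) :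
    (Link.diag q).SrcLeg s X α (sgd (s.alt q.i) (s.alt q.j) * (w₁ - w₂)) := by
  rw [s.face_eq] at hq
  have r1 := hr (.edge q.n q.i) (by simp [Square.links])
  have r2 := hr (.edge (step q.n q.i) q.j) (by simp [Square.links])
  have r3 := hr (.diag q) (by simp [Square.links])
  simp only [Link.biquad, QuadSystem.biquad_eq, Link.TgtLeg, Link.SrcLeg, Link.src, Link.tgt,
    Link.par, s.black_step, s.diagParam_eq] at r1 r2 r3 h₁ h₂ ⊢
  rw [← pairH_symm] at r1
  exact three_leg hq r1 r2 r3 h₁ h₂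

theorem Square.tgtLeg_diag (hq : s.face X α q.n q.i q.j = 0)
    (hr : ∀ ℓ ∈ q.links, ℓ.biquad s X α ≠ 0)
    (h₁ : (Link.edge q.n q.j).TgtLeg s X α w₁)
    (h₂ : (Link.edge (step q.n q.j) q.i).SrcLeg s X α w₂) :
    (Link.diag q).TgtLeg s X α (-(sgd (s.alt q.i) (s.alt q.j) * (w₁ - w₂))) := by
  rw [s.face_eq] at hq
  have r1 := hr (.edge q.n q.j) (by simp [Square.links])
  have r2 := hr (.edge (step q.n q.j) q.i) (by simp [Square.links])
  have r3 := hr (.diag q) (by simp [Square.links])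
  simp only [Link.biquad, QuadSystem.biquad_eq, Link.TgtLeg, Link.SrcLeg, Link.src, Link.tgt,
    Link.par, s.black_step, s.diagParam_eq, step_comm q.n q.j q.i] at r1 r2 r3 h₁ h₂ ⊢
  rw [← pairH_symm] at r1
  exact three_leg' hq r1 r2 r3 h₁ h₂

theorem Square.biquad_ne_zero {A : Set (Square m)} (hA : s.Regular X α A) (hq : q ∈ A) :
    ∀ ℓ ∈ q.links, ℓ.biquad s X α ≠ 0 := by
  obtain ⟨-, ⟨h1, h2, h3, h4⟩, -, h5⟩ := hA q hq
  rintro ℓ (rfl | rfl | rfl | rfl | rfl)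
  · exact h1.2
  · simp only [Link.biquad, Link.src, Link.tgt, step_comm q.n q.j q.i]
    exact h2.2
  · exact h3.2
  · exact h4.2
  · exact h5.2

end square

/-- The Lagrangians `𝔏` have the derivatives `P, Q, R` on the links of the squares of `A`, and
the three-leg relations hold for them at `(X, α)`. -/
structure Adapted (s : QuadSystem m) (𝔏 : Lagrangians m) (P Q R : Link m → ℂ × ℂ × ℂ → ℂ)
    (X : Lattice m → ℂ) (α : Fin m → ℂ) (A : Set (Square m)) : Prop where
  pot : ∀ q ∈ A, ∀ ℓ ∈ q.links,
    ℓ.Pot s X α (fun z => s.val 𝔏 ℓ.src ℓ.tgt z.1 z.2.1 z.2.2) (P ℓ) (Q ℓ) (R ℓ)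
  src : ∀ q ∈ A, P (.diag q) ((Link.diag q).pt s X α) = sgd (s.alt q.i) (s.alt q.j) *
    (Q (.edge q.n q.i) ((Link.edge q.n q.i).pt s X α)
      - P (.edge (step q.n q.i) q.j) ((Link.edge (step q.n q.i) q.j).pt s X α))
  tgt : ∀ q ∈ A, Q (.diag q) ((Link.diag q).pt s X α) = -(sgd (s.alt q.i) (s.alt q.j) *
    (Q (.edge q.n q.j) ((Link.edge q.n q.j).pt s X α)
      - P (.edge (step q.n q.j) q.i) ((Link.edge (step q.n q.j) q.i).pt s X α)))

theorem Adapted.carries {s : QuadSystem m} {𝔏 : Lagrangians m}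
    {P Q R : Link m → ℂ × ℂ × ℂ → ℂ} {X : Lattice m → ℂ} {α : Fin m → ℂ} {A : Set (Square m)}
    (h : Adapted s 𝔏 P Q R X α A) {q : Square m} (hq : q ∈ A) :
    s.Carries 𝔏 X q.n (step q.n q.i) (α q.i) ∧
    s.Carries 𝔏 X (step q.n q.j) (step (step q.n q.i) q.j) (α q.i) ∧
    s.Carries 𝔏 X q.n (step q.n q.j) (α q.j) ∧
    s.Carries 𝔏 X (step q.n q.i) (step (step q.n q.i) q.j) (α q.j) ∧
    s.Carries 𝔏 X (step q.n q.i) (step q.n q.j) (s.diagParam α q.i q.j) := by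
  have key (ℓ) (hℓ : ℓ ∈ q.links) : s.Carries 𝔏 X ℓ.src ℓ.tgt (ℓ.par s α) :=
    s.carries_of_potential (h.pot q hq ℓ hℓ)
  refine ⟨key (.edge q.n q.i) (by simp [Square.links]), ?_,
    key (.edge q.n q.j) (by simp [Square.links]),
    key (.edge (step q.n q.i) q.j) (by simp [Square.links]),
    key (.diag q) (by simp [Square.links])⟩
  rw [step_comm]
  exact key (.edge (step q.n q.j) q.i) (by simp [Square.links])

/-- The Lagrangians given by the functions `F` on the links. -/
def lagrangiansOf (s : QuadSystem m) (α : Fin m → ℂ) (F : Link m → ℂ → ℂ → ℂ → ℂ) :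
    Lagrangians m where
  L := onPairs F
  Lam := onPairs fun ℓ => oddify (ℓ.par s α) (F ℓ)
  LamBar := onPairs fun ℓ => oddify (ℓ.par s α) (F ℓ)

theorem par_ne_zero {s : QuadSystem m} {X : Lattice m → ℂ} {α : Fin m → ℂ} {ℓ : Link m}
    (h : ℓ.biquad s X α ≠ 0) (hc : s.black ℓ.src = s.black ℓ.tgt) : ℓ.par s α ≠ 0 := by
  intro h0
  have := weight_ne_zero_of_pairH h
  rw [hc, h0, Bool.xor_self] at this
  cases hk : s.k <;> simp [weight, hk] at this

theorem val_lagrangiansOf {s : QuadSystem m} {X : Lattice m → ℂ} {α : Fin m → ℂ}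
    (F : Link m → ℂ → ℂ → ℂ → ℂ) {ℓ : Link m} (h : ℓ.biquad s X α ≠ 0) :
    (fun z : ℂ × ℂ × ℂ => s.val (lagrangiansOf s α F) ℓ.src ℓ.tgt z.1 z.2.1 z.2.2)
      =ᶠ[𝓝 (ℓ.pt s X α)] fun z => F ℓ z.1 z.2.1 z.2.2 := by
  simp only [QuadSystem.val, lagrangiansOf]
  split <;> rename_i hu hv
  · simp only [onPairs_link]
    exact oddify_eventuallyEq (par_ne_zero h (hu.trans hv.symm)) _ _ _
  · simp only [onPairs_link]
    exact oddify_eventuallyEq (par_ne_zero h (hu.trans hv.symm)) _ _ _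
  · simp only [onPairs_link]
    rfl
  · simp only [onPairs_symm F ℓ.tgt, onPairs_link]
    rfl

/-- The logarithms `r` of the biquadratics are prescribed, the legs on edges are arbitrary, and the
legs on each diagonal are then dictated by the three-leg relations. Distinct squares have distinct
diagonals, so these choices never conflict and all squares can be treated at once. -/
theorem exists_lagrangians {s : QuadSystem m} {X : Lattice m → ℂ} {α : Fin m → ℂ}
    {A : Set (Square m)} (hA : s.Regular X α A) (hs : s.Solves X α A) (r : Link m → ℂ)
    (hr : ∀ q ∈ A, ∀ ℓ ∈ q.links, exp (r ℓ) = ℓ.biquad s X α) :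
    ∃ 𝔏 P Q R, s.IsLagrangian 𝔏 X α A ∧ Adapted s 𝔏 P Q R X α A ∧
      ∀ q ∈ A, ∀ ℓ ∈ q.links, s.val 𝔏 ℓ.src ℓ.tgt (X ℓ.src) (X ℓ.tgt) (ℓ.par s α) = 0 ∧
        R ℓ (ℓ.pt s X α) = r ℓ := by
  have hE (ℓ : Link m) : ∃ F P Q R, exp (r ℓ) = ℓ.biquad s X α →
      ℓ.Pot s X α F P Q R ∧ F (ℓ.pt s X α) = 0 ∧ R (ℓ.pt s X α) = r ℓ := by
    by_cases h : exp (r ℓ) = ℓ.biquad s X α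
    · obtain ⟨p, q, hp, hq⟩ := Link.exists_legs (h ▸ exp_ne_zero (r ℓ))
      obtain ⟨F, P, Q, R, h1, h2, -, -, h3⟩ := Link.exists_pot hp hq h
      exact ⟨F, P, Q, R, fun _ => ⟨h1, h2, h3⟩⟩
    · exact ⟨0, 0, 0, 0, fun h' => absurd h' h⟩
  choose F P Q R hF using hE
  -- The prescribed derivatives are admissible because the quad-equation holds: by its three-leg
  -- forms they are values of the legs of the diagonal.
  have hD (q : Square m) : ∃ F' P' Q' R', q ∈ A → (Link.diag q).Pot s X α F' P' Q' R' ∧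
      F' ((Link.diag q).pt s X α) = 0 ∧
      P' ((Link.diag q).pt s X α) = sgd (s.alt q.i) (s.alt q.j) *
        (Q (.edge q.n q.i) ((Link.edge q.n q.i).pt s X α)
        - P (.edge (step q.n q.i) q.j) ((Link.edge (step q.n q.i) q.j).pt s X α)) ∧
      Q' ((Link.diag q).pt s X α) = -(sgd (s.alt q.i) (s.alt q.j) *
        (Q (.edge q.n q.j) ((Link.edge q.n q.j).pt s X α)
        - P (.edge (step q.n q.j) q.i) ((Link.edge (step q.n q.j) q.i).pt s X α))) ∧
      R' ((Link.diag q).pt s X α) = r (.diag q) := by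
    by_cases hq : q ∈ A
    · have hp (ℓ) (hℓ : ℓ ∈ q.links) := (hF ℓ (hr q hq ℓ hℓ)).1.2.self_of_nhds
      obtain ⟨F', P', Q', R', h⟩ := Link.exists_pot
        (Square.srcLeg_diag (hs q hq) (Square.biquad_ne_zero hA hq)
          (hp (.edge q.n q.i) (by simp [Square.links])).2.1
          (hp (.edge (step q.n q.i) q.j) (by simp [Square.links])).1)
        (Square.tgtLeg_diag (hs q hq) (Square.biquad_ne_zero hA hq)
          (hp (.edge q.n q.j) (by simp [Square.links])).2.1
          (hp (.edge (step q.n q.j) q.i) (by simp [Square.links])).1)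
        (hr q hq (.diag q) (by simp [Square.links]))
      exact ⟨F', P', Q', R', fun _ => h⟩
    · exact ⟨0, 0, 0, 0, fun h' => absurd h' hq⟩
  choose F' P' Q' R' hD using hD
  let glue (f : Link m → ℂ × ℂ × ℂ → ℂ) (g : Square m → ℂ × ℂ × ℂ → ℂ) : Link m → ℂ × ℂ × ℂ → ℂ
    | .edge n i => f (.edge n i)
    | .diag q => g q
  have hG : ∀ q ∈ A, ∀ ℓ ∈ q.links, ℓ.Pot s X α (glue F F' ℓ) (glue P P' ℓ) (glue Q Q' ℓ)
      (glue R R' ℓ) ∧ glue F F' ℓ (ℓ.pt s X α) = 0 ∧ glue R R' ℓ (ℓ.pt s X α) = r ℓ := by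
    rintro q hq ℓ hℓ
    have h := hF ℓ (hr q hq ℓ hℓ)
    rcases hℓ with rfl | rfl | rfl | rfl | rfl
    any_goals exact h
    exact ⟨(hD q hq).1, (hD q hq).2.1, (hD q hq).2.2.2.2⟩
  have hv : ∀ q ∈ A, ∀ ℓ ∈ q.links, _ := fun q hq ℓ hℓ =>
    val_lagrangiansOf (fun ℓ X Y β => glue F F' ℓ (X, Y, β))
      (Square.biquad_ne_zero hA hq ℓ hℓ)
  have had : Adapted s (lagrangiansOf s α fun ℓ X Y β => glue F F' ℓ (X, Y, β)) (glue P P')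
      (glue Q Q') (glue R R') X α A :=
    ⟨fun q hq ℓ hℓ => (hG q hq ℓ hℓ).1.congr (hv q hq ℓ hℓ), fun q hq => (hD q hq).2.2.1,
      fun q hq => (hD q hq).2.2.2.1⟩
  refine ⟨_, _, _, _, ⟨onPairs_symm _, onPairs_symm _, onPairs_neg fun ℓ => oddify_neg _ _,
    onPairs_neg fun ℓ => oddify_neg _ _, fun q hq => had.carries hq⟩, had, fun q hq ℓ hℓ => ?_⟩
  exact ⟨(hv q hq ℓ hℓ).self_of_nhds.trans (hG q hq ℓ hℓ).2.1, (hG q hq ℓ hℓ).2.2⟩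

end

section

variable {m : ℕ}

/-! ## The differential of the two-form on solutions -/

theorem Link.continuous_par (s : QuadSystem m) (ℓ : Link m) :
    Continuous fun α : Fin m → ℂ => ℓ.par s α := by
  rcases ℓ with ⟨n, i⟩ | q
  · exact continuous_apply i
  · simp only [Link.par, QuadSystem.diagParam]
    split_ifs <;> fun_prop

theorem Link.continuous_pt (s : QuadSystem m) (ℓ : Link m) :
    Continuous fun p : (Lattice m → ℂ) × (Fin m → ℂ) => ℓ.pt s p.1 p.2 := by
  have := (ℓ.continuous_par s).comp
    (continuous_snd : Continuous (Prod.snd : (Lattice m → ℂ) × (Fin m → ℂ) → _))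
  unfold Link.pt
  exact (by fun_prop : Continuous fun p : (Lattice m → ℂ) × (Fin m → ℂ) => p.1 ℓ.src).prodMk
    ((by fun_prop : Continuous fun p : (Lattice m → ℂ) × (Fin m → ℂ) => p.1 ℓ.tgt).prodMk this)

/-- At `(X, α)` the functions `P, Q, R` are the derivatives of the Lagrangians on the links of
the square `q`, and the three-leg relations hold. -/
structure SquareData (s : QuadSystem m) (𝔏 : Lagrangians m) (P Q R : Link m → ℂ × ℂ × ℂ → ℂ)
    (q : Square m) (X : Lattice m → ℂ) (α : Fin m → ℂ) : Prop where
  deriv : ∀ ℓ ∈ q.links, HasFDerivAt (fun z : ℂ × ℂ × ℂ => s.val 𝔏 ℓ.src ℓ.tgt z.1 z.2.1 z.2.2)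
    (form₃ (P ℓ (ℓ.pt s X α)) (Q ℓ (ℓ.pt s X α)) (R ℓ (ℓ.pt s X α))) (ℓ.pt s X α)
  exp_eq : ∀ ℓ ∈ q.links, exp (R ℓ (ℓ.pt s X α)) = ℓ.biquad s X α
  src : P (.diag q) ((Link.diag q).pt s X α) = sgd (s.alt q.i) (s.alt q.j) *
    (Q (.edge q.n q.i) ((Link.edge q.n q.i).pt s X α)
      - P (.edge (step q.n q.i) q.j) ((Link.edge (step q.n q.i) q.j).pt s X α))
  tgt : Q (.diag q) ((Link.diag q).pt s X α) = -(sgd (s.alt q.i) (s.alt q.j) *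
    (Q (.edge q.n q.j) ((Link.edge q.n q.j).pt s X α)
      - P (.edge (step q.n q.j) q.i) ((Link.edge (step q.n q.j) q.i).pt s X α)))

theorem eventually_eq_of_isPer {E : Type*} [TopologicalSpace E] {x₀ : E} {f g : E → ℂ}
    (hf : ContinuousAt f x₀) (hg : ContinuousAt g x₀) (h0 : f x₀ = g x₀) (k : Family) (ε : ℂ)
    (c : Bool) : ∀ᶠ x in 𝓝 x₀, IsPer k ε c (f x - g x) → f x = g x := by
  obtain ⟨r, hr, h⟩ := exists_isPer_eq_zero k ε c
  have hc : ContinuousAt (fun x => ‖f x - g x‖) x₀ := (hf.sub hg).norm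
  filter_upwards [hc.eventually_lt_const (show ‖f x₀ - g x₀‖ < r by simpa [h0] using hr)]
    with x hx hp
  exact sub_eq_zero.1 (h _ hp hx)

section

variable {s : QuadSystem m} {𝔏 : Lagrangians m} {P Q R : Link m → ℂ × ℂ × ℂ → ℂ}
  {X₀ : Lattice m → ℂ} {α₀ : Fin m → ℂ} {A : Set (Square m)} {q : Square m}

/-- At a nearby solution the three-leg relations hold up to a period. The defect is continuous and
zero at the centre, so the period is zero. -/
theorem Adapted.eventually_squareData (h : Adapted s 𝔏 P Q R X₀ α₀ A) (hq : q ∈ A) :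
    ∀ᶠ p : (Lattice m → ℂ) × (Fin m → ℂ) in 𝓝 (X₀, α₀), s.face p.1 p.2 q.n q.i q.j = 0 →
      SquareData s 𝔏 P Q R q p.1 p.2 := by
  have ht (ℓ : Link m) := (ℓ.continuous_pt s).tendsto (X₀, α₀)
  have ev (ℓ) (hℓ : ℓ ∈ q.links) := (ht ℓ).eventually
    ((h.pot q hq ℓ hℓ).1.2.2.2.and (h.pot q hq ℓ hℓ).2)
  have hcP (ℓ) (hℓ : ℓ ∈ q.links) : ContinuousAt
      (fun p : (Lattice m → ℂ) × (Fin m → ℂ) => P ℓ (ℓ.pt s p.1 p.2)) (X₀, α₀) :=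
    (h.pot q hq ℓ hℓ).1.1.tendsto.comp (ht ℓ)
  have hcQ (ℓ) (hℓ : ℓ ∈ q.links) : ContinuousAt
      (fun p : (Lattice m → ℂ) × (Fin m → ℂ) => Q ℓ (ℓ.pt s p.1 p.2)) (X₀, α₀) :=
    (h.pot q hq ℓ hℓ).1.2.1.tendsto.comp (ht ℓ)
  have m1 : Link.edge q.n q.i ∈ q.links := by simp [Square.links]
  have m2 : Link.edge (step q.n q.j) q.i ∈ q.links := by simp [Square.links]
  have m3 : Link.edge q.n q.j ∈ q.links := by simp [Square.links]
  have m4 : Link.edge (step q.n q.i) q.j ∈ q.links := by simp [Square.links]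
  have m5 : Link.diag q ∈ q.links := by simp [Square.links]
  have e1 := eventually_eq_of_isPer (hcP _ m5)
    (((hcQ _ m1).sub (hcP _ m4)).const_mul (sgd (s.alt q.i) (s.alt q.j)))
    (h.src q hq) s.k s.ε (s.black (Link.diag q).src)
  have e2 := eventually_eq_of_isPer (hcQ _ m5)
    (((hcQ _ m3).sub (hcP _ m2)).const_mul (sgd (s.alt q.i) (s.alt q.j))).neg
    (h.tgt q hq) s.k s.ε (s.black (Link.diag q).tgt)
  filter_upwards [(Filter.eventually_all_finite (by unfold Square.links; exact Set.toFinite _)).2 ev,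
    e1, e2] with p all e1 e2 hf
  have hr : ∀ ℓ ∈ q.links, ℓ.biquad s p.1 p.2 ≠ 0 := fun ℓ hℓ => by
    have : exp _ = ℓ.biquad s p.1 p.2 := (all ℓ hℓ).2.2.2
    rw [← this]
    exact exp_ne_zero _
  refine ⟨fun ℓ hℓ => (all ℓ hℓ).1, fun ℓ hℓ => (all ℓ hℓ).2.2.2, e1 ?_, e2 ?_⟩
  · exact (leg_iff_isPer (Square.srcLeg_diag hf hr (all _ m1).2.2.1 (all _ m4).2.1)).1 (all _ m5).2.1
  · exact (leg_iff_isPer (Square.tgtLeg_diag hf hr (all _ m3).2.2.1 (all _ m2).2.1)).1 (all _ m5).2.2.1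

/-- The derivative of the two-form along a curve. -/
theorem SquareData.hasDerivAt_twoForm {Xt : ℂ → Lattice m → ℂ} {αt : ℂ → Fin m → ℂ} {t : ℂ}
    {X' : Lattice m → ℂ} {α' : Fin m → ℂ} (h : SquareData s 𝔏 P Q R q (Xt t) (αt t))
    (h0 : HasDerivAt (fun τ => Xt τ q.n) (X' q.n) t)
    (hi : HasDerivAt (fun τ => Xt τ (step q.n q.i)) (X' (step q.n q.i)) t)
    (hj : HasDerivAt (fun τ => Xt τ (step q.n q.j)) (X' (step q.n q.j)) t)
    (ai : HasDerivAt (fun τ => αt τ q.i) (α' q.i) t)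
    (aj : HasDerivAt (fun τ => αt τ q.j) (α' q.j) t) :
    HasDerivAt (fun τ => s.twoForm 𝔏 (Xt τ) (αt τ) q.n q.i q.j)
      ((P (.edge q.n q.i) ((Link.edge q.n q.i).pt s (Xt t) (αt t))
          - P (.edge q.n q.j) ((Link.edge q.n q.j).pt s (Xt t) (αt t))) * X' q.n
        + P (.edge (step q.n q.i) q.j) ((Link.edge (step q.n q.i) q.j).pt s (Xt t) (αt t))
          * X' (step q.n q.i)
        - P (.edge (step q.n q.j) q.i) ((Link.edge (step q.n q.j) q.i).pt s (Xt t) (αt t))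
          * X' (step q.n q.j)
        + (R (.edge q.n q.i) ((Link.edge q.n q.i).pt s (Xt t) (αt t))
          - R (.diag q) ((Link.diag q).pt s (Xt t) (αt t))) * α' q.i
        - (R (.edge q.n q.j) ((Link.edge q.n q.j).pt s (Xt t) (αt t))
          - R (.diag q) ((Link.diag q).pt s (Xt t) (αt t))) * α' q.j) t := by
  have key (ℓ) (hℓ : ℓ ∈ q.links) {x' y' b' : ℂ} (hx : HasDerivAt (fun τ => Xt τ ℓ.src) x' t)
      (hy : HasDerivAt (fun τ => Xt τ ℓ.tgt) y' t)
      (hb : HasDerivAt (fun τ => ℓ.par s (αt τ)) b' t) :=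
    (h.deriv ℓ hℓ).comp_hasDerivAt t (hx.prodMk (hy.prodMk hb))
  have hd : HasDerivAt (fun τ => (Link.diag q).par s (αt τ))
      (dpar (s.alt q.i) (s.alt q.j) (α' q.i) (α' q.j)) t := by
    simp only [Link.par, s.diagParam_eq]
    cases s.alt q.i <;> cases s.alt q.j <;> simp only [dpar, Bool.not_true, Bool.not_false,
      Bool.and_true, Bool.and_false, cond_true, cond_false]
    · exact ai.sub aj
    · exact aj.sub ai
    · exact ai.sub aj
    · exact ai.sub aj
  have k1 := key (.edge q.n q.i) (by simp [Square.links]) h0 hi ai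
  have k2 := key (.edge q.n q.j) (by simp [Square.links]) h0 hj aj
  have k3 := key (.diag q) (by simp [Square.links]) hi hj hd
  have k := (k1.sub k2).sub (k3.const_mul (sgd (s.alt q.i) (s.alt q.j)))
  simp only [s.twoForm_eq]
  refine k.congr_deriv ?_
  -- The diagonal legs cancel the legs of the base edges at `X_i` and `X_j`, leaving the legs of the
  -- edges that lead from there to the fourth vertex.
  simp only [form₃_apply, h.src, h.tgt]
  cases s.alt q.i <;> cases s.alt q.j <;> simp only [dpar, sgd, Bool.not_true, Bool.not_false,
      Bool.and_true, Bool.and_false, cond_true, cond_false] <;> ring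

end

/-! ## The derivatives with respect to the parameters -/

end

section

/-! ## The equations on a cube -/

/-- The six equations on a cube, `x, xi, …, xijl` being the values at its vertices. -/
structure CubeEq (k : Family) (ε δ : ℂ) (c si sj sl : Bool)
    (a b d x xi xj xl xij xil xjl xijl : ℂ) : Prop where
  ij : vquad k ε δ c si sj a b x xi xij xj = 0
  il : vquad k ε δ c si sl a d x xi xil xl = 0
  jl : vquad k ε δ c sj sl b d x xj xjl xl = 0
  ij' : vquad k ε δ (xor c sl) si sj a b xl xil xijl xjl = 0
  il' : vquad k ε δ (xor c sj) si sl a d xj xij xijl xjl = 0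
  jl' : vquad k ε δ (xor c si) sj sl b d xi xij xijl xil = 0

/-- The biquadratics on the edges at the vertex `x` and on the diagonals joining their ends do not
vanish. -/
structure CubeReg (k : Family) (ε δ : ℂ) (c si sj sl : Bool) (a b d x xi xj xl : ℂ) : Prop where
  i : pairH k ε δ c (xor c si) a x xi ≠ 0
  j : pairH k ε δ c (xor c sj) b x xj ≠ 0
  l : pairH k ε δ c (xor c sl) d x xl ≠ 0
  ij : pairH k ε δ (xor c si) (xor c sj) (dpar si sj a b) xi xj ≠ 0
  il : pairH k ε δ (xor c si) (xor c sl) (dpar si sl a d) xi xl ≠ 0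
  jl : pairH k ε δ (xor c sj) (xor c sl) (dpar sj sl b d) xj xl ≠ 0

theorem pairH_dpar_swap (k : Family) (ε δ : ℂ) (si sj : Bool) (a b : ℂ) :
    ∃ e : ℂ, e ^ 2 = 1 ∧ ∀ c x y, pairH k ε δ (xor c sj) (xor c si) (dpar sj si b a) y x =
      e * pairH k ε δ (xor c si) (xor c sj) (dpar si sj a b) x y := by
  refine ⟨bif xor si sj then 1 else -1, by cases si <;> cases sj <;> simp, fun c x y => ?_⟩
  rw [← pairH_symm]
  cases si <;> cases sj <;> simp [dpar, ← pairH_neg]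

section cube

variable {k : Family} {ε δ : ℂ} {c si sj sl : Bool}
  {a b d x xi xj xl xij xil xjl xijl : ℂ}

theorem vquad_swap_iff : vquad k ε δ c sj si b a x xj xij xi = 0 ↔
    vquad k ε δ c si sj a b x xi xij xj = 0 := by
  rw [vquad_swap]
  cases si <;> cases sj <;> simp

theorem CubeEq.swap₁₂ (h : CubeEq k ε δ c si sj sl a b d x xi xj xl xij xil xjl xijl) :
    CubeEq k ε δ c sj si sl b a d x xj xi xl xij xjl xil xijl :=
  ⟨vquad_swap_iff.2 h.ij, h.jl, h.il, vquad_swap_iff.2 h.ij', h.jl', h.il'⟩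

theorem CubeEq.swap₂₃ (h : CubeEq k ε δ c si sj sl a b d x xi xj xl xij xil xjl xijl) :
    CubeEq k ε δ c si sl sj a d b x xi xl xj xil xij xjl xijl :=
  ⟨h.il, h.ij, vquad_swap_iff.2 h.jl, h.il', h.ij', vquad_swap_iff.2 h.jl'⟩

theorem pairH_dpar_swap_ne (h : pairH k ε δ (xor c si) (xor c sj) (dpar si sj a b) xi xj ≠ 0) :
    pairH k ε δ (xor c sj) (xor c si) (dpar sj si b a) xj xi ≠ 0 := by
  obtain ⟨e, he, hs⟩ := pairH_dpar_swap k ε δ si sj a b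
  rw [hs]
  exact mul_ne_zero (by rintro rfl; simp at he) h

theorem CubeReg.swap₁₂ (h : CubeReg k ε δ c si sj sl a b d x xi xj xl) :
    CubeReg k ε δ c sj si sl b a d x xj xi xl :=
  ⟨h.j, h.i, h.l, pairH_dpar_swap_ne h.ij, h.jl, h.il⟩

theorem CubeReg.swap₂₃ (h : CubeReg k ε δ c si sj sl a b d x xi xj xl) :
    CubeReg k ε δ c si sl sj a d b x xi xl xj :=
  ⟨h.i, h.l, h.j, h.il, h.ij, pairH_dpar_swap_ne h.jl⟩

theorem weight_edge (h : pairH k ε δ c (xor c si) a x xi ≠ 0) : weight k si a ≠ 0 := by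
  have := weight_ne_zero_of_pairH h
  cases c <;> simpa using this

theorem weight_diag (h : pairH k ε δ (xor c si) (xor c sj) (dpar si sj a b) xi xj ≠ 0) :
    weight k (xor si sj) (dpar si sj a b) ≠ 0 := by
  have := weight_ne_zero_of_pairH h
  cases c <;> simpa using this

theorem CubeReg.wi (h : CubeReg k ε δ c si sj sl a b d x xi xj xl) : weight k si a ≠ 0 :=
  weight_edge h.i

theorem CubeReg.wj (h : CubeReg k ε δ c si sj sl a b d x xi xj xl) : weight k sj b ≠ 0 :=
  weight_edge h.j

theorem CubeReg.wl (h : CubeReg k ε δ c si sj sl a b d x xi xj xl) : weight k sl d ≠ 0 :=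
  weight_edge h.l

theorem CubeReg.coef_ij (h : CubeReg k ε δ c si sj sl a b d x xi xj xl)
    (hq : vquad k ε δ c si sj a b x xi xij xj = 0) : coef₃ k ε δ c si sj a b x xi xj ≠ 0 :=
  (product_identities hq h.wi h.wj (weight_diag h.ij)).2.2 h.ij

theorem CubeReg.tetra_iff (h : CubeReg k ε δ c si sj sl a b d x xi xj xl)
    (hij : vquad k ε δ c si sj a b x xi xij xj = 0)
    (hil : vquad k ε δ c si sl a d x xi xil xl = 0) :
    vquad k ε δ (xor c si) sj sl b d xi xij xijl xil = 0 ↔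
      tetra k ε δ c si sj sl a b d xi xj xl xijl = 0 :=
  far_iff_tetra hij hil (h.coef_ij hij) (h.swap₂₃.coef_ij hil) h.wi h.wj h.wl h.i

theorem CubeEq.tetra (h : CubeEq k ε δ c si sj sl a b d x xi xj xl xij xil xjl xijl)
    (hr : CubeReg k ε δ c si sj sl a b d x xi xj xl) :
    tetra k ε δ c si sj sl a b d xi xj xl xijl = 0 :=
  (hr.tetra_iff h.ij h.il).1 h.jl'

/-- 3D consistency: the three faces away from `x` are each equivalent to the same tetrahedron
equation, by its symmetry in the directions. -/
theorem CubeReg.cubeEq (h : CubeReg k ε δ c si sj sl a b d x xi xj xl)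
    (hij : vquad k ε δ c si sj a b x xi xij xj = 0)
    (hil : vquad k ε δ c si sl a d x xi xil xl = 0)
    (hjl : vquad k ε δ c sj sl b d x xj xjl xl = 0)
    (ht : QuadLagr.tetra k ε δ c si sj sl a b d xi xj xl xijl = 0) :
    CubeEq k ε δ c si sj sl a b d x xi xj xl xij xil xjl xijl where
  ij := hij
  il := hil
  jl := hjl
  jl' := (h.tetra_iff hij hil).2 ht
  il' := (h.swap₁₂.tetra_iff (vquad_swap_iff.2 hij) hjl).2 ((tetra_swap₁₂ ..).2 ht)
  ij' := (h.swap₂₃.swap₁₂.tetra_iff (vquad_swap_iff.2 hil) (vquad_swap_iff.2 hjl)).2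
    ((tetra_swap₁₂ ..).2 ((tetra_swap₂₃ ..).2 ht))

theorem pairH_tetra_ne (h : pairH k ε δ (xor c sj) (xor c sl) (dpar sj sl b d) xj xl ≠ 0) :
    pairH k ε δ (xor (xor c si) (xor si sj)) (xor (xor c si) (xor si sl))
      (dpar (xor si sj) (xor si sl) (bif si then a - b else b - a)
        (bif si then a - d else d - a)) xj xl ≠ 0 := by
  rw [show xor (xor c si) (xor si sj) = xor c sj by cases c <;> cases si <;> cases sj <;> rfl,
    show xor (xor c si) (xor si sl) = xor c sl by cases c <;> cases si <;> cases sl <;> rfl]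
  have key (u v : ℂ) (e : Bool) (huv : v = -u) (hu : pairH k ε δ e e u xj xl ≠ 0) :
      pairH k ε δ e e v xj xl ≠ 0 := by
    rw [huv, pairH_neg]; exact neg_ne_zero.2 hu
  cases si <;> cases sj <;> cases sl <;> simp [dpar] at h ⊢ <;>
    first | exact h | exact key _ _ _ (by ring) h

theorem CubeReg.weight_tetra (h : CubeReg k ε δ c si sj sl a b d x xi xj xl) :
    weight k (xor si sj) (bif si then a - b else b - a) ≠ 0 ∧
    weight k (xor si sl) (bif si then a - d else d - a) ≠ 0 ∧
    weight k (xor (xor si sj) (xor si sl)) (dpar (xor si sj) (xor si sl)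
      (bif si then a - b else b - a) (bif si then a - d else d - a)) ≠ 0 :=
  ⟨weight_par _ _ _ _ _ (weight_diag h.ij), weight_par _ _ _ _ _ (weight_diag h.il),
    weight_dpar _ _ _ _ _ _ _ (weight_diag h.jl)⟩

theorem CubeReg.coef_tetra (h : CubeReg k ε δ c si sj sl a b d x xi xj xl)
    (ht : QuadLagr.tetra k ε δ c si sj sl a b d xi xj xl xijl = 0) :
    coef₃ k ε δ (xor c si) (xor si sj) (xor si sl) (bif si then a - b else b - a)
      (bif si then a - d else d - a) xi xj xl ≠ 0 :=
  (product_identities ht h.weight_tetra.1 h.weight_tetra.2.1 h.weight_tetra.2.2).2.2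
    (pairH_tetra_ne h.jl)

/-- The multiplicative form of the closure relation for the derivative with respect to `a`. -/
theorem CubeEq.prod_i (h : CubeEq k ε δ c si sj sl a b d x xi xj xl xij xil xjl xijl)
    (hr : CubeReg k ε δ c si sj sl a b d x xi xj xl)
    (h' : pairH k ε δ (xor (xor c sj) sl) (xor (xor (xor c sj) sl) si) a xjl xijl ≠ 0) :
    pairH k ε δ (xor c sl) (xor (xor c sl) si) a xl xil *
      pairH k ε δ (xor (xor c sj) si) (xor (xor c sj) sl) (dpar si sl a d) xij xjl *
      pairH k ε δ (xor c si) (xor c sj) (dpar si sj a b) xi xj =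
    pairH k ε δ (xor c sj) (xor (xor c sj) si) a xj xij *
      pairH k ε δ (xor (xor c sl) si) (xor (xor c sl) sj) (dpar si sj a b) xil xjl *
      pairH k ε δ (xor c si) (xor c sl) (dpar si sl a d) xi xl := by
  -- `A` and `B` replace products of opposite edges by products of diagonals on the two faces that
  -- share the edge from `xjl` to `xijl`. `D` is the product identity for the tetrahedron equation,
  -- which relates the diagonals left over. The shared edge is cancelled by `h'`.
  have A := (product_identities h.ij' hr.wi hr.wj (weight_diag hr.ij)).2.1
  have B := (product_identities h.il' hr.wi hr.wl (weight_diag hr.il)).2.1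
  obtain ⟨w1, w2, w3⟩ := hr.weight_tetra
  have D := (product_identities (h.tetra hr) w1 w2 w3).1
  obtain ⟨e₁, he₁, s₁⟩ := pairH_par k ε δ si sj a b
  obtain ⟨e₂, he₂, s₂⟩ := pairH_par k ε δ si sl a d
  rw [s₁, s₂] at D
  rw [show xor (xor (xor c si) (xor si sj)) (xor si sl) = xor (xor (xor c si) (xor si sl)) (xor si sj)
    by cases c <;> cases si <;> cases sj <;> cases sl <;> rfl, s₁,
    show xor (xor (xor c si) (xor si sl)) (xor si sj) = xor (xor (xor c si) (xor si sj)) (xor si sl)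
    by cases c <;> cases si <;> cases sj <;> cases sl <;> rfl, s₂] at D
  have n1 (c s t : Bool) : xor (xor c s) t = xor (xor c t) s := by
    cases c <;> cases s <;> cases t <;> rfl
  have n2 : xor (xor c si) (xor si sj) = xor c sj := by
    cases c <;> cases si <;> cases sj <;> rfl
  have n3 : xor (xor c si) (xor si sl) = xor c sl := by
    cases c <;> cases si <;> cases sl <;> rfl
  have n4 : xor (xor c sj) (xor si sl) = xor (xor (xor c sj) sl) si := by
    cases c <;> cases si <;> cases sj <;> cases sl <;> rfl
  rw [n2, n3, n4] at D
  rw [n1 (xor c sl) si sj, n1 c sl sj] at A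
  rw [n1 (xor c sj) si sl] at B
  rw [n1 c sl sj]
  refine mul_right_cancel₀ h' ?_
  linear_combination (pairH k ε δ (xor (xor c sj) si) (xor (xor c sj) sl) (dpar si sl a d) xij xjl *
      pairH k ε δ (xor c si) (xor c sj) (dpar si sj a b) xi xj) * A
    - (pairH k ε δ (xor (xor c sl) si) (xor (xor c sj) sl) (dpar si sj a b) xil xjl *
      pairH k ε δ (xor c si) (xor c sl) (dpar si sl a d) xi xl) * B
    + (pairH k ε δ (xor (xor c sl) si) (xor (xor c sj) sl) (dpar si sj a b) xil xjl *
      pairH k ε δ (xor (xor c sj) si) (xor (xor c sj) sl) (dpar si sl a d) xij xjl) *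
      (D - pairH k ε δ (xor c si) (xor c sj) (dpar si sj a b) xi xj *
        pairH k ε δ (xor c sl) (xor (xor (xor c sj) sl) si) (dpar si sj a b) xl xijl * he₁
      + pairH k ε δ (xor c si) (xor c sl) (dpar si sl a d) xi xl *
        pairH k ε δ (xor c sj) (xor (xor (xor c sj) sl) si) (dpar si sl a d) xj xijl * he₂)

/-- The multiplicative form of the closure relation for the derivative with respect to `b`. -/
theorem CubeEq.prod_j (h : CubeEq k ε δ c si sj sl a b d x xi xj xl xij xil xjl xijl)
    (hr : CubeReg k ε δ c si sj sl a b d x xi xj xl)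
    (h' : pairH k ε δ (xor (xor c si) sl) (xor (xor (xor c si) sl) sj) b xil xijl ≠ 0) :
    pairH k ε δ (xor c sl) (xor (xor c sl) sj) b xl xjl *
      pairH k ε δ (xor (xor c si) sj) (xor (xor c si) sl) (dpar sj sl b d) xij xil *
      pairH k ε δ (xor c si) (xor c sj) (dpar si sj a b) xi xj =
    pairH k ε δ (xor c si) (xor (xor c si) sj) b xi xij *
      pairH k ε δ (xor (xor c sl) si) (xor (xor c sl) sj) (dpar si sj a b) xil xjl *
      pairH k ε δ (xor c sj) (xor c sl) (dpar sj sl b d) xj xl := by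
  have H := h.swap₁₂.prod_i hr.swap₁₂ h'
  obtain ⟨e, he, hs⟩ := pairH_dpar_swap k ε δ si sj a b
  rw [hs, hs] at H
  refine mul_left_cancel₀ (show e ≠ 0 by rintro rfl; simp at he) ?_
  linear_combination H

/-- The multiplicative form of the closure relation for the derivative with respect to `d`. -/
theorem CubeEq.prod_l (h : CubeEq k ε δ c si sj sl a b d x xi xj xl xij xil xjl xijl)
    (hr : CubeReg k ε δ c si sj sl a b d x xi xj xl)
    (h' : pairH k ε δ (xor (xor c si) sj) (xor (xor (xor c si) sj) sl) d xij xijl ≠ 0) :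
    pairH k ε δ (xor c sj) (xor (xor c sj) sl) d xj xjl *
      pairH k ε δ (xor (xor c si) sj) (xor (xor c si) sl) (dpar sj sl b d) xij xil *
      pairH k ε δ (xor c si) (xor c sl) (dpar si sl a d) xi xl =
    pairH k ε δ (xor c si) (xor (xor c si) sl) d xi xil *
      pairH k ε δ (xor (xor c sj) si) (xor (xor c sj) sl) (dpar si sl a d) xij xjl *
      pairH k ε δ (xor c sj) (xor c sl) (dpar sj sl b d) xj xl := by
  have H := h.swap₂₃.swap₁₂.prod_i hr.swap₂₃.swap₁₂ h'
  obtain ⟨e, he, hs⟩ := pairH_dpar_swap k ε δ si sl a d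
  obtain ⟨f, hf, hs'⟩ := pairH_dpar_swap k ε δ sj sl b d
  rw [hs, hs, hs', hs'] at H
  refine mul_left_cancel₀ (show e * f ≠ 0 from
    mul_ne_zero (by rintro rfl; simp at he) (by rintro rfl; simp at hf)) ?_
  linear_combination H

end cube

/-! ## Local solution of the equations on a cube -/

theorem differentiableAt_vquad {E : Type*} [NormedAddCommGroup E] [NormedSpace ℂ E]
    {a b x xi xij xj : E → ℂ} {e : E} (ha : DifferentiableAt ℂ a e) (hb : DifferentiableAt ℂ b e)
    (hx : DifferentiableAt ℂ x e) (hi : DifferentiableAt ℂ xi e) (hij : DifferentiableAt ℂ xij e)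
    (hj : DifferentiableAt ℂ xj e) (k : Family) (ε δ : ℂ) (c si sj : Bool) :
    DifferentiableAt ℂ (fun z => vquad k ε δ c si sj (a z) (b z) (x z) (xi z) (xij z) (xj z)) e := by
  have hexp (z : ℂ) : exp z ≠ 0 := exp_ne_zero z
  cases k <;> cases c <;> cases si <;> cases sj <;> simp only [vquad, polyH, polyTrap, polyQ] <;>
    fun_prop (disch := exact hexp _)

/-- The third vertex as a function of the others. -/
def solve₃ (k : Family) (ε δ : ℂ) (c si sj : Bool) (a b x xi xj : ℂ) : ℂ :=
  -vquad k ε δ c si sj a b x xi 0 xj / coef₃ k ε δ c si sj a b x xi xj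

theorem vquad_eq_zero_iff {k : Family} {ε δ : ℂ} {c si sj : Bool} {a b x xi xj : ℂ}
    (h : coef₃ k ε δ c si sj a b x xi xj ≠ 0) (y : ℂ) :
    vquad k ε δ c si sj a b x xi y xj = 0 ↔ y = solve₃ k ε δ c si sj a b x xi xj := by
  rw [solve₃, eq_div_iff h, affine₃]
  simp only [coef₃]
  constructor <;> intro h <;> linear_combination h

theorem differentiableAt_coef₃ {E : Type*} [NormedAddCommGroup E] [NormedSpace ℂ E]
    {a b x xi xj : E → ℂ} {e : E} (ha : DifferentiableAt ℂ a e) (hb : DifferentiableAt ℂ b e)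
    (hx : DifferentiableAt ℂ x e) (hi : DifferentiableAt ℂ xi e)
    (hj : DifferentiableAt ℂ xj e) (k : Family) (ε δ : ℂ) (c si sj : Bool) :
    DifferentiableAt ℂ (fun z => coef₃ k ε δ c si sj (a z) (b z) (x z) (xi z) (xj z)) e :=
  (differentiableAt_vquad ha hb hx hi (differentiableAt_const 1) hj ..).sub
    (differentiableAt_vquad ha hb hx hi (differentiableAt_const 0) hj ..)

theorem differentiable_cunif (k : Family) (ε δ : ℂ) (c : Bool) :
    Differentiable ℂ (cunif k ε δ c) := by
  unfold cunif
  generalize (if c then ε else 0) = e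
  cases k <;> simp only [unif]
  · fun_prop
  · fun_prop
  · split_ifs <;> fun_prop

theorem exists_localInverse {f : ℂ → ℂ} (hf : Differentiable ℂ f) {X₀ : ℂ} (h : deriv f X₀ ≠ 0) :
    ∃ g : ℂ → ℂ, (∀ᶠ x in 𝓝 (f X₀), f (g x) = x ∧ DifferentiableAt ℂ g x) ∧
      (∀ᶠ X in 𝓝 X₀, g (f X) = X) := by
  have hc : ContDiffAt ℂ 1 f X₀ := hf.contDiff.contDiffAt
  have hd : HasFDerivAt f (ContinuousLinearEquiv.unitsEquivAut ℂ (Units.mk0 _ h) : ℂ →L[ℂ] ℂ) X₀ := by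
    refine (hf X₀).hasDerivAt.hasFDerivAt.congr_fderiv ?_
    ext
    simp
  have hs := hc.hasStrictFDerivAt' hd one_ne_zero
  refine ⟨hc.localInverse hd one_ne_zero, ?_, hs.eventually_left_inverse⟩
  filter_upwards [hs.eventually_right_inverse,
    (hc.to_localInverse hd one_ne_zero).eventually (by simp)] with x h1 h2
  exact ⟨h1, h2.differentiableAt (by simp)⟩

end

section

/-- The equation is affine in the third vertex with non-zero coefficient, so the field there is an
explicit quotient; a local inverse of the uniformization gives the variable itself, uniquely near
`Y₀`. -/
theorem exists_solution_curve {E : Type*} [NormedAddCommGroup E] [NormedSpace ℂ E] {e₀ : E}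
    {a b x xi xj : E → ℂ} (ha : Differentiable ℂ a) (hb : Differentiable ℂ b)
    (hx : Differentiable ℂ x) (hi : Differentiable ℂ xi) (hj : Differentiable ℂ xj)
    {k : Family} {ε δ : ℂ} {c si sj : Bool} {f : ℂ → ℂ} (hf : Differentiable ℂ f) {Y₀ : ℂ}
    (hd : deriv f Y₀ ≠ 0)
    (hq : vquad k ε δ c si sj (a e₀) (b e₀) (x e₀) (xi e₀) (f Y₀) (xj e₀) = 0)
    (hc : coef₃ k ε δ c si sj (a e₀) (b e₀) (x e₀) (xi e₀) (xj e₀) ≠ 0) :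
    ∃ ψ : E → ℂ, (∀ᶠ e in 𝓝 e₀, DifferentiableAt ℂ ψ e ∧
        vquad k ε δ c si sj (a e) (b e) (x e) (xi e) (f (ψ e)) (xj e) = 0) ∧
      ∀ᶠ w : E × ℂ in 𝓝 (e₀, Y₀),
        vquad k ε δ c si sj (a w.1) (b w.1) (x w.1) (xi w.1) (f w.2) (xj w.1) = 0 →
        w.2 = ψ w.1 := by
  obtain ⟨g, hg, hg'⟩ := exists_localInverse hf hd
  have hC (e) := differentiableAt_coef₃ (ha e) (hb e) (hx e) (hi e) (hj e) k ε δ c si sj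
  have hV (e) := differentiableAt_vquad (ha e) (hb e) (hx e) (hi e)
    (differentiableAt_const (0 : ℂ)) (hj e) k ε δ c si sj
  have hne := (hC e₀).continuousAt.eventually_ne hc
  let y : E → ℂ := fun e => solve₃ k ε δ c si sj (a e) (b e) (x e) (xi e) (xj e)
  have hy : ∀ᶠ e in 𝓝 e₀, DifferentiableAt ℂ y e := by
    filter_upwards [hne] with e he
    simp only [y, solve₃, div_eq_mul_inv]
    exact (hV e).fun_neg.fun_mul ((hC e).fun_inv he)
  have h0 : y e₀ = f Y₀ := ((vquad_eq_zero_iff hc _).1 hq).symm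
  have ht : Tendsto y (𝓝 e₀) (𝓝 (f Y₀)) := h0 ▸ hy.self_of_nhds.continuousAt.tendsto
  refine ⟨fun e => g (y e), ?_, ?_⟩
  · filter_upwards [hy, hne, ht.eventually hg] with e h1 h2 h3
    refine ⟨h3.2.comp e h1, ?_⟩
    rw [vquad_eq_zero_iff h2, h3.1]
  · filter_upwards [(continuous_fst.tendsto (e₀, Y₀)).eventually hne,
      (continuous_snd.tendsto (e₀, Y₀)).eventually hg'] with w h1 h2 h3
    rw [vquad_eq_zero_iff h1] at h3
    rw [← h2, h3]

/-- Near a non-zero value the biquadratic is the exponential of the parameter derivative of a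
potential. -/
theorem eventually_pairH_ne {k : Family} {ε δ : ℂ} {cu cv : Bool} {z₀ : ℂ × ℂ × ℂ}
    (h : pairH k ε δ cu cv z₀.2.2 (cunif k ε δ cu z₀.1) (cunif k ε δ cv z₀.2.1) ≠ 0) :
    ∀ᶠ z in 𝓝 z₀, pairH k ε δ cu cv z.2.2 (cunif k ε δ cu z.1) (cunif k ε δ cv z.2.1) ≠ 0 := by
  obtain ⟨F, P, Q, R, -, hF⟩ := exists_potential h
  filter_upwards [hF] with z hz
  rw [← hz.2.2]
  exact exp_ne_zero _

/-- The equations on a cube: `z` consists of the values of the uniformizing variables at the base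
vertex and its three neighbours and of the three parameters, `y` of the other four values. -/
def CubeSol (k : Family) (ε δ : ℂ) (c si sj sl : Bool) (z : Fin 7 → ℂ) (y : Fin 4 → ℂ) : Prop :=
  CubeEq k ε δ c si sj sl (z 4) (z 5) (z 6) (cunif k ε δ c (z 0)) (cunif k ε δ (xor c si) (z 1))
    (cunif k ε δ (xor c sj) (z 2)) (cunif k ε δ (xor c sl) (z 3))
    (cunif k ε δ (xor (xor c si) sj) (y 0)) (cunif k ε δ (xor (xor c si) sl) (y 1))
    (cunif k ε δ (xor (xor c sj) sl) (y 2)) (cunif k ε δ (xor (xor (xor c si) sj) sl) (y 3))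

/-- The regularity of the data `z`. -/
def CubeSolReg (k : Family) (ε δ : ℂ) (c si sj sl : Bool) (z : Fin 7 → ℂ) : Prop :=
  CubeReg k ε δ c si sj sl (z 4) (z 5) (z 6) (cunif k ε δ c (z 0)) (cunif k ε δ (xor c si) (z 1))
    (cunif k ε δ (xor c sj) (z 2)) (cunif k ε δ (xor c sl) (z 3))

section

variable {k : Family} {ε δ : ℂ} {c si sj sl : Bool} {z₀ : Fin 7 → ℂ} {y₀ : Fin 4 → ℂ}

theorem CubeSolReg.eventually (h : CubeSolReg k ε δ c si sj sl z₀) :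
    ∀ᶠ z in 𝓝 z₀, CubeSolReg k ε δ c si sj sl z := by
  have key (u v : Fin 7) (p : (Fin 7 → ℂ) → ℂ) (hp : Continuous p) (cu cv : Bool)
      (h : pairH k ε δ cu cv (p z₀) (cunif k ε δ cu (z₀ u)) (cunif k ε δ cv (z₀ v)) ≠ 0) :
      ∀ᶠ z in 𝓝 z₀, pairH k ε δ cu cv (p z) (cunif k ε δ cu (z u)) (cunif k ε δ cv (z v)) ≠ 0 := by
    have hc : Continuous fun z : Fin 7 → ℂ => (z u, z v, p z) := by fun_prop
    exact (hc.tendsto z₀).eventually (eventually_pairH_ne (z₀ := (z₀ u, z₀ v, p z₀)) h)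
  have hd (s t : Bool) (u v : Fin 7) : Continuous fun z : Fin 7 → ℂ => dpar s t (z u) (z v) := by
    cases s <;> cases t <;> simp only [dpar, Bool.not_true, Bool.not_false, Bool.and_true,
      Bool.and_false, cond_true, cond_false] <;> fun_prop
  filter_upwards [key 0 1 (fun z => z 4) (by fun_prop) c (xor c si) h.i,
    key 0 2 (fun z => z 5) (by fun_prop) c (xor c sj) h.j,
    key 0 3 (fun z => z 6) (by fun_prop) c (xor c sl) h.l,
    key 1 2 (fun z => dpar si sj (z 4) (z 5)) (hd _ _ _ _) (xor c si) (xor c sj) h.ij,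
    key 1 3 (fun z => dpar si sl (z 4) (z 6)) (hd _ _ _ _) (xor c si) (xor c sl) h.il,
    key 2 3 (fun z => dpar sj sl (z 5) (z 6)) (hd _ _ _ _) (xor c sj) (xor c sl) h.jl]
    with z h1 h2 h3 h4 h5 h6
  exact ⟨h1, h2, h3, h4, h5, h6⟩

/-- The three faces at the base vertex determine `xij`, `xil`, `xjl`, and the tetrahedron equation
determines `xijl`; by `CubeReg.cubeEq` the remaining faces follow. Every nearby solution arises in
this way. -/
theorem exists_cube_solution (hr : CubeSolReg k ε δ c si sj sl z₀)
    (hs : CubeSol k ε δ c si sj sl z₀ y₀)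
    (d0 : deriv (cunif k ε δ (xor (xor c si) sj)) (y₀ 0) ≠ 0)
    (d1 : deriv (cunif k ε δ (xor (xor c si) sl)) (y₀ 1) ≠ 0)
    (d2 : deriv (cunif k ε δ (xor (xor c sj) sl)) (y₀ 2) ≠ 0)
    (d3 : deriv (cunif k ε δ (xor (xor (xor c si) sj) sl)) (y₀ 3) ≠ 0) :
    ∃ Ψ : (Fin 7 → ℂ) → Fin 4 → ℂ,
      (∀ᶠ z in 𝓝 z₀, DifferentiableAt ℂ Ψ z ∧ CubeSol k ε δ c si sj sl z (Ψ z)) ∧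
      ∀ᶠ w : (Fin 7 → ℂ) × (Fin 4 → ℂ) in 𝓝 (z₀, y₀), CubeSol k ε δ c si sj sl w.1 w.2 →
        w.2 = Ψ w.1 := by
  have hp (u : Fin 7) : Differentiable ℂ fun z : Fin 7 → ℂ => z u := by fun_prop
  have hx (e : Bool) (u : Fin 7) : Differentiable ℂ fun z : Fin 7 → ℂ => cunif k ε δ e (z u) :=
    (differentiable_cunif k ε δ e).comp (hp u)
  have hb (s : Bool) (u v : Fin 7) : Differentiable ℂ fun z : Fin 7 → ℂ =>
      bif s then z u - z v else z v - z u := by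
    cases s <;> simp only [cond_true, cond_false] <;> fun_prop
  obtain ⟨ψ₀, h0, h0'⟩ := exists_solution_curve (hp 4) (hp 5) (hx c 0) (hx (xor c si) 1)
    (hx (xor c sj) 2) (differentiable_cunif k ε δ (xor (xor c si) sj)) d0 hs.ij (hr.coef_ij hs.ij)
  obtain ⟨ψ₁, h1, h1'⟩ := exists_solution_curve (hp 4) (hp 6) (hx c 0) (hx (xor c si) 1)
    (hx (xor c sl) 3) (differentiable_cunif k ε δ (xor (xor c si) sl)) d1 hs.il
    (hr.swap₂₃.coef_ij hs.il)
  obtain ⟨ψ₂, h2, h2'⟩ := exists_solution_curve (hp 5) (hp 6) (hx c 0) (hx (xor c sj) 2)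
    (hx (xor c sl) 3) (differentiable_cunif k ε δ (xor (xor c sj) sl)) d2 hs.jl
    (hr.swap₁₂.swap₂₃.coef_ij hs.jl)
  obtain ⟨ψ₃, h3, h3'⟩ := exists_solution_curve (hb si 4 5) (hb si 4 6) (hx (xor c si) 1)
    (hx (xor c sj) 2) (hx (xor c sl) 3)
    (differentiable_cunif k ε δ (xor (xor (xor c si) sj) sl)) d3 (hs.tetra hr)
    (hr.coef_tetra (hs.tetra hr))
  refine ⟨fun z => ![ψ₀ z, ψ₁ z, ψ₂ z, ψ₃ z], ?_, ?_⟩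
  · filter_upwards [h0, h1, h2, h3, hr.eventually] with z a0 a1 a2 a3 hz
    refine ⟨differentiableAt_pi.2 fun u => ?_, hz.cubeEq a0.2 a1.2 a2.2 a3.2⟩
    fin_cases u
    exacts [a0.1, a1.1, a2.1, a3.1]
  · have tw (u : Fin 4) : Tendsto (fun w : (Fin 7 → ℂ) × (Fin 4 → ℂ) => (w.1, w.2 u)) (𝓝 (z₀, y₀))
        (𝓝 (z₀, y₀ u)) :=
      (by fun_prop : Continuous fun w : (Fin 7 → ℂ) × (Fin 4 → ℂ) => (w.1, w.2 u)).tendsto (z₀, y₀)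
    filter_upwards [(tw 0).eventually h0', (tw 1).eventually h1', (tw 2).eventually h2',
      (tw 3).eventually h3', (continuous_fst.tendsto (z₀, y₀)).eventually hr.eventually]
      with w a0 a1 a2 a3 hz hw
    ext u
    fin_cases u
    exacts [a0 hw.ij, a1 hw.il, a2 hw.jl, a3 (hw.tetra hz)]

end

end

section

variable {m : ℕ}

/-! ## Elementary cubes -/

namespace Cube

variable (C : Cube m)

/-- The vertices of a cube. -/
def vtx : Fin 8 → Lattice m :=
  ![C.n, step C.n C.i, step C.n C.j, step C.n C.l, step (step C.n C.i) C.j,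
    step (step C.n C.i) C.l, step (step C.n C.j) C.l, step (step (step C.n C.i) C.j) C.l]

/-- The directions of a cube. -/
def dir : Fin 3 → Fin m := ![C.i, C.j, C.l]

theorem dir_injective : Function.Injective C.dir := by
  have h1 := C.ij.ne
  have h2 := C.jl.ne
  have h3 := (C.ij.trans C.jl).ne
  intro u v h
  fin_cases u <;> fin_cases v <;> simp [dir, h1, h2, h3, h1.symm, h2.symm, h3.symm] at h ⊢

theorem vtx_injective : Function.Injective C.vtx := by
  have h1 := C.ij.ne
  have h2 := C.jl.ne
  have h3 := (C.ij.trans C.jl).ne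
  let f : Lattice m → ℤ × ℤ × ℤ :=
    fun v => (v C.i - C.n C.i, v C.j - C.n C.j, v C.l - C.n C.l)
  have hf : f ∘ C.vtx = ![(0, 0, 0), (1, 0, 0), (0, 1, 0), (0, 0, 1), (1, 1, 0), (1, 0, 1),
      (0, 1, 1), (1, 1, 1)] := by
    funext u
    fin_cases u <;>
      simp [f, vtx, step, Pi.single_apply, h1, h2, h3, h1.symm, h2.symm, h3.symm]
  have : Function.Injective (f ∘ C.vtx) := by
    rw [hf]
    decide
  exact this.of_comp

/-- The values at the base vertex and its neighbours, and the parameters. -/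
def base (X : Lattice m → ℂ) (α : Fin m → ℂ) : Fin 7 → ℂ :=
  ![X C.n, X (step C.n C.i), X (step C.n C.j), X (step C.n C.l), α C.i, α C.j, α C.l]

/-- The values at the other vertices. -/
def far (X : Lattice m → ℂ) : Fin 4 → ℂ :=
  ![X (step (step C.n C.i) C.j), X (step (step C.n C.i) C.l), X (step (step C.n C.j) C.l),
    X (step (step (step C.n C.i) C.j) C.l)]

theorem continuous_base : Continuous fun p : (Lattice m → ℂ) × (Fin m → ℂ) => C.base p.1 p.2 := by
  refine continuous_pi fun u => ?_
  fin_cases u <;> simp [base] <;> fun_prop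

theorem continuous_far : Continuous fun p : (Lattice m → ℂ) × (Fin m → ℂ) => C.far p.1 := by
  refine continuous_pi fun u => ?_
  fin_cases u <;> simp [far] <;> fun_prop

/-- The faces of a cube. -/
def f₁ : Square m := ⟨C.n, C.i, C.j, C.ij⟩
/-- The face opposite to `f₁`. -/
def f₁' : Square m := ⟨step C.n C.l, C.i, C.j, C.ij⟩
/-- The face in the directions `j, l`. -/
def f₂ : Square m := ⟨C.n, C.j, C.l, C.jl⟩
/-- The face opposite to `f₂`. -/
def f₂' : Square m := ⟨step C.n C.i, C.j, C.l, C.jl⟩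
/-- The face in the directions `i, l`. -/
def f₃ : Square m := ⟨C.n, C.i, C.l, C.ij.trans C.jl⟩
/-- The face opposite to `f₃`. -/
def f₃' : Square m := ⟨step C.n C.j, C.i, C.l, C.ij.trans C.jl⟩

theorem faces_eq : C.faces = {C.f₁, C.f₁', C.f₂, C.f₂', C.f₃, C.f₃'} := rfl

theorem solves_iff (s : QuadSystem m) (X : Lattice m → ℂ) (α : Fin m → ℂ) :
    s.Solves X α C.faces ↔ CubeSol s.k s.ε s.δ (s.black C.n) (s.alt C.i) (s.alt C.j) (s.alt C.l)
      (C.base X α) (C.far X) := by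
  have e1 := step_comm C.n C.j C.i
  have e2 := step_comm C.n C.l C.i
  have e3 := step_comm C.n C.l C.j
  have e4 := step_comm (step C.n C.i) C.l C.j
  have h : s.Solves X α C.faces ↔ s.face X α C.n C.i C.j = 0 ∧
      s.face X α (step C.n C.l) C.i C.j = 0 ∧ s.face X α C.n C.j C.l = 0 ∧
      s.face X α (step C.n C.i) C.j C.l = 0 ∧ s.face X α C.n C.i C.l = 0 ∧
      s.face X α (step C.n C.j) C.i C.l = 0 := by
    simp [QuadSystem.Solves, faces]
  have hf (n i j) : s.face X α n i j = vquad s.k s.ε s.δ (s.black n) (s.alt i) (s.alt j) (α i) (α j)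
      (s.field X n) (s.field X (step n i)) (s.field X (step (step n i) j))
      (s.field X (step n j)) := rfl
  rw [h]
  simp only [hf, e1, e2, e3, e4]
  simp only [s.field_eq, s.black_step]
  constructor
  · rintro ⟨h1, h2, h3, h4, h5, h6⟩
    exact ⟨h1, h5, h3, h2, h6, h4⟩
  · rintro ⟨h1, h5, h3, h2, h6, h4⟩
    exact ⟨h1, h2, h3, h4, h5, h6⟩

variable {C} in
theorem cubeSolReg {s : QuadSystem m} {X : Lattice m → ℂ} {α : Fin m → ℂ}
    (h : ∀ q ∈ C.faces, ∀ ℓ ∈ q.links, ℓ.biquad s X α ≠ 0) :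
    CubeSolReg s.k s.ε s.δ (s.black C.n) (s.alt C.i) (s.alt C.j) (s.alt C.l) (C.base X α) := by
  have m1 : C.f₁ ∈ C.faces := by simp [faces_eq]
  have m2 : C.f₂ ∈ C.faces := by simp [faces_eq]
  have m3 : C.f₃ ∈ C.faces := by simp [faces_eq]
  have h1 := h _ m1 (.edge C.n C.i) (by simp [Square.links, f₁])
  have h2 := h _ m1 (.edge C.n C.j) (by simp [Square.links, f₁])
  have h3 := h _ m2 (.edge C.n C.l) (by simp [Square.links, f₂])
  have h4 := h _ m1 (.diag C.f₁) (by simp [Square.links])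
  have h5 := h _ m3 (.diag C.f₃) (by simp [Square.links])
  have h6 := h _ m2 (.diag C.f₂) (by simp [Square.links])
  simp only [Link.biquad, QuadSystem.biquad_eq, Link.src, Link.tgt, Link.par, f₁, f₂, f₃,
    s.black_step, s.diagParam_eq] at h1 h2 h3 h4 h5 h6
  exact ⟨h1, h2, h3, h4, h5, h6⟩

/-- The sum over the cube of the derivatives of the two-form with respect to `α_i`. -/
def clos_i (ρ : Link m → ℂ) : ℂ :=
  (ρ (.edge (step C.n C.l) C.i) - ρ (.diag C.f₁')) - (ρ (.edge C.n C.i) - ρ (.diag C.f₁))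
    - (ρ (.edge (step C.n C.j) C.i) - ρ (.diag C.f₃')) + (ρ (.edge C.n C.i) - ρ (.diag C.f₃))

/-- The sum over the cube of the derivatives of the two-form with respect to `α_j`. -/
def clos_j (ρ : Link m → ℂ) : ℂ :=
  -(ρ (.edge (step C.n C.l) C.j) - ρ (.diag C.f₁')) + (ρ (.edge C.n C.j) - ρ (.diag C.f₁))
    + (ρ (.edge (step C.n C.i) C.j) - ρ (.diag C.f₂')) - (ρ (.edge C.n C.j) - ρ (.diag C.f₂))

/-- The sum over the cube of the derivatives of the two-form with respect to `α_l`. -/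
def clos_l (ρ : Link m → ℂ) : ℂ :=
  -(ρ (.edge (step C.n C.i) C.l) - ρ (.diag C.f₂')) + (ρ (.edge C.n C.l) - ρ (.diag C.f₂))
    + (ρ (.edge (step C.n C.j) C.l) - ρ (.diag C.f₃')) - (ρ (.edge C.n C.l) - ρ (.diag C.f₃))

/-- The three sums of derivatives with respect to the parameters. -/
def clos (ρ : Link m → ℂ) : Fin 3 → ℂ := ![C.clos_i ρ, C.clos_j ρ, C.clos_l ρ]

variable {C} in
-- In each of the three sums the logarithm of the edge at the base vertex cancels. The exponential
-- of the rest is the quotient of the two sides of `CubeEq.prod_i`, `CubeEq.prod_j` or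
-- `CubeEq.prod_l`.
theorem exp_clos {s : QuadSystem m} {X : Lattice m → ℂ} {α : Fin m → ℂ} {ρ : Link m → ℂ}
    (h : ∀ q ∈ C.faces, ∀ ℓ ∈ q.links, exp (ρ ℓ) = ℓ.biquad s X α)
    (hs : s.Solves X α C.faces) (u : Fin 3) : exp (C.clos ρ u) = 1 := by
  have hne : ∀ q ∈ C.faces, ∀ ℓ ∈ q.links, ℓ.biquad s X α ≠ 0 :=
    fun q hq ℓ hℓ => h q hq ℓ hℓ ▸ exp_ne_zero _
  have hr := cubeSolReg hne
  rw [C.solves_iff] at hs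
  have e1 := step_comm C.n C.j C.i
  have e2 := step_comm C.n C.l C.i
  have e3 := step_comm C.n C.l C.j
  have e4 := step_comm (step C.n C.i) C.l C.j
  have m1 : C.f₁ ∈ C.faces := by simp [faces_eq]
  have m2 : C.f₂ ∈ C.faces := by simp [faces_eq]
  have m3 : C.f₃ ∈ C.faces := by simp [faces_eq]
  have m1' : C.f₁' ∈ C.faces := by simp [faces_eq]
  have m2' : C.f₂' ∈ C.faces := by simp [faces_eq]
  have m3' : C.f₃' ∈ C.faces := by simp [faces_eq]
  have dg {q : Square m} (hq : q ∈ C.faces) := h _ hq (.diag q) (by simp [Square.links])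
  have x1 := dg m1
  have x2 := dg m2
  have x3 := dg m3
  have x1' := dg m1'
  have x2' := dg m2'
  have x3' := dg m3'
  have y1 := h _ m1' (.edge (step C.n C.l) C.i) (by simp [Square.links, f₁'])
  have y2 := h _ m1 (.edge (step C.n C.j) C.i) (by simp [Square.links, f₁])
  have y3 := h _ m1' (.edge (step C.n C.l) C.j) (by simp [Square.links, f₁'])
  have y4 := h _ m1 (.edge (step C.n C.i) C.j) (by simp [Square.links, f₁])
  have y5 := h _ m2' (.edge (step C.n C.i) C.l) (by simp [Square.links, f₂'])
  have y6 := h _ m3' (.edge (step C.n C.j) C.l) (by simp [Square.links, f₃'])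
  have n1 := hne _ m3' (.edge (step (step C.n C.j) C.l) C.i) (by simp [Square.links, f₃'])
  have n2 := hne _ m2' (.edge (step (step C.n C.i) C.l) C.j) (by simp [Square.links, f₂'])
  have n3 := hne _ m2' (.edge (step (step C.n C.i) C.j) C.l) (by simp [Square.links, f₂'])
  have e5 := step_comm (step C.n C.j) C.l C.i
  have bc (c p q : Bool) : xor (xor c p) q = xor (xor c q) p := by
    cases c <;> cases p <;> cases q <;> rfl
  have b1 := bc (s.black C.n) (s.alt C.j) (s.alt C.i)
  have b2 := bc (s.black C.n) (s.alt C.l) (s.alt C.i)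
  have b3 := bc (s.black C.n) (s.alt C.l) (s.alt C.j)
  have b4 := bc (xor (s.black C.n) (s.alt C.i)) (s.alt C.l) (s.alt C.j)
  have b5 := bc (xor (s.black C.n) (s.alt C.j)) (s.alt C.l) (s.alt C.i)
  have v0 : C.base X α 0 = X C.n := rfl
  have v1 : C.base X α 1 = X (step C.n C.i) := rfl
  have v2 : C.base X α 2 = X (step C.n C.j) := rfl
  have v3 : C.base X α 3 = X (step C.n C.l) := rfl
  have v4 : C.base X α 4 = α C.i := rfl
  have v5 : C.base X α 5 = α C.j := rfl
  have v6 : C.base X α 6 = α C.l := rfl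
  have w0 : C.far X 0 = X (step (step C.n C.i) C.j) := rfl
  have w1 : C.far X 1 = X (step (step C.n C.i) C.l) := rfl
  have w2 : C.far X 2 = X (step (step C.n C.j) C.l) := rfl
  have w3 : C.far X 3 = X (step (step (step C.n C.i) C.j) C.l) := rfl
  simp only [Link.biquad, QuadSystem.biquad_eq, Link.src, Link.tgt, Link.par, f₁, f₂, f₃, f₁', f₂',
    f₃', e1, e2, e3, e4, e5] at x1 x2 x3 x1' x2' x3' y1 y2 y3 y4 y5 y6 n1 n2 n3
  simp only [s.black_step, s.diagParam_eq, b1, b2, b3, b4, b5]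
    at x1 x2 x3 x1' x2' x3' y1 y2 y3 y4 y5 y6 n1 n2 n3
  have key {u v w : ℂ} (h : exp u = exp v) (hw : w = u - v) : exp w = 1 := by
    rw [hw, exp_sub, h, div_self (exp_ne_zero _)]
  have pi := hs.prod_i hr
  have pj := hs.prod_j hr
  have pl := hs.prod_l hr
  simp only [v0, v1, v2, v3, v4, v5, v6, w0, w1, w2, w3, b1, b2, b3, b4, b5] at pi pj pl
  replace pi := pi n1
  replace pj := pj n2
  replace pl := pl n3
  rw [← y1, ← y2, ← x1, ← x1', ← x3, ← x3', ← exp_add, ← exp_add, ← exp_add, ← exp_add] at pi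
  rw [← y3, ← y4, ← x1, ← x1', ← x2, ← x2', ← exp_add, ← exp_add, ← exp_add, ← exp_add] at pj
  rw [← y5, ← y6, ← x2, ← x2', ← x3, ← x3', ← exp_add, ← exp_add, ← exp_add, ← exp_add] at pl
  fin_cases u
  · refine key pi ?_
    simp only [clos, clos_i, f₁, f₂, f₃, f₁', f₂', f₃', Fin.zero_eta, Matrix.cons_val]
    ring
  · refine key pj.symm ?_
    simp only [clos, clos_j, f₁, f₂, f₃, f₁', f₂', f₃', Fin.mk_one, Matrix.cons_val]
    ring
  · refine key pl ?_
    simp only [clos, clos_l, f₁, f₂, f₃, f₁', f₂', f₃', Fin.reduceFinMk, Matrix.cons_val]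
    ring

end Cube

end

section

variable {m : ℕ}

/-! ## The closure relation -/

/-- The two-form ignores the fourth vertex of a square, so the field at the vertex opposite to the
base does not enter the sum. -/
theorem Cube.flipSum_congr (C : Cube m) {s : QuadSystem m} {𝔏 : Lagrangians m}
    {X X' : Lattice m → ℂ} {α α' : Fin m → ℂ} (hX : ∀ u, X (C.vtx u) = X' (C.vtx u))
    (hα : ∀ u, α (C.dir u) = α' (C.dir u)) : s.flipSum 𝔏 X α C = s.flipSum 𝔏 X' α' C := by
  have h0 : X C.n = X' C.n := hX 0
  have h1 : X (step C.n C.i) = X' (step C.n C.i) := hX 1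
  have h2 : X (step C.n C.j) = X' (step C.n C.j) := hX 2
  have h3 : X (step C.n C.l) = X' (step C.n C.l) := hX 3
  have h4 : X (step (step C.n C.i) C.j) = X' (step (step C.n C.i) C.j) := hX 4
  have h5 : X (step (step C.n C.i) C.l) = X' (step (step C.n C.i) C.l) := hX 5
  have h6 : X (step (step C.n C.j) C.l) = X' (step (step C.n C.j) C.l) := hX 6
  have a0 : α C.i = α' C.i := hα 0
  have a1 : α C.j = α' C.j := hα 1
  have a2 : α C.l = α' C.l := hα 2
  have e1 := step_comm C.n C.j C.i
  have e2 := step_comm C.n C.l C.i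
  have e3 := step_comm C.n C.l C.j
  simp only [QuadSystem.flipSum, s.twoForm_eq, s.diagParam_eq, e1, e2, e3, h0, h1, h2, h3, h4, h5, h6,
    a0, a1, a2]

section

variable {s : QuadSystem m} {𝔏 : Lagrangians m} {P Q R : Link m → ℂ × ℂ × ℂ → ℂ}
  {X₀ : Lattice m → ℂ} {α₀ : Fin m → ℂ} {A : Set (Square m)} {C : Cube m}

theorem Cube.flipSum_eq (hL : s.IsLagrangian 𝔏 X₀ α₀ A) (X : Lattice m → ℂ) (α : Fin m → ℂ) :
    s.flipSum 𝔏 X α C =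
      (s.twoForm 𝔏 X α (step C.n C.i) C.j C.l - s.twoForm 𝔏 X α C.n C.j C.l) -
      (s.twoForm 𝔏 X α (step C.n C.j) C.i C.l - s.twoForm 𝔏 X α C.n C.i C.l) +
      (s.twoForm 𝔏 X α (step C.n C.l) C.i C.j - s.twoForm 𝔏 X α C.n C.i C.j) := by
  rw [QuadSystem.flipSum, s.twoForm_swap hL X α (step C.n C.j) C.i C.l,
    s.twoForm_swap hL X α C.n C.i C.l]
  ring

/-- The derivative of the sum over a cube along a curve of solutions. -/
theorem Cube.hasDerivAt_flipSum (hL : s.IsLagrangian 𝔏 X₀ α₀ A)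
    {Xt : ℂ → Lattice m → ℂ} {αt : ℂ → Fin m → ℂ} {t : ℂ}
    (hsd : ∀ q ∈ C.faces, SquareData s 𝔏 P Q R q (Xt t) (αt t))
    (hX : ∀ u, DifferentiableAt ℂ (fun τ => Xt τ (C.vtx u)) t)
    (hα : ∀ u, DifferentiableAt ℂ (fun τ => αt τ (C.dir u)) t) :
    HasDerivAt (fun τ => s.flipSum 𝔏 (Xt τ) (αt τ) C)
      (∑ u, C.clos (fun ℓ => R ℓ (ℓ.pt s (Xt t) (αt t))) u *
        deriv (fun τ => αt τ (C.dir u)) t) t := by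
  let X' : Lattice m → ℂ := fun v => deriv (fun τ => Xt τ v) t
  let α' : Fin m → ℂ := fun i => deriv (fun τ => αt τ i) t
  have h0 : HasDerivAt (fun τ => Xt τ C.n) (X' C.n) t := (hX 0).hasDerivAt
  have h1 : HasDerivAt (fun τ => Xt τ (step C.n C.i)) (X' (step C.n C.i)) t := (hX 1).hasDerivAt
  have h2 : HasDerivAt (fun τ => Xt τ (step C.n C.j)) (X' (step C.n C.j)) t := (hX 2).hasDerivAt
  have h3 : HasDerivAt (fun τ => Xt τ (step C.n C.l)) (X' (step C.n C.l)) t := (hX 3).hasDerivAt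
  have h4 : HasDerivAt (fun τ => Xt τ (step (step C.n C.i) C.j)) (X' (step (step C.n C.i) C.j)) t :=
    (hX 4).hasDerivAt
  have h5 : HasDerivAt (fun τ => Xt τ (step (step C.n C.i) C.l)) (X' (step (step C.n C.i) C.l)) t :=
    (hX 5).hasDerivAt
  have h6 : HasDerivAt (fun τ => Xt τ (step (step C.n C.j) C.l)) (X' (step (step C.n C.j) C.l)) t :=
    (hX 6).hasDerivAt
  have a0 : HasDerivAt (fun τ => αt τ C.i) (α' C.i) t := (hα 0).hasDerivAt
  have a1 : HasDerivAt (fun τ => αt τ C.j) (α' C.j) t := (hα 1).hasDerivAt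
  have a2 : HasDerivAt (fun τ => αt τ C.l) (α' C.l) t := (hα 2).hasDerivAt
  have e1 := step_comm C.n C.j C.i
  have e2 := step_comm C.n C.l C.i
  have e3 := step_comm C.n C.l C.j
  have sd (q) (hq : q ∈ C.faces) := (hsd q hq).hasDerivAt_twoForm (X' := X') (α' := α')
  have k1 := sd C.f₁ (by simp [faces_eq]) h0 h1 h2 a0 a1
  have k1' := sd C.f₁' (by simp [faces_eq]) h3 (by simp only [f₁', e2]; exact h5)
    (by simp only [f₁', e3]; exact h6) a0 a1
  have k2 := sd C.f₂ (by simp [faces_eq]) h0 h2 h3 a1 a2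
  have k2' := sd C.f₂' (by simp [faces_eq]) h1 h4 h5 a1 a2
  have k3 := sd C.f₃ (by simp [faces_eq]) h0 h1 h3 a0 a2
  have k3' := sd C.f₃' (by simp [faces_eq]) h2 (by simp only [f₃', e1]; exact h4) h6 a0 a2
  have k := ((k2'.sub k2).sub (k3'.sub k3)).add (k1'.sub k1)
  simp only [Cube.flipSum_eq hL]
  refine k.congr_deriv ?_
  simp only [Fin.sum_univ_three, clos, clos_i, clos_j, clos_l, dir, Matrix.cons_val]
  rw [show deriv (fun τ => αt τ C.i) t = α' C.i from rfl,
    show deriv (fun τ => αt τ C.j) t = α' C.j from rfl,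
    show deriv (fun τ => αt τ C.l) t = α' C.l from rfl]
  simp only [f₁, f₂, f₃, f₁', f₂', f₃', e1, e2, e3]
  -- At each vertex the edge legs from the adjacent faces cancel in pairs; only the parameter terms
  -- remain.
  ring

/-- On solutions these sums are integer multiples of 2πi, and they depend continuously on the data.
-/
theorem Adapted.eventually_clos (h : Adapted s 𝔏 P Q R X₀ α₀ A) (hC : C.faces ⊆ A)
    (h0 : ∀ u, C.clos (fun ℓ => R ℓ (ℓ.pt s X₀ α₀)) u = 0) :
    ∀ᶠ p : (Lattice m → ℂ) × (Fin m → ℂ) in 𝓝 (X₀, α₀), s.Solves p.1 p.2 C.faces →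
      (∀ q ∈ C.faces, SquareData s 𝔏 P Q R q p.1 p.2) →
      ∀ u, C.clos (fun ℓ => R ℓ (ℓ.pt s p.1 p.2)) u = 0 := by
  have hR (q) (hq : q ∈ C.faces) (ℓ) (hℓ : ℓ ∈ q.links) : ContinuousAt
      (fun p : (Lattice m → ℂ) × (Fin m → ℂ) => R ℓ (ℓ.pt s p.1 p.2)) (X₀, α₀) :=
    (h.pot q (hC hq) ℓ hℓ).1.2.2.1.tendsto.comp ((ℓ.continuous_pt s).tendsto (X₀, α₀))
  have m1 : C.f₁ ∈ C.faces := by simp [Cube.faces_eq]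
  have m2 : C.f₂ ∈ C.faces := by simp [Cube.faces_eq]
  have m3 : C.f₃ ∈ C.faces := by simp [Cube.faces_eq]
  have m1' : C.f₁' ∈ C.faces := by simp [Cube.faces_eq]
  have m2' : C.f₂' ∈ C.faces := by simp [Cube.faces_eq]
  have m3' : C.f₃' ∈ C.faces := by simp [Cube.faces_eq]
  have dg {q : Square m} (hq : q ∈ C.faces) := hR _ hq (.diag q) (by simp [Square.links])
  have x1 := dg m1
  have x2 := dg m2
  have x3 := dg m3
  have x1' := dg m1'
  have x2' := dg m2'
  have x3' := dg m3'
  have z1 := hR _ m1 (.edge C.n C.i) (by simp [Square.links, Cube.f₁])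
  have z2 := hR _ m1 (.edge C.n C.j) (by simp [Square.links, Cube.f₁])
  have z3 := hR _ m2 (.edge C.n C.l) (by simp [Square.links, Cube.f₂])
  have y1 := hR _ m1' (.edge (step C.n C.l) C.i) (by simp [Square.links, Cube.f₁'])
  have y2 := hR _ m1 (.edge (step C.n C.j) C.i) (by simp [Square.links, Cube.f₁])
  have y3 := hR _ m1' (.edge (step C.n C.l) C.j) (by simp [Square.links, Cube.f₁'])
  have y4 := hR _ m1 (.edge (step C.n C.i) C.j) (by simp [Square.links, Cube.f₁])
  have y5 := hR _ m2' (.edge (step C.n C.i) C.l) (by simp [Square.links, Cube.f₂'])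
  have y6 := hR _ m3' (.edge (step C.n C.j) C.l) (by simp [Square.links, Cube.f₃'])
  have hc (u : Fin 3) : ContinuousAt (fun p : (Lattice m → ℂ) × (Fin m → ℂ) =>
      C.clos (fun ℓ => R ℓ (ℓ.pt s p.1 p.2)) u) (X₀, α₀) := by
    fin_cases u
    · exact (((y1.sub x1').sub (z1.sub x1)).sub (y2.sub x3')).add (z1.sub x3)
    · exact (((y3.sub x1').neg.add (z2.sub x1)).add (y4.sub x2')).sub (z2.sub x2)
    · exact (((y5.sub x2').neg.add (z3.sub x2)).add (y6.sub x3')).sub (z3.sub x3)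
  -- The second family has rate `1`, so its periods are exactly those of the logarithm.
  have hev (u : Fin 3) := eventually_eq_of_isPer (hc u) (continuousAt_const (y := 0)) (h0 u)
    .II 0 true
  filter_upwards [hev 0, hev 1, hev 2] with p p0 p1 p2 hs hsd
  have key (u : Fin 3) : IsPer .II 0 true (C.clos (fun ℓ => R ℓ (ℓ.pt s p.1 p.2)) u - 0) := by
    simpa [IsPer, rate] using Cube.exp_clos (fun q hq => (hsd q hq).exp_eq) hs u
  intro u
  fin_cases u
  exacts [p0 (key 0), p1 (key 1), p2 (key 2)]

end

end

/-! ### Integration of the closure relation along solutions -/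

section

variable {m : ℕ}

section

variable {s : QuadSystem m} {𝔏 : Lagrangians m} {P Q R : Link m → ℂ × ℂ × ℂ → ℂ}
  {X₀ : Lattice m → ℂ} {α₀ : Fin m → ℂ} {A : Set (Square m)} {C : Cube m}

/-- The values at the vertices of a cube. -/
def cubeVals (z : Fin 7 → ℂ) (y : Fin 4 → ℂ) : Fin 8 → ℂ :=
  ![z 0, z 1, z 2, z 3, y 0, y 1, y 2, y 3]

/-- The three parameters. -/
def cubePars (z : Fin 7 → ℂ) : Fin 3 → ℂ := ![z 4, z 5, z 6]

/-- Replace the values of `X₀` on a cube. -/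
def Cube.extX (C : Cube m) (X₀ : Lattice m → ℂ) (z : Fin 7 → ℂ) (y : Fin 4 → ℂ) : Lattice m → ℂ :=
  Function.extend C.vtx (cubeVals z y) X₀

/-- Replace the parameters in the directions of a cube. -/
def Cube.extA (C : Cube m) (α₀ : Fin m → ℂ) (z : Fin 7 → ℂ) : Fin m → ℂ :=
  Function.extend C.dir (cubePars z) α₀

theorem Cube.extX_vtx (C : Cube m) (z : Fin 7 → ℂ) (y : Fin 4 → ℂ) (u : Fin 8) :
    C.extX X₀ z y (C.vtx u) = cubeVals z y u := C.vtx_injective.extend_apply _ _ u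

theorem Cube.extA_dir (C : Cube m) (z : Fin 7 → ℂ) (u : Fin 3) :
    C.extA α₀ z (C.dir u) = cubePars z u := C.dir_injective.extend_apply _ _ u

theorem cubeVals_eq (C : Cube m) (X : Lattice m → ℂ) (α : Fin m → ℂ) (u : Fin 8) :
    cubeVals (C.base X α) (C.far X) u = X (C.vtx u) := by fin_cases u <;> rfl

theorem cubePars_eq (C : Cube m) (X : Lattice m → ℂ) (α : Fin m → ℂ) (u : Fin 3) :
    cubePars (C.base X α) u = α (C.dir u) := by fin_cases u <;> rfl

theorem Cube.extX_base_far (C : Cube m) : C.extX X₀ (C.base X₀ α₀) (C.far X₀) = X₀ := by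
  ext v
  by_cases h : ∃ u, C.vtx u = v
  · obtain ⟨u, rfl⟩ := h
    rw [C.extX_vtx, cubeVals_eq]
  · exact Function.extend_apply' _ _ _ h

theorem Cube.extA_base (C : Cube m) : C.extA α₀ (C.base X₀ α₀) = α₀ := by
  ext v
  by_cases h : ∃ u, C.dir u = v
  · obtain ⟨u, rfl⟩ := h
    rw [C.extA_dir, cubePars_eq]
  · exact Function.extend_apply' _ _ _ h

theorem Cube.base_ext (C : Cube m) (z : Fin 7 → ℂ) (y : Fin 4 → ℂ) :
    C.base (C.extX X₀ z y) (C.extA α₀ z) = z := by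
  ext u
  fin_cases u
  exacts [C.extX_vtx z y 0, C.extX_vtx z y 1, C.extX_vtx z y 2, C.extX_vtx z y 3, C.extA_dir z 0,
    C.extA_dir z 1, C.extA_dir z 2]

theorem Cube.far_ext (C : Cube m) (z : Fin 7 → ℂ) (y : Fin 4 → ℂ) :
    C.far (C.extX X₀ z y) = y := by
  ext u
  fin_cases u
  exacts [C.extX_vtx z y 4, C.extX_vtx z y 5, C.extX_vtx z y 6, C.extX_vtx z y 7]

theorem continuous_cubeVals (u : Fin 8) :
    Continuous fun w : (Fin 7 → ℂ) × (Fin 4 → ℂ) => cubeVals w.1 w.2 u := by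
  fin_cases u <;> simp [cubeVals] <;> fun_prop

theorem continuous_cubePars (u : Fin 3) : Continuous fun z : Fin 7 → ℂ => cubePars z u := by
  fin_cases u <;> simp [cubePars] <;> fun_prop

theorem Cube.continuous_ext (C : Cube m) (X₀ : Lattice m → ℂ) (α₀ : Fin m → ℂ) :
    Continuous fun w : (Fin 7 → ℂ) × (Fin 4 → ℂ) => (C.extX X₀ w.1 w.2, C.extA α₀ w.1) := by
  refine (continuous_pi fun v => ?_).prodMk (continuous_pi fun v => ?_)
  · by_cases h : ∃ u, C.vtx u = v
    · obtain ⟨u, rfl⟩ := h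
      simp only [C.extX_vtx]
      exact continuous_cubeVals u
    · simp only [extX, Function.extend_apply' _ _ _ h]
      exact continuous_const
  · by_cases h : ∃ u, C.dir u = v
    · obtain ⟨u, rfl⟩ := h
      simp only [C.extA_dir]
      exact (continuous_cubePars u).comp continuous_fst
    · simp only [extA, Function.extend_apply' _ _ _ h]
      exact continuous_const

/-- The derivative of the sum along solutions is a combination of the parameter velocities with the
`clos` sums as coefficients. It vanishes either because the parameters do not move or because the
sums are zero; the two alternatives serve the two parts of the theorem. -/
theorem Adapted.eventually_flipSum (h : Adapted s 𝔏 P Q R X₀ α₀ A)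
    (hL : s.IsLagrangian 𝔏 X₀ α₀ A) (hC : C.faces ⊆ A) (hA : s.Regular X₀ α₀ C.faces)
    (hs : s.Solves X₀ α₀ C.faces) (h0 : s.flipSum 𝔏 X₀ α₀ C = 0) :
    ∀ᶠ p : (Lattice m → ℂ) × (Fin m → ℂ) in 𝓝 (X₀, α₀), s.Solves p.1 p.2 C.faces →
      (p.2 = α₀ ∨ ∀ u, C.clos (fun ℓ => R ℓ (ℓ.pt s X₀ α₀)) u = 0) →
      s.flipSum 𝔏 p.1 p.2 C = 0 := by
  have hr := Cube.cubeSolReg fun q hq => Square.biquad_ne_zero hA hq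
  have hs' := (C.solves_iff s X₀ α₀).1 hs
  have v4 := (hA C.f₁ (by simp [Cube.faces_eq])).1.2.2.2
  have v5 := (hA C.f₃ (by simp [Cube.faces_eq])).1.2.2.2
  have v6 := (hA C.f₂ (by simp [Cube.faces_eq])).1.2.2.2
  have v7 := (hA C.f₂' (by simp [Cube.faces_eq])).1.2.2.2
  simp only [s.regularVertex_eq, Cube.f₁, Cube.f₂, Cube.f₃, Cube.f₂', s.black_step] at v4 v5 v6 v7
  obtain ⟨Ψ, hΨ, hΨ'⟩ := exists_cube_solution hr hs' v4 v5 v6 v7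
  set z₀ := C.base X₀ α₀ with hz₀
  have hΨ0 : Ψ z₀ = C.far X₀ := (hΨ'.self_of_nhds hs').symm
  have hsd : ∀ᶠ p : (Lattice m → ℂ) × (Fin m → ℂ) in 𝓝 (X₀, α₀), ∀ q ∈ C.faces,
      s.face p.1 p.2 q.n q.i q.j = 0 → SquareData s 𝔏 P Q R q p.1 p.2 :=
    (Filter.eventually_all_finite (by unfold Cube.faces; exact Set.toFinite _)).2
      fun q hq => h.eventually_squareData (hC hq)
  have hcl : ∀ᶠ p : (Lattice m → ℂ) × (Fin m → ℂ) in 𝓝 (X₀, α₀),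
      (∀ u, C.clos (fun ℓ => R ℓ (ℓ.pt s X₀ α₀)) u = 0) → s.Solves p.1 p.2 C.faces →
      (∀ q ∈ C.faces, SquareData s 𝔏 P Q R q p.1 p.2) →
      ∀ u, C.clos (fun ℓ => R ℓ (ℓ.pt s p.1 p.2)) u = 0 := by
    by_cases hex : ∀ u, C.clos (fun ℓ => R ℓ (ℓ.pt s X₀ α₀)) u = 0
    · filter_upwards [h.eventually_clos hC hex] with p hp _ using hp
    · exact .of_forall fun p hex' => absurd hex' hex
  have ht : Tendsto (fun z => (C.extX X₀ z (Ψ z), C.extA α₀ z)) (𝓝 z₀) (𝓝 (X₀, α₀)) := by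
    have hc : ContinuousAt (fun z => (z, Ψ z)) z₀ :=
      continuousAt_id.prodMk hΨ.self_of_nhds.1.continuousAt
    have e : (C.extX X₀ z₀ (Ψ z₀), C.extA α₀ z₀) = (X₀, α₀) := by
      rw [hΨ0, hz₀, C.extX_base_far, C.extA_base]
    rw [← e]
    exact ((C.continuous_ext X₀ α₀).tendsto (z₀, Ψ z₀)).comp hc.tendsto
  obtain ⟨ρ, hρ, hb⟩ := Metric.eventually_nhds_iff_ball.1
    ((hΨ.and (ht.eventually hsd)).and (ht.eventually hcl))
  have claim : ∀ z ∈ Metric.ball z₀ ρ, (cubePars z = cubePars z₀ ∨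
      ∀ u, C.clos (fun ℓ => R ℓ (ℓ.pt s X₀ α₀)) u = 0) →
      s.flipSum 𝔏 (C.extX X₀ z (Ψ z)) (C.extA α₀ z) C = 0 := by
    intro z hz hor
    -- A segment in the free data stays in the ball, and its parameters are constant whenever its
    -- ends have the same parameters. It is lifted to solutions by `Ψ`.
    let γ : ℂ → Fin 7 → ℂ := fun t => z₀ + t • (z - z₀)
    have hγd : Differentiable ℂ γ := by fun_prop
    let g : ℂ → ℂ := fun t => s.flipSum 𝔏 (C.extX X₀ (γ t) (Ψ (γ t))) (C.extA α₀ (γ t)) C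
    have hγ (t : ℝ) (h0 : 0 ≤ t) (h1 : t ≤ 1) : γ t ∈ Metric.ball z₀ ρ := by
      rw [mem_ball_iff_norm] at hz ⊢
      simp only [γ, add_sub_cancel_left, norm_smul, Complex.norm_real, Real.norm_eq_abs,
        abs_of_nonneg h0]
      exact (mul_le_of_le_one_left (norm_nonneg _) h1).trans_lt hz
    have hd (t : ℝ) (h0 : 0 ≤ t) (h1 : t ≤ 1) : HasDerivAt g 0 t := by
      obtain ⟨⟨⟨b1, b2⟩, b3⟩, b4⟩ := hb _ (hγ t h0 h1)
      have hsol : s.Solves (C.extX X₀ (γ t) (Ψ (γ t))) (C.extA α₀ (γ t)) C.faces := by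
        rw [C.solves_iff, C.base_ext, C.far_ext]
        exact b2
      have hsd' : ∀ q ∈ C.faces, _ := fun q hq => b3 q hq (hsol q hq)
      have hk := Cube.hasDerivAt_flipSum (t := (t : ℂ)) (Xt := fun t => C.extX X₀ (γ t) (Ψ (γ t)))
        (αt := fun t => C.extA α₀ (γ t)) hL hsd' (fun u => ?_) (fun u => ?_)
      · refine hk.congr_deriv (Finset.sum_eq_zero fun u _ => ?_)
        rcases hor with hor | hor
        · have hcon : (fun τ => C.extA α₀ (γ τ) (C.dir u)) = fun _ => cubePars z₀ u := by
            funext τ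
            have hu := congrFun hor u
            rw [C.extA_dir]
            fin_cases u <;> simp [cubePars, γ] at hu ⊢ <;> simp [hu]
          rw [hcon, deriv_const, mul_zero]
        · rw [b4 hor hsol hsd' u, zero_mul]
      · simp only [C.extX_vtx]
        have hψ (v : Fin 4) : DifferentiableAt ℂ (fun τ => Ψ (γ τ) v) (t : ℂ) :=
          (differentiableAt_pi.1 (b1.comp (t : ℂ) (hγd t))) v
        have hz (v : Fin 7) : DifferentiableAt ℂ (fun τ => γ τ v) (t : ℂ) :=
          (differentiableAt_pi.1 (hγd t)) v
        fin_cases u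
        exacts [hz 0, hz 1, hz 2, hz 3, hψ 0, hψ 1, hψ 2, hψ 3]
      · simp only [C.extA_dir]
        have hz (v : Fin 7) : DifferentiableAt ℂ (fun τ => γ τ v) (t : ℂ) :=
          (differentiableAt_pi.1 (hγd t)) v
        fin_cases u
        exacts [hz 4, hz 5, hz 6]
    -- The derivative is complex, but it is integrated only over the real segment from the given
    -- solution to the nearby one.
    have hconst := constant_of_has_deriv_right_zero (f := fun t : ℝ => g t) (a := 0) (b := 1)
      (fun t ht => (hd t ht.1 ht.2).comp_ofReal.continuousAt.continuousWithinAt)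
      (fun t ht => (hd t ht.1 ht.2.le).comp_ofReal.hasDerivWithinAt) 1 (by simp)
    have g1 : g ((1 : ℝ) : ℂ) = s.flipSum 𝔏 (C.extX X₀ z (Ψ z)) (C.extA α₀ z) C := by
      simp [g, γ]
    have g0 : g ((0 : ℝ) : ℂ) = 0 := by
      simp only [g, γ, ofReal_zero, zero_smul, add_zero, hΨ0]
      rw [hz₀, C.extX_base_far, C.extA_base, h0]
    rw [← g1, hconst, g0]
  have hbase := (C.continuous_base.tendsto (X₀, α₀)).eventually (Metric.ball_mem_nhds z₀ hρ)
  have hpair := ((C.continuous_base.prodMk C.continuous_far).tendsto (X₀, α₀)).eventually hΨ'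
  filter_upwards [hbase, hpair] with p h1 h2 hsol hor
  -- Local uniqueness places every nearby solution on the graph of `Ψ`; only its values on the cube
  -- and the three parameters matter.
  have hfar := h2 ((C.solves_iff s p.1 p.2).1 hsol)
  rw [← claim _ h1 ?_]
  · refine C.flipSum_congr (fun u => ?_) (fun u => ?_)
    · rw [C.extX_vtx, ← hfar, cubeVals_eq]
    · rw [C.extA_dir, cubePars_eq]
  · refine hor.imp_left fun hp => funext fun u => ?_
    rw [cubePars_eq, hz₀, cubePars_eq, hp]

end

theorem step_inj (n : Lattice m) {i j : Fin m} : step n i = step n j ↔ i = j := by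
  refine ⟨fun h => ?_, fun h => h ▸ rfl⟩
  by_contra hij
  have := congrFun h i
  simp [step, Pi.single_apply, hij] at this

theorem ne_step (n : Lattice m) (i : Fin m) : n ≠ step n i := by
  intro h
  have := congrFun h i
  simp [step] at this

open Classical in
/-- The logarithms of the biquadratics on the links of a cube can be chosen so that the closure
relations for the derivatives with respect to the parameters hold. -/
theorem Cube.exists_logs (C : Cube m) {s : QuadSystem m} {X : Lattice m → ℂ} {α : Fin m → ℂ}
    (hs : s.Solves X α C.faces) (hr : ∀ q ∈ C.faces, ∀ ℓ ∈ q.links, ℓ.biquad s X α ≠ 0) :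
    ∃ r : Link m → ℂ, (∀ q ∈ C.faces, ∀ ℓ ∈ q.links, exp (r ℓ) = ℓ.biquad s X α) ∧
      ∀ u, C.clos r u = 0 := by
  have h1 := C.ij.ne
  have h2 := C.jl.ne
  have h3 := (C.ij.trans C.jl).ne
  let ρ : Link m → ℂ := fun ℓ => log (ℓ.biquad s X α)
  have hρ : ∀ q ∈ C.faces, ∀ ℓ ∈ q.links, exp (ρ ℓ) = ℓ.biquad s X α :=
    fun q hq ℓ hℓ => exp_log (hr q hq ℓ hℓ)
  have hc := Cube.exp_clos hρ hs
  -- Each of the three edges enters only the sum of its own direction, with coefficient `-1`, `1`,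
  -- `1` respectively, so the corrections make all three sums zero. By `exp_clos` they are multiples
  -- of 2πi and leave the exponentials unchanged.
  refine ⟨fun ℓ => ρ ℓ + (if ℓ = .edge (step C.n C.j) C.i then C.clos ρ 0 else 0)
    - (if ℓ = .edge (step C.n C.i) C.j then C.clos ρ 1 else 0)
    - (if ℓ = .edge (step C.n C.j) C.l then C.clos ρ 2 else 0), fun q hq ℓ hℓ => ?_, fun u => ?_⟩
  · simp only [exp_sub, exp_add, hρ q hq ℓ hℓ, apply_ite exp, hc, exp_zero, ite_self, mul_one,
      div_one]
  · have n1 := ne_step C.n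
    fin_cases u <;>
      simp [clos, clos_i, clos_j, clos_l, step_inj, n1, h1, h2, h3, h1.symm, h2.symm, h3.symm] <;>
      ring

/-- The initial value for the integration: every Lagrangian was normalised to vanish at the given
solution. -/
theorem QuadSystem.flipSum_eq_zero {s : QuadSystem m} {𝔏 : Lagrangians m} {X : Lattice m → ℂ}
    {α : Fin m → ℂ} {A : Set (Square m)} {C : Cube m} (hL : s.IsLagrangian 𝔏 X α A)
    (h : ∀ q ∈ C.faces, ∀ ℓ ∈ q.links, s.val 𝔏 ℓ.src ℓ.tgt (X ℓ.src) (X ℓ.tgt) (ℓ.par s α) = 0) :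
    s.flipSum 𝔏 X α C = 0 := by
  have key (q) (hq : q ∈ C.faces) : s.twoForm 𝔏 X α q.n q.i q.j = 0 := by
    have e1 := h q hq (.edge q.n q.i) (by simp [Square.links])
    have e2 := h q hq (.edge q.n q.j) (by simp [Square.links])
    have e3 := h q hq (.diag q) (by simp [Square.links])
    simp only [Link.src, Link.tgt, Link.par] at e1 e2 e3
    rw [s.twoForm_eq, e1, e2, e3]
    ring
  have k1 := key C.f₁ (by simp [Cube.faces_eq])
  have k1' := key C.f₁' (by simp [Cube.faces_eq])
  have k2 := key C.f₂ (by simp [Cube.faces_eq])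
  have k2' := key C.f₂' (by simp [Cube.faces_eq])
  have k3 := key C.f₃ (by simp [Cube.faces_eq])
  have k3' := key C.f₃' (by simp [Cube.faces_eq])
  simp only [Cube.f₁, Cube.f₁', Cube.f₂, Cube.f₂', Cube.f₃, Cube.f₃'] at k1 k1' k2 k2' k3 k3'
  rw [Cube.flipSum_eq hL, k1, k1', k2, k2', k3, k3']
  ring

end

end QuadLagr

end

/-! ### The flip invariance on one cube and on the whole lattice -/

open QuadLagr in
theorem mainTheorem2 {m : ℕ} (s : QuadSystem m) :
    (∀ (C : Cube m) (X₀ : Lattice m → ℂ) (α₀ : Fin m → ℂ),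
      s.Regular X₀ α₀ C.faces → s.Solves X₀ α₀ C.faces →
      ∃ 𝔏 : Lagrangians m, s.IsLagrangian 𝔏 X₀ α₀ C.faces ∧
        ∀ᶠ p : (Lattice m → ℂ) × (Fin m → ℂ) in 𝓝 (X₀, α₀), s.Solves p.1 p.2 C.faces →
          s.flipSum 𝔏 p.1 p.2 C = 0 ∧
          ∀ Sg Sg' : QuadSurface m, IsFlip C Sg Sg' →
            s.action 𝔏 p.1 p.2 Sg' = s.action 𝔏 p.1 p.2 Sg) ∧
    (∀ (X₀ : Lattice m → ℂ) (α₀ : Fin m → ℂ),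
      s.Regular X₀ α₀ Set.univ → s.Solves X₀ α₀ Set.univ →
      ∃ 𝔏 : Lagrangians m, s.IsLagrangian 𝔏 X₀ α₀ Set.univ ∧
        ∀ C : Cube m, ∀ᶠ X : Lattice m → ℂ in 𝓝 X₀, s.Solves X α₀ C.faces →
          s.flipSum 𝔏 X α₀ C = 0 ∧
          ∀ Sg Sg' : QuadSurface m, IsFlip C Sg Sg' →
            s.action 𝔏 X α₀ Sg' = s.action 𝔏 X α₀ Sg) := by
  constructor
  · intro C X₀ α₀ hA hs
    obtain ⟨r, hr, hc⟩ := C.exists_logs hs fun q hq => Square.biquad_ne_zero hA hq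
    obtain ⟨𝔏, P, Q, R, hL, had, h0⟩ := exists_lagrangians hA hs r hr
    have hc' : ∀ u, C.clos (fun ℓ => R ℓ (ℓ.pt s X₀ α₀)) u = 0 := by
      have m1 : C.f₁ ∈ C.faces := by simp [Cube.faces_eq]
      have m2 : C.f₂ ∈ C.faces := by simp [Cube.faces_eq]
      have m3 : C.f₃ ∈ C.faces := by simp [Cube.faces_eq]
      have m1' : C.f₁' ∈ C.faces := by simp [Cube.faces_eq]
      have m2' : C.f₂' ∈ C.faces := by simp [Cube.faces_eq]
      have m3' : C.f₃' ∈ C.faces := by simp [Cube.faces_eq]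
      have dg {q : Square m} (hq : q ∈ C.faces) := (h0 q hq (.diag q) (by simp [Square.links])).2
      intro u
      rw [← hc u]
      simp only [Cube.clos, Cube.clos_i, Cube.clos_j, Cube.clos_l, dg m1, dg m2, dg m3, dg m1',
        dg m2', dg m3',
        (h0 _ m1 (.edge C.n C.i) (by simp [Square.links, Cube.f₁])).2,
        (h0 _ m1 (.edge C.n C.j) (by simp [Square.links, Cube.f₁])).2,
        (h0 _ m2 (.edge C.n C.l) (by simp [Square.links, Cube.f₂])).2,
        (h0 _ m1' (.edge (step C.n C.l) C.i) (by simp [Square.links, Cube.f₁'])).2,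
        (h0 _ m1 (.edge (step C.n C.j) C.i) (by simp [Square.links, Cube.f₁])).2,
        (h0 _ m1' (.edge (step C.n C.l) C.j) (by simp [Square.links, Cube.f₁'])).2,
        (h0 _ m1 (.edge (step C.n C.i) C.j) (by simp [Square.links, Cube.f₁])).2,
        (h0 _ m2' (.edge (step C.n C.i) C.l) (by simp [Square.links, Cube.f₂'])).2,
        (h0 _ m3' (.edge (step C.n C.j) C.l) (by simp [Square.links, Cube.f₃'])).2]
    have hev := had.eventually_flipSum hL subset_rfl hA hs
      (QuadSystem.flipSum_eq_zero hL fun q hq ℓ hℓ => (h0 q hq ℓ hℓ).1)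
    refine ⟨𝔏, hL, hev.mono fun p hp hsol => ?_⟩
    have := hp hsol (.inr hc')
    exact ⟨this, fun Sg Sg' hf => s.action_flip hL this hf⟩
  · intro X₀ α₀ hA hs
    -- Principal logarithms suffice here: with fixed parameters the sums `clos` are multiplied by
    -- zero, so no compatibility between neighbouring cubes is required.
    obtain ⟨𝔏, P, Q, R, hL, had, h0⟩ := exists_lagrangians hA hs
      (fun ℓ => Complex.log (ℓ.biquad s X₀ α₀))
      fun q hq ℓ hℓ => Complex.exp_log (Square.biquad_ne_zero hA hq ℓ hℓ)
    refine ⟨𝔏, hL, fun C => ?_⟩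
    have hev := had.eventually_flipSum (C := C) hL (Set.subset_univ _) (fun q _ => hA q trivial)
      (fun q _ => hs q trivial)
      (QuadSystem.flipSum_eq_zero hL fun q hq ℓ hℓ => (h0 q trivial ℓ hℓ).1)
    have ht : Filter.Tendsto (fun X : Lattice m → ℂ => (X, α₀)) (𝓝 X₀) (𝓝 (X₀, α₀)) :=
      (Continuous.prodMk_left α₀).tendsto X₀
    refine (ht.eventually hev).mono fun X hp hsol => ?_
    have := hp hsol (.inl rfl)
    exact ⟨this, fun Sg Sg' hf => s.action_flip hL this hf⟩
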